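/- Let $q_*:\mathbb{R}\to\mathbb{R}$ be a critical front of the Ginzburg--Landau equation $A_t=A_{xx}+A-A|A|^2$, i.e. a $C^2$ solution of $$q_*''+2q_*'+q_*-q_*^3=0,\qquad \lim_{x\to-\infty}q_*(x)=1,\quad \lim_{x\to+\infty}q_*(x)=0 .$$ For $\eta_\pm\in\mathbb{R}$ let $\omega_{\eta_-,\eta_+}$ denote a smooth positive function on $\mathbb{R}$ with $\omega_{\eta_-,\eta_+}(x)=e^{\eta_+x}$ for $x\ge 1$ and $\omega_{\eta_-,\eta_+}(x)=e^{\eta_-x}$ for $x\le -1$. For $k\ge 0$ and $1\le \ell\le\infty$ let $W^{k,\ell}_{\mathrm{exp},\eta_-,\eta_+}(\mathbb{R})$ be the space of complex-valued $f$ with norm $\|f\|=\|\omega_{\eta_-,\eta_+}f\|_{W^{k,\ell}}<\infty$, and $L^\ell_{\mathrm{exp},\eta_-,\eta_+}=W^{0,\ell}_{\mathrm{exp},\eta_-,\eta_+}$. Put $\omega=\omega_{0,1}$ and $$\mathcal{L}_\psi=\partial_{xx}+2\bigl(1+(\omega^{-1})'\omega\bigr)\partial_x+(\omega^{-1})''\omega+2(\omega^{-1})'\omega+1-q_*^2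 .$$ Let $\chi_+$ be smooth with $\chi_+(x)=0$ for $x\le 2$ and $\chi_+(x)=1$ for $x\ge 3$, let $\chi_-(x)=\chi_+(-x)$, and let $\nu^+(\lambda)=-1+\sqrt{1+\lambda}$ (principal branch). For $\gamma\in\mathbb{C}$ small and $\beta_\pm\in\mathbb{C}$ define $$F(v,\beta_-,\beta_+;\gamma)=(\mathcal{L}_\psi-\gamma^2)v+\beta_-(\mathcal{L}_\psi-\gamma^2)\bigl(\chi_-e^{\nu^+(\gamma^2)\,\cdot}\bigr)+\beta_+(\mathcal{L}_\psi-\gamma^2)\bigl(\chi_+e^{-\gamma\,\cdot}\bigr).$$ Then there is $\eta_0>0$ such that for every $\eta\in(0,\eta_0)$ and for either pair of spaces $$(X_\eta,Y_\eta)=\bigl(L^\ell_{\mathrm{exp},-\eta,\eta}(\mathbb{R}),\,W^{2,\ell}_{\mathrm{exp},-\eta,\eta}(\mathbb{R})\bigr),\qquad \ell=1\ \text{or}\ \ell=\infty,$$ there is $\delta>0$ such that for every $\gamma\in\mathbb{C}$ with $|\gamma|<\delta$ the linear map $$(v,\beta_-,\beta_+)\mapsto F(v,\beta_-,\beta_+;\gamma):\;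 Y_\eta\times\mathbb{C}^2\to X_\eta$$ is well defined, bounded and invertible with bounded inverse. Writing the unique solution of $F(v,\beta_-,\beta_+;\gamma)=\tilde f$ as $(v,\beta_-,\beta_+)=(T(\gamma)\tilde f,B_-(\gamma)\tilde f,B_+(\gamma)\tilde f)$, the maps $$\gamma\mapsto T(\gamma)\in\mathcal{B}(X_\eta,Y_\eta),\qquad \gamma\mapsto B_\pm(\gamma)\in\mathcal{B}(X_\eta,\mathbb{C})$$ are analytic on $\{|\gamma|<\delta\}$ in the operator norm topologies. -/

import Mathlib

open MeasureTheory Set Filter Topology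
open scoped ENNReal ContDiff

noncomputable section

namespace GLFront

/-! ### Weak derivatives and Sobolev spaces on the real line -/

/-- `g` is the weak (distributional) derivative of `f` on `ℝ`. -/
def IsWeakDeriv (f g : ℝ → ℂ) : Prop :=
  LocallyIntegrable f volume ∧ LocallyIntegrable g volume ∧
    ∀ φ : ℝ → ℝ, ContDiff ℝ ∞ φ → HasCompactSupport φ →
      ∫ x, (deriv φ x) • f x = -∫ x, φ x • g x

open Classical in
/-- A representative of the weak derivative of `f`, unique up to null sets
(the zero function if `f` is not weakly differentiable). -/
def weakDeriv (f : ℝ → ℂ) : ℝ → ℂ :=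
  if h : ∃ g, IsWeakDeriv f g then Classical.choose h else 0

/-- `f ∈ W^{k,ℓ}(ℝ)`: `f` has weak derivatives up to order `k` and all of them, including
`f` itself, belong to `L^ℓ(ℝ)`. -/
def MemSobolev (k : ℕ) (ℓ : ℝ≥0∞) (f : ℝ → ℂ) : Prop :=
  ∃ g : ℕ → ℝ → ℂ, g 0 = f ∧ (∀ j < k, IsWeakDeriv (g j) (g (j + 1))) ∧
    ∀ j ≤ k, MemLp (g j) ℓ volume

theorem IsWeakDeriv.congr {f f' g g' : ℝ → ℂ} (h : IsWeakDeriv f g)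
    (hf : f =ᵐ[volume] f') (hg : g =ᵐ[volume] g') : IsWeakDeriv f' g' := by
  refine ⟨h.1.congr hf, h.2.1.congr hg, fun φ h1 h2 => ?_⟩
  have e1 : ∫ x, (deriv φ x) • f' x = ∫ x, (deriv φ x) • f x :=
    integral_congr_ae (by filter_upwards [hf] with x hx; rw [hx])
  have e2 : ∫ x, φ x • g' x = ∫ x, φ x • g x :=
    integral_congr_ae (by filter_upwards [hg] with x hx; rw [hx])
  rw [e1, e2]
  exact h.2.2 φ h1 h2

theorem IsWeakDeriv.unique {f g g' : ℝ → ℂ} (h : IsWeakDeriv f g) (h' : IsWeakDeriv f g') :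
    g =ᵐ[volume] g' := by
  refine ae_eq_of_integral_contDiff_smul_eq h.2.1 h'.2.1 fun φ h1 h2 => ?_
  have e1 := h.2.2 φ h1 h2
  have e2 := h'.2.2 φ h1 h2
  rw [e1] at e2
  exact neg_injective e2

theorem IsWeakDeriv.add {f g f' g' : ℝ → ℂ} (h : IsWeakDeriv f g) (h' : IsWeakDeriv f' g') :
    IsWeakDeriv (f + f') (g + g') := by
  refine ⟨h.1.add h'.1, h.2.1.add h'.2.1, fun φ h1 h2 => ?_⟩
  have cd : Continuous (deriv φ) := h1.continuous_deriv (by simp)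
  have e1 : ∫ x, (deriv φ x) • (f + f') x
      = (∫ x, (deriv φ x) • f x) + ∫ x, (deriv φ x) • f' x := by
    rw [← integral_add]
    · simp
    · exact h.1.integrable_smul_left_of_hasCompactSupport cd h2.deriv
    · exact h'.1.integrable_smul_left_of_hasCompactSupport cd h2.deriv
  have e2 : ∫ x, φ x • (g + g') x = (∫ x, φ x • g x) + ∫ x, φ x • g' x := by
    rw [← integral_add]
    · simp
    · exact h.2.1.integrable_smul_left_of_hasCompactSupport h1.continuous h2
    · exact h'.2.1.integrable_smul_left_of_hasCompactSupport h1.continuous h2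
  rw [e1, e2, h.2.2 φ h1 h2, h'.2.2 φ h1 h2, neg_add]

theorem IsWeakDeriv.const_smul {f g : ℝ → ℂ} (h : IsWeakDeriv f g) (c : ℂ) :
    IsWeakDeriv (c • f) (c • g) := by
  refine ⟨h.1.smul c, h.2.1.smul c, fun φ h1 h2 => ?_⟩
  have e1 : ∫ x, (deriv φ x) • (c • f) x = c • ∫ x, (deriv φ x) • f x := by
    rw [← integral_smul]
    exact integral_congr_ae (Eventually.of_forall fun x => by
      simp only [Pi.smul_apply]; exact smul_comm _ c _)
  have e2 : ∫ x, φ x • (c • g) x = c • ∫ x, φ x • g x := by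
    rw [← integral_smul]
    exact integral_congr_ae (Eventually.of_forall fun x => by
      simp only [Pi.smul_apply]; exact smul_comm _ c _)
  rw [e1, e2, h.2.2 φ h1 h2, smul_neg]

theorem IsWeakDeriv.weakDeriv_ae {f g : ℝ → ℂ} (h : IsWeakDeriv f g) :
    weakDeriv f =ᵐ[volume] g := by
  have hex : ∃ g, IsWeakDeriv f g := ⟨g, h⟩
  rw [weakDeriv, dif_pos hex]
  exact (Classical.choose_spec hex).unique h

theorem iterate_weakDeriv_ae {k : ℕ} {g : ℕ → ℝ → ℂ}
    (h : ∀ j < k, IsWeakDeriv (g j) (g (j + 1))) :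
    ∀ j ≤ k, weakDeriv^[j] (g 0) =ᵐ[volume] g j := by
  intro j
  induction j with
  | zero => intro _; simp
  | succ j ih =>
    intro hj
    rw [Function.iterate_succ_apply']
    exact ((h j hj).congr (ih (by omega)).symm (ae_eq_refl _)).weakDeriv_ae

theorem MemSobolev.congr {k : ℕ} {ℓ : ℝ≥0∞} {f f' : ℝ → ℂ} (h : MemSobolev k ℓ f)
    (hf : f =ᵐ[volume] f') : MemSobolev k ℓ f' := by
  obtain ⟨g, h0, h1, h2⟩ := h
  have key : ∀ j, g j =ᵐ[volume] Function.update g 0 f' j := by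
    intro j
    rcases eq_or_ne j 0 with rfl | hj
    · simpa [h0] using hf
    · simp [Function.update_of_ne hj]
  exact ⟨Function.update g 0 f', by simp, fun j hj => (h1 j hj).congr (key j) (key (j + 1)),
    fun j hj => (memLp_congr_ae (key j)).1 (h2 j hj)⟩

theorem MemSobolev.add {k : ℕ} {ℓ : ℝ≥0∞} {f f' : ℝ → ℂ} (h : MemSobolev k ℓ f)
    (h' : MemSobolev k ℓ f') : MemSobolev k ℓ (f + f') := by
  obtain ⟨g, h0, h1, h2⟩ := h
  obtain ⟨g', h0', h1', h2'⟩ := h'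
  exact ⟨fun j => g j + g' j, by simp [h0, h0'], fun j hj => (h1 j hj).add (h1' j hj),
    fun j hj => (h2 j hj).add (h2' j hj)⟩

theorem MemSobolev.const_smul {k : ℕ} {ℓ : ℝ≥0∞} {f : ℝ → ℂ} (h : MemSobolev k ℓ f) (c : ℂ) :
    MemSobolev k ℓ (c • f) := by
  obtain ⟨g, h0, h1, h2⟩ := h
  exact ⟨fun j => c • g j, by simp [h0], fun j hj => (h1 j hj).const_smul c,
    fun j hj => (h2 j hj).const_smul c⟩

theorem MemSobolev.zero {k : ℕ} {ℓ : ℝ≥0∞} : MemSobolev k ℓ 0 := by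
  refine ⟨fun _ => 0, rfl, fun j _ => ⟨locallyIntegrable_zero, locallyIntegrable_zero, ?_⟩,
    fun j _ => MemLp.zero⟩
  intro φ _ _
  simp

theorem MemSobolev.memLp_iterate {k : ℕ} {ℓ : ℝ≥0∞} {f : ℝ → ℂ} (h : MemSobolev k ℓ f)
    {j : ℕ} (hj : j ≤ k) : MemLp (weakDeriv^[j] f) ℓ volume := by
  obtain ⟨g, rfl, h1, h2⟩ := h
  exact (memLp_congr_ae (iterate_weakDeriv_ae h1 j hj)).2 (h2 j hj)

theorem MemSobolev.iterate_congr {k : ℕ} {ℓ : ℝ≥0∞} {f f' : ℝ → ℂ} (h : MemSobolev k ℓ f)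
    (hf : f =ᵐ[volume] f') {j : ℕ} (hj : j ≤ k) :
    weakDeriv^[j] f =ᵐ[volume] weakDeriv^[j] f' := by
  obtain ⟨g, rfl, h1, h2⟩ := h
  have key : ∀ i, g i =ᵐ[volume] Function.update g 0 f' i := by
    intro i
    rcases eq_or_ne i 0 with rfl | hi
    · simpa using hf
    · simp [Function.update_of_ne hi]
  have e := iterate_weakDeriv_ae (k := k) (g := Function.update g 0 f')
    (fun i hi => (h1 i hi).congr (key i) (key (i + 1))) j hj
  simp only [Function.update_self] at e
  exact ((iterate_weakDeriv_ae h1 j hj).trans (key j)).trans e.symm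

theorem MemSobolev.iterate_add {k : ℕ} {ℓ : ℝ≥0∞} {f f' : ℝ → ℂ} (h : MemSobolev k ℓ f)
    (h' : MemSobolev k ℓ f') {j : ℕ} (hj : j ≤ k) :
    weakDeriv^[j] (f + f') =ᵐ[volume] weakDeriv^[j] f + weakDeriv^[j] f' := by
  obtain ⟨g, rfl, h1, h2⟩ := h
  obtain ⟨g', rfl, h1', h2'⟩ := h'
  have e := iterate_weakDeriv_ae (k := k) (g := fun i => g i + g' i)
    (fun i hi => (h1 i hi).add (h1' i hi)) j hj
  exact e.trans ((iterate_weakDeriv_ae h1 j hj).add (iterate_weakDeriv_ae h1' j hj)).symm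

theorem MemSobolev.iterate_const_smul {k : ℕ} {ℓ : ℝ≥0∞} {f : ℝ → ℂ} (h : MemSobolev k ℓ f)
    (c : ℂ) {j : ℕ} (hj : j ≤ k) :
    weakDeriv^[j] (c • f) =ᵐ[volume] c • weakDeriv^[j] f := by
  obtain ⟨g, rfl, h1, h2⟩ := h
  have e := iterate_weakDeriv_ae (k := k) (g := fun i => c • g i)
    (fun i hi => (h1 i hi).const_smul c) j hj
  exact e.trans ((iterate_weakDeriv_ae h1 j hj).const_smul c).symm

/-! ### Exponential weights and exponentially weighted Sobolev spaces -/

/-- A smooth positive exponential weight `ω_{η₋,η₊}`. -/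
structure ExpWeight (ηm ηp : ℝ) where
  toFun : ℝ → ℝ
  smooth : ContDiff ℝ ∞ toFun
  pos : ∀ x, 0 < toFun x
  right : ∀ x, 1 ≤ x → toFun x = Real.exp (ηp * x)
  left : ∀ x, x ≤ -1 → toFun x = Real.exp (ηm * x)

instance {ηm ηp : ℝ} : CoeFun (ExpWeight ηm ηp) (fun _ => ℝ → ℝ) := ⟨ExpWeight.toFun⟩

/-- The product `W f` of a weight and a complex function. -/
def ExpWeight.mul {ηm ηp : ℝ} (W : ExpWeight ηm ηp) (f : ℝ → ℂ) : ℝ → ℂ :=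
  fun x => (W x : ℂ) * f x

section Spaces

variable {ηm ηp : ℝ} (W : ExpWeight ηm ηp) (k : ℕ) (ℓ : ℝ≥0∞)

theorem ExpWeight.mul_add_ae (f g : ℝ →ₘ[volume] ℂ) :
    W.mul f + W.mul g =ᵐ[volume] W.mul (f + g : ℝ →ₘ[volume] ℂ) := by
  filter_upwards [AEEqFun.coeFn_add f g] with x hx
  simp only [ExpWeight.mul, Pi.add_apply, hx, mul_add]

theorem ExpWeight.mul_smul_ae (c : ℂ) (f : ℝ →ₘ[volume] ℂ) :
    c • W.mul f =ᵐ[volume] W.mul (c • f : ℝ →ₘ[volume] ℂ) := by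
  filter_upwards [AEEqFun.coeFn_smul c f] with x hx
  simp only [ExpWeight.mul, Pi.smul_apply, hx, smul_eq_mul]
  ring

/-- The (classes of) measurable functions `f : ℝ → ℂ` with `W f ∈ W^{k,ℓ}(ℝ)`. -/
def expSobolevSubmodule : Submodule ℂ (ℝ →ₘ[volume] ℂ) where
  carrier := {f | MemSobolev k ℓ (W.mul f)}
  zero_mem' := by
    refine MemSobolev.congr MemSobolev.zero ?_
    filter_upwards [AEEqFun.coeFn_zero (α := ℝ) (β := ℂ) (μ := volume)] with x hx
    simp [ExpWeight.mul, hx]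
  add_mem' := fun {f g} hf hg => (MemSobolev.add hf hg).congr (W.mul_add_ae f g)
  smul_mem' := fun c f hf => (MemSobolev.const_smul hf c).congr (W.mul_smul_ae c f)

/-- The exponentially weighted Sobolev space `W^{k,ℓ}_{exp,η₋,η₊}(ℝ)`; for `k = 0` this is
`L^ℓ_{exp,η₋,η₊}(ℝ)`. -/
def ExpSobolev : Type := ↥(expSobolevSubmodule W k ℓ)

instance : AddCommGroup (ExpSobolev W k ℓ) :=
  inferInstanceAs (AddCommGroup ↥(expSobolevSubmodule W k ℓ))

instance : Module ℂ (ExpSobolev W k ℓ) :=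
  inferInstanceAs (Module ℂ ↥(expSobolevSubmodule W k ℓ))

/-- Elements of the weighted space are used as functions through a measurable representative. -/
instance : CoeFun (ExpSobolev W k ℓ) (fun _ => ℝ → ℂ) := ⟨fun f => (f.1 : ℝ →ₘ[volume] ℂ)⟩

theorem ExpSobolev.memSobolev (f : ExpSobolev W k ℓ) : MemSobolev k ℓ (W.mul f) := f.2

/-- The tuple of `L^ℓ` classes of `(W f), (W f)', …, (W f)^{(k)}`. -/
def ExpSobolev.derivs [Fact (1 ≤ ℓ)] :
    ExpSobolev W k ℓ →ₗ[ℂ] PiLp ℓ (fun _ : Fin (k + 1) => Lp ℂ ℓ (volume : Measure ℝ)) where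
  toFun f := WithLp.toLp ℓ fun j =>
    ((f.memSobolev W k ℓ).memLp_iterate (Nat.lt_succ_iff.1 j.2)).toLp _
  map_add' f g := by
    ext1 j
    have hj : (j : ℕ) ≤ k := Nat.lt_succ_iff.1 j.2
    refine Eq.trans (MemLp.toLp_congr ((f + g).memSobolev W k ℓ |>.memLp_iterate hj) _ ?_)
      (MemLp.toLp_add ((f.memSobolev W k ℓ).memLp_iterate hj)
      ((g.memSobolev W k ℓ).memLp_iterate hj))
    have e := W.mul_add_ae f.1 g.1
    exact (MemSobolev.iterate_congr ((f.memSobolev W k ℓ).add (g.memSobolev W k ℓ)) e hj).symm.trans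
      ((f.memSobolev W k ℓ).iterate_add (g.memSobolev W k ℓ) hj)
  map_smul' c f := by
    ext1 j
    have hj : (j : ℕ) ≤ k := Nat.lt_succ_iff.1 j.2
    refine Eq.trans (MemLp.toLp_congr ((c • f).memSobolev W k ℓ |>.memLp_iterate hj) _ ?_)
      (MemLp.toLp_const_smul c ((f.memSobolev W k ℓ).memLp_iterate hj))
    have e := W.mul_smul_ae c f.1
    exact (MemSobolev.iterate_congr ((f.memSobolev W k ℓ).const_smul c) e hj).symm.trans
      ((f.memSobolev W k ℓ).iterate_const_smul c hj)

theorem ExpSobolev.derivs_injective [Fact (1 ≤ ℓ)] :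
    Function.Injective (ExpSobolev.derivs W k ℓ) := by
  intro f g h
  have h0 := congrArg (fun u => u.ofLp (0 : Fin (k + 1))) h
  have h1 : W.mul f =ᵐ[volume] W.mul g :=
    (MemLp.toLp_eq_toLp_iff ((f.memSobolev W k ℓ).memLp_iterate (Nat.zero_le k))
      ((g.memSobolev W k ℓ).memLp_iterate (Nat.zero_le k))).1 h0
  refine Subtype.ext (AEEqFun.ext ?_)
  filter_upwards [h1] with x hx
  exact mul_left_cancel₀ (Complex.ofReal_ne_zero.2 (W.pos x).ne') hx

/-- The norm `‖f‖ = ‖W f‖_{W^{k,ℓ}}`, where `‖g‖_{W^{k,ℓ}}` is the `ℓ`-norm of the tuple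
`(‖g‖_{L^ℓ}, ‖g'‖_{L^ℓ}, …, ‖g^{(k)}‖_{L^ℓ})`. -/
instance [Fact (1 ≤ ℓ)] : NormedAddCommGroup (ExpSobolev W k ℓ) :=
  NormedAddCommGroup.induced (ExpSobolev W k ℓ) _ (ExpSobolev.derivs W k ℓ)
    (ExpSobolev.derivs_injective W k ℓ)

instance [Fact (1 ≤ ℓ)] : NormedSpace ℂ (ExpSobolev W k ℓ) :=
  NormedSpace.induced ℂ (ExpSobolev W k ℓ) _ (ExpSobolev.derivs W k ℓ)

end Spaces

/-! ### The critical front, the linearization in the phase, and the far-field/core map -/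

/-- `q` is a (real) critical front: a stationary solution, in the frame moving with speed `2`,
connecting the state `1` at `-∞` to the state `0` at `+∞`. -/
structure IsCriticalFront (q : ℝ → ℝ) : Prop where
  contDiff : ContDiff ℝ 2 q
  ode : ∀ x, deriv (deriv q) x + 2 * deriv q x + q x - q x ^ 3 = 0
  atBot : Tendsto q atBot (𝓝 1)
  atTop : Tendsto q atTop (𝓝 0)

/-- A smooth cutoff `χ₊`, equal to `0` on `(-∞, 2]` and to `1` on `[3, ∞)`. -/
structure IsCutoff (χ : ℝ → ℝ) : Prop where
  smooth : ContDiff ℝ ∞ χ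
  left : ∀ x, x ≤ 2 → χ x = 0
  right : ∀ x, 3 ≤ x → χ x = 1

/-- The operator
`L_ψ = ∂ₓₓ + 2 (1 + (w⁻¹)' w) ∂ₓ + (w⁻¹)'' w + 2 (w⁻¹)' w + 1 - q²`, with weak derivatives. -/
def Lpsi (q w : ℝ → ℝ) (ψ : ℝ → ℂ) : ℝ → ℂ := fun x =>
  weakDeriv (weakDeriv ψ) x
    + ((2 * (1 + deriv (fun y => (w y)⁻¹) x * w x) : ℝ) : ℂ) * weakDeriv ψ x
    + ((deriv (deriv fun y => (w y)⁻¹) x * w x + 2 * (deriv (fun y => (w y)⁻¹) x * w x)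
        + 1 - q x ^ 2 : ℝ) : ℂ) * ψ x

/-- The spatial eigenvalue `ν⁺(λ) = -1 + √(1 + λ)` (principal branch). -/
def nuPlus (lam : ℂ) : ℂ := -1 + (1 + lam) ^ (1 / 2 : ℂ)

/-- The left far-field mode `χ₋ e^{ν⁺(γ²) x}`, where `χ₋(x) = χ₊(-x)`. -/
def modeLeft (χ : ℝ → ℝ) (γ : ℂ) : ℝ → ℂ := fun x =>
  (χ (-x) : ℂ) * Complex.exp (nuPlus (γ ^ 2) * x)

/-- The right far-field mode `χ₊ e^{-γ x}`. -/
def modeRight (χ : ℝ → ℝ) (γ : ℂ) : ℝ → ℂ := fun x =>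
  (χ x : ℂ) * Complex.exp (-γ * x)

/-- The operator `L_ψ - γ²`. -/
def LpsiShift (q w : ℝ → ℝ) (γ : ℂ) (ψ : ℝ → ℂ) : ℝ → ℂ := fun x =>
  Lpsi q w ψ x - γ ^ 2 * ψ x

/-- The far-field/core map
`F(v, β₋, β₊; γ) = (L_ψ - γ²) v + β₋ (L_ψ - γ²)(χ₋ e^{ν⁺(γ²) ·}) + β₊ (L_ψ - γ²)(χ₊ e^{-γ ·})`. -/
def farFieldCore (q w χ : ℝ → ℝ) (v : ℝ → ℂ) (βm βp γ : ℂ) : ℝ → ℂ := fun x =>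
  LpsiShift q w γ v x + βm * LpsiShift q w γ (modeLeft χ γ) x
    + βp * LpsiShift q w γ (modeRight χ γ) x

end GLFront

end

/-! The operator `L_ψ` is `ω L ω⁻¹` with `L = ∂ₓₓ + 2∂ₓ + 1 - q²`. Putting `U = e^x ω⁻¹ ψ` removes
the first order term as well: `L_ψ ψ = f` becomes `U'' - q² U = e^x ω⁻¹ f`. The front equation says
precisely that `u = e^x q` solves the homogeneous equation. Convexity arguments show that `u` and
`u'` are positive and that `u'` is bounded, so `u` grows exactly linearly at `+∞`; at `-∞` the front
tends to `1` exponentially, by a comparison argument. Every solution is then explicit in terms of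
`u` by reduction of order.

The heart of the matter is bijectivity at `γ = 0`. There the two modes are just the cutoffs, and
with `ψ = v + β₋ χ₋ + β₊ χ₊` the problem is to solve `L_ψ ψ = f` with `ψ` approaching constants
`β₋`, `β₊` at the two ends. Injectivity (`eq_zero_of_solution`): a homogeneous solution has `U = u
(A + c ∫ u⁻²)`. The term with `c` makes `ψ` unbounded at `-∞`; once it is gone, `A` makes `ψ` grow
linearly at `+∞`. So both vanish: no bounded resonance exists at the edge of the essential spectrum.
Surjectivity (`IsCriticalFront.exists_solution`): variation of constants gives a solution with one
free constant `A`, chosen so that `U' → 0` at `+∞`. The distance of `ψ` to its limits is then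
bounded by tail integrals of functions in the weighted space, and taking tails preserves that space
(`EMem.tailInt`).

For small `γ`, each mode exponent satisfies the dispersion relation of the constant-coefficient
operator at its own end, so `L_ψ - γ²` maps the mode to an exponentially localized function times
`e^{ζ(γ) x}`. Such products depend holomorphically on `γ` in the weighted space (`exists_expFamily`,
`exists_mode_family`). Hence `γ ↦ F(·; γ)` is a holomorphic family of bounded operators between
Banach spaces. Bijectivity at `0`, the bounded inverse theorem and the smoothness of operator
inversion (`exists_equiv_of_bijective_zero`) give the result near `0`.

The threshold `1/4` for `η` comes from the decay rate proved for `1 - q` at `-∞`; it is convenient,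
not optimal. -/

namespace GLFront

/-! ### Primitives of locally integrable functions and their relation to weak derivatives. -/

/-- `F` is a primitive of the locally integrable function `g`. -/
structure IsPrim (F g : ℝ → ℂ) : Prop where
  loc : LocallyIntegrable g volume
  eq : ∀ x, F x = F 0 + ∫ t in (0 : ℝ)..x, g t

theorem intervalIntegrable_of_loc {E : Type*} [NormedAddCommGroup E] {g : ℝ → E}
    (h : LocallyIntegrable g volume) (a b : ℝ) : IntervalIntegrable g volume a b :=
  intervalIntegrable_iff.mpr
    ((h.integrableOn_isCompact isCompact_uIcc).mono_set uIoc_subset_uIcc)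

namespace IsPrim

variable {F G f g : ℝ → ℂ}

theorem sub_eq (h : IsPrim F g) (x y : ℝ) : F y - F x = ∫ t in x..y, g t := by
  rw [h.eq y, h.eq x, ← intervalIntegral.integral_interval_sub_left
    (intervalIntegrable_of_loc h.loc 0 y) (intervalIntegrable_of_loc h.loc 0 x)]
  ring

theorem continuous (h : IsPrim F g) : Continuous F := by
  have : F = fun x => F 0 + ∫ t in (0 : ℝ)..x, g t := funext h.eq
  rw [this]
  exact continuous_const.add
    (intervalIntegral.continuous_primitive (intervalIntegrable_of_loc h.loc) 0)

theorem add (h : IsPrim F f) (h' : IsPrim G g) : IsPrim (F + G) (f + g) := by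
  refine ⟨h.loc.add h'.loc, fun x => ?_⟩
  simp only [Pi.add_apply]
  rw [intervalIntegral.integral_add (intervalIntegrable_of_loc h.loc _ _)
    (intervalIntegrable_of_loc h'.loc _ _), h.eq x, h'.eq x]
  ring

theorem const_smul (h : IsPrim F f) (c : ℂ) : IsPrim (c • F) (c • f) := by
  refine ⟨h.loc.smul c, fun x => ?_⟩
  simp only [Pi.smul_apply]
  rw [intervalIntegral.integral_smul, h.eq x, smul_add]

theorem congr (h : IsPrim F f) (hg : f =ᵐ[volume] g) : IsPrim F g := by
  refine ⟨h.loc.congr hg, fun x => ?_⟩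
  rw [h.eq x, intervalIntegral.integral_congr_ae (hg.mono fun t ht _ => ht)]

theorem of_hasDerivAt (h : ∀ x, HasDerivAt F (g x) x) (hg : Continuous g) : IsPrim F g := by
  refine ⟨hg.locallyIntegrable, fun x => ?_⟩
  rw [intervalIntegral.integral_eq_sub_of_hasDerivAt (fun t _ => h t)
    (hg.intervalIntegrable _ _)]
  ring

theorem hasDerivAt (h : IsPrim F g) (hg : Continuous g) (x : ℝ) : HasDerivAt F (g x) x := by
  have : F = fun x => F 0 + ∫ t in (0 : ℝ)..x, g t := funext h.eq
  rw [this]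
  exact (intervalIntegral.integral_hasDerivAt_right (hg.intervalIntegrable _ _)
    (hg.stronglyMeasurableAtFilter _ _) hg.continuousAt).const_add _

theorem of_loc (h : LocallyIntegrable g volume) : IsPrim (fun x => ∫ t in (0 : ℝ)..x, g t) g :=
  ⟨h, fun x => by simp⟩

end IsPrim

theorem absolutelyContinuousOnInterval_ofReal {h : ℝ → ℝ} {a b : ℝ}
    (hh : AbsolutelyContinuousOnInterval h a b) :
    AbsolutelyContinuousOnInterval (fun x => (h x : ℂ)) a b := by
  unfold AbsolutelyContinuousOnInterval at hh ⊢
  refine hh.congr fun E => Finset.sum_congr rfl fun i _ => ?_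
  rw [Complex.dist_eq, ← Complex.ofReal_sub, Complex.norm_real, Real.dist_eq, Real.norm_eq_abs]

theorem absolutelyContinuousOnInterval_const (c : ℂ) (a b : ℝ) :
    AbsolutelyContinuousOnInterval (fun _ : ℝ => c) a b :=
  ((contDiff_const (c := c) (n := 1) (𝕜 := ℝ) (E := ℝ)).contDiffOn).absolutelyContinuousOnInterval

namespace IsPrim

variable {F G f g a a' : ℝ → ℂ}

/-- Absolute continuity of an indefinite integral is applied to the real and imaginary parts
separately and recombined. -/
theorem absolutelyContinuous (h : IsPrim F g) (x y : ℝ) :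
    AbsolutelyContinuousOnInterval F x y := by
  have hi := intervalIntegrable_of_loc h.loc x y
  have hre : IntervalIntegrable (fun t => (g t).re) volume x y := ⟨hi.1.re, hi.2.re⟩
  have him : IntervalIntegrable (fun t => (g t).im) volume x y := ⟨hi.1.im, hi.2.im⟩
  have h1 := absolutelyContinuousOnInterval_ofReal
    (hre.absolutelyContinuousOnInterval_intervalIntegral (c := x) (by simp))
  have h2 := (absolutelyContinuousOnInterval_ofReal
    (him.absolutelyContinuousOnInterval_intervalIntegral (c := x) (by simp))).const_smul Complex.I
  have h3 := ((absolutelyContinuousOnInterval_const (F x) x y).add h1).add h2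
  suffices e : F = ((fun _ => F x) + fun z => ((∫ v in x..z, (g v).re : ℝ) : ℂ)) +
      fun z => Complex.I • ((∫ v in x..z, (g v).im : ℝ) : ℂ) by
    rw [e]; exact h3
  funext z
  have hz := intervalIntegrable_of_loc h.loc x z
  have e : F z = F x + ∫ t in x..z, g t := by rw [← h.sub_eq x z]; ring
  have e1 : ∫ t in x..z, g t = ∫ t in x..z, (((g t).re : ℂ) + Complex.I * ((g t).im : ℂ)) := by
    congr 1; ext t; rw [mul_comm, Complex.re_add_im]
  rw [e, e1, intervalIntegral.integral_add, intervalIntegral.integral_const_mul,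
    intervalIntegral.integral_ofReal, intervalIntegral.integral_ofReal]
  · simp [add_assoc]
  · constructor
    · exact hz.1.re.ofReal
    · exact hz.2.re.ofReal
  · refine IntervalIntegrable.const_mul ?_ _
    constructor
    · exact hz.1.im.ofReal
    · exact hz.2.im.ofReal

theorem ae_hasDerivAt (h : IsPrim F g) : ∀ᵐ x, HasDerivAt F (g x) x := by
  have : F = fun x => F 0 + ∫ t in (0 : ℝ)..x, g t := funext h.eq
  rw [this]
  filter_upwards [LocallyIntegrable.ae_hasDerivAt_integral h.loc] with x hx
  exact (hx 0).const_add _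

/-- The difference between `a F` and the integral of the product-rule expression is absolutely
continuous with derivative zero almost everywhere, hence constant. -/
theorem mul (h : IsPrim F f) (ha : IsPrim a a') :
    IsPrim (fun x => a x * F x) (fun x => a' x * F x + a x * f x) := by
  have hl : LocallyIntegrable (fun x => a' x * F x + a x * f x) volume := by
    refine LocallyIntegrable.add ?_ ?_
    · have := ha.loc.locallyIntegrableOn univ |>.mul_continuousOn
        h.continuous.continuousOn isClosed_univ.isLocallyClosed
      exact locallyIntegrableOn_univ.1 this
    · have := h.loc.locallyIntegrableOn univ |>.continuousOn_mul
        ha.continuous.continuousOn isClosed_univ.isLocallyClosed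
      exact locallyIntegrableOn_univ.1 this
  refine ⟨hl, fun x => ?_⟩
  have hP := IsPrim.of_loc hl
  have hac : AbsolutelyContinuousOnInterval
      (fun y => a y • F y - ∫ t in (0 : ℝ)..y, (a' t * F t + a t * f t)) 0 x :=
    ((ha.absolutelyContinuous 0 x).smul (h.absolutelyContinuous 0 x)).sub
      (hP.absolutelyContinuous 0 x)
  obtain ⟨C, hC⟩ := hac.const_of_ae_hasDerivAt_zero (by
    filter_upwards [h.ae_hasDerivAt, ha.ae_hasDerivAt, hP.ae_hasDerivAt] with y h1 h2 h3 _
    have := (h2.mul h1).sub h3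
    rw [sub_self] at this
    exact this)
  have e0 := hC 0 (by simp)
  have e1 := hC x (by simp)
  simp only [intervalIntegral.integral_same, smul_eq_mul, sub_zero] at e0 e1
  rw [e0, ← e1]; ring

theorem isWeakDeriv (h : IsPrim F g) : IsWeakDeriv F g := by
  refine ⟨h.continuous.locallyIntegrable, h.loc, fun φ h1 h2 => ?_⟩
  have hd : IsPrim (fun x => (φ x : ℂ)) (fun x => ((deriv φ x : ℝ) : ℂ)) :=
    of_hasDerivAt (fun x => ((h1.differentiable (by simp)) x).hasDerivAt.ofReal_comp)
      (Complex.continuous_ofReal.comp (h1.continuous_deriv (by simp)))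
  have hm := h.mul hd
  have cd : Continuous (deriv φ) := h1.continuous_deriv (by simp)
  have i1 := h.continuous.locallyIntegrable (μ := volume)
    |>.integrable_smul_left_of_hasCompactSupport cd h2.deriv
  have i2 := h.loc.integrable_smul_left_of_hasCompactSupport h1.continuous h2
  rw [← add_eq_zero_iff_eq_neg, ← integral_add i1 i2]
  obtain ⟨R, hR⟩ := h2.isCompact.isBounded.subset_closedBall 0
  have hz : ∀ x, R < |x| → φ x = 0 := fun x hx => by
    by_contra hne
    have := hR (subset_tsupport _ hne)
    simp at this; linarith
  have hzd : ∀ x, R < |x| → deriv φ x = 0 := fun x hx => by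
    by_contra hne
    have := hR (support_deriv_subset hne)
    simp at this; linarith
  -- The interval strictly contains the support of `φ`, so the boundary terms of the integration by
  -- parts vanish.
  have hS := hm.sub_eq (-(|R| + 1)) (|R| + 1)
  have hb : R < |(|R| + 1)| := by
    rw [abs_of_nonneg (by positivity)]; linarith [le_abs_self R]
  rw [hz _ hb, hz (-(|R| + 1)) (by rwa [abs_neg])] at hS
  simp only [Complex.ofReal_zero, zero_mul, sub_zero] at hS
  rw [intervalIntegral.integral_eq_integral_of_support_subset] at hS
  · rw [hS]; congr 1
  · intro x hx
    by_contra hne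
    apply hx
    have : R < |x| := by
      by_contra hle
      push Not at hle
      have := abs_le.1 hle
      exact hne ⟨by linarith [le_abs_self R], by linarith [le_abs_self R]⟩
    simp [hz x this, hzd x this]

end IsPrim

/-- The du Bois-Reymond argument: subtracting from a test function its mass times a fixed bump
leaves a mean-zero function, whose primitive `Ψ` is again a test function. Testing against `Ψ`
identifies `d` with the constant `∫ φ₀ d`. -/
theorem ae_const_of_isWeakDeriv_zero {d : ℝ → ℂ} (h : IsWeakDeriv d 0) :
    ∃ c : ℂ, d =ᵐ[volume] fun _ => c := by
  let B : ContDiffBump (0 : ℝ) := ⟨1, 2, by norm_num, by norm_num⟩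
  let φ₀ := B.normed volume
  have s0 : ContDiff ℝ ∞ φ₀ := B.contDiff_normed
  have c0 : HasCompactSupport φ₀ := B.hasCompactSupport_normed
  have t0 : ∫ x, φ₀ x = 1 := B.integral_normed
  refine ⟨∫ x, φ₀ x • d x, ae_eq_of_integral_contDiff_smul_eq h.1
    (continuous_const.locallyIntegrable) fun φ h1 h2 => ?_⟩
  set m := ∫ x, φ x with hm
  let θ : ℝ → ℝ := fun x => φ x - m * φ₀ x
  have sθ : ContDiff ℝ ∞ θ := h1.sub (contDiff_const.mul s0)
  have iφ : Integrable φ := h1.continuous.integrable_of_hasCompactSupport h2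
  have i0 : Integrable φ₀ := s0.continuous.integrable_of_hasCompactSupport c0
  have cθ : HasCompactSupport θ := h2.sub (c0.mul_left (f := fun _ => m))
  have iθ : Integrable θ := sθ.continuous.integrable_of_hasCompactSupport cθ
  have tθ : ∫ x, θ x = 0 := by
    simp only [θ]
    rw [integral_sub iφ (i0.const_mul m), integral_const_mul, t0, ← hm]; ring
  obtain ⟨R, hR⟩ := cθ.isCompact.isBounded.subset_closedBall 0
  have hz : ∀ x, R < |x| → θ x = 0 := fun x hx => by
    by_contra hne
    have := hR (subset_tsupport _ hne)
    simp at this; linarith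
  let Ψ : ℝ → ℝ := fun x => ∫ t in (-(|R| + 1))..x, θ t
  have dΨ : ∀ x, HasDerivAt Ψ (θ x) x := fun x =>
    intervalIntegral.integral_hasDerivAt_right (sθ.continuous.intervalIntegrable _ _)
      (sθ.continuous.stronglyMeasurableAtFilter _ _) sθ.continuous.continuousAt
  have eΨ : deriv Ψ = θ := funext fun x => (dΨ x).deriv
  have sΨ : ContDiff ℝ ∞ Ψ := by
    rw [contDiff_infty_iff_deriv, eΨ]
    exact ⟨fun x => (dΨ x).differentiableAt, sθ⟩
  have cΨ : HasCompactSupport Ψ := by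
    refine HasCompactSupport.intro (isCompact_closedBall (0 : ℝ) (|R| + 1)) fun x hx => ?_
    have hx' : |R| + 1 < |x| := by simpa using hx
    rcases lt_abs.1 hx' with hp | hn
    · have e : Ψ x = ∫ t, θ t := by
        apply intervalIntegral.integral_eq_integral_of_support_subset
        intro y hy
        by_contra hne
        refine hy (hz y ?_)
        by_contra hle
        push Not at hle
        have := abs_le.1 hle
        exact hne ⟨by linarith [le_abs_self R], by linarith [le_abs_self R]⟩
      rw [e, tθ]
    · refine intervalIntegral.integral_zero_ae (Eventually.of_forall fun y hy => hz y ?_)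
      rw [uIoc_of_ge (by linarith)] at hy
      rw [lt_abs]; right
      linarith [hy.2, le_abs_self R]
  have key := h.2.2 Ψ sΨ cΨ
  rw [eΨ] at key
  simp only [Pi.zero_apply, smul_zero, integral_zero, neg_zero, θ] at key
  have j1 := h.1.integrable_smul_left_of_hasCompactSupport h1.continuous h2
  have j0 := h.1.integrable_smul_left_of_hasCompactSupport s0.continuous c0
  have e : ∫ x, (φ x - m * φ₀ x) • d x = (∫ x, φ x • d x) - m • ∫ x, φ₀ x • d x := by
    rw [← integral_smul, ← integral_sub j1 (by exact j0.smul m)]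
    refine integral_congr_ae (Eventually.of_forall fun x => ?_)
    simp only [sub_smul, mul_smul]
  rw [e, sub_eq_zero] at key
  rw [key, integral_smul_const]

/-- Subtracting the indefinite integral of `g` leaves a function with zero weak derivative. This
lets weak solutions be treated as absolutely continuous functions. -/
theorem IsWeakDeriv.exists_isPrim {f g : ℝ → ℂ} (h : IsWeakDeriv f g) :
    ∃ F, f =ᵐ[volume] F ∧ IsPrim F g := by
  have hP := IsPrim.of_loc h.2.1
  have hd := h.add (hP.isWeakDeriv.const_smul (-1))
  obtain ⟨c, hc⟩ := ae_const_of_isWeakDeriv_zero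
    (hd.congr (ae_eq_refl _) (Eventually.of_forall fun x => by simp))
  refine ⟨fun x => c + ∫ t in (0 : ℝ)..x, g t, ?_, h.2.1, fun x => by simp⟩
  filter_upwards [hc] with x hx
  rw [← hx]; simp

theorem IsWeakDeriv.mul {f g a a' : ℝ → ℂ} (h : IsWeakDeriv f g) (ha : IsPrim a a') :
    IsWeakDeriv (fun x => a x * f x) (fun x => a' x * f x + a x * g x) := by
  obtain ⟨F, hF, hP⟩ := h.exists_isPrim
  refine (hP.mul ha).isWeakDeriv.congr ?_ ?_ <;>
  · filter_upwards [hF] with x hx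
    rw [hx]

/-! ### Positivity, growth and decay of the critical front. -/

theorem exists_forall_Iic_le_mul {f g : ℝ → ℝ} (hf : Continuous f) (hg : Continuous g)
    (hpos : ∀ x, 0 < g x) {a C : ℝ} (h : ∀ x ≤ a, |f x| ≤ C * g x) (b : ℝ) :
    ∃ C', 0 < C' ∧ ∀ x ≤ b, |f x| ≤ C' * g x := by
  obtain ⟨D, hD⟩ := (isCompact_Icc (a := a) (b := b)).exists_bound_of_continuousOn
    (f := fun x => f x / g x) ((hf.div hg fun x => (hpos x).ne').continuousOn)
  refine ⟨max (max C D) 1, by positivity, fun x hx => ?_⟩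
  rcases le_total x a with h1 | h1
  · refine (h x h1).trans (mul_le_mul_of_nonneg_right ?_ (hpos x).le)
    exact (le_max_left _ _).trans (le_max_left _ _)
  · have h2 := hD x ⟨h1, hx⟩
    rw [Real.norm_eq_abs, abs_div, abs_of_pos (hpos x), div_le_iff₀ (hpos x)] at h2
    refine h2.trans (mul_le_mul_of_nonneg_right ?_ (hpos x).le)
    exact (le_max_right _ _).trans (le_max_left _ _)

/-- A one-dimensional maximum principle on a left half-line. -/
theorem nonneg_of_deriv_deriv_neg_of_neg {z : ℝ → ℝ} (hz : Continuous z) {b : ℝ}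
    (hb : 0 ≤ z b) (h0 : Tendsto z atBot (𝓝 0))
    (hneg : ∀ x < b, z x < 0 → deriv z x = 0 → deriv (deriv z) x < 0) :
    ∀ x ≤ b, 0 ≤ z x := by
  by_contra! hcon
  obtain ⟨x, hxb, hx⟩ := hcon
  have hev : ∀ᶠ y in atBot, z x < z y := h0.eventually (lt_mem_nhds hx)
  obtain ⟨a, ha⟩ := eventually_atBot.1 hev
  have hax : a < x := by
    by_contra hle
    exact lt_irrefl _ (ha x (not_lt.1 hle))
  obtain ⟨y, hy, hmin⟩ := isCompact_Icc.exists_isMinOn (nonempty_Icc.2 (hax.le.trans hxb))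
    hz.continuousOn
  have hyx : z y ≤ z x := hmin ⟨hax.le, hxb⟩
  have hy1 : a < y := by
    rcases hy.1.lt_or_eq with h | h
    · exact h
    · have := ha y h.ge; linarith
  have hy2 : y < b := by
    rcases hy.2.lt_or_eq with h | h
    · exact h
    · rw [h] at hyx; linarith
  have hloc : IsLocalMin z y := hmin.isLocalMin (Icc_mem_nhds hy1 hy2)
  have hd := hloc.deriv_eq_zero
  have hdd := hneg y hy2 (by linarith) hd
  -- An interior minimum with negative second derivative is also a local maximum, so `z` is locally
  -- constant there and its second derivative is zero.
  have hmax := isLocalMax_of_deriv_deriv_neg hdd hd hz.continuousAt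
  have hconst : z =ᶠ[𝓝 y] fun _ => z y := by
    filter_upwards [hloc, hmax] with t h1 h2
    exact le_antisymm h2 h1
  have h1 : deriv z =ᶠ[𝓝 y] fun _ => 0 := by
    have := hconst.deriv
    simpa using this
  have h2 := h1.deriv_eq
  simp at h2
  linarith

namespace IsCriticalFront

variable {q : ℝ → ℝ} (hq : IsCriticalFront q)
include hq

theorem hasDerivAt (x : ℝ) : HasDerivAt q (deriv q x) x :=
  (hq.contDiff.differentiable (by simp) x).hasDerivAt

theorem contDiff_deriv : ContDiff ℝ 1 (deriv q) :=
  ((contDiff_succ_iff_deriv (n := 1)).1 hq.contDiff).2.2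

theorem hasDerivAt_deriv (x : ℝ) : HasDerivAt (deriv q) (deriv (deriv q) x) x :=
  (hq.contDiff_deriv.differentiable (by simp) x).hasDerivAt

theorem continuous : Continuous q := hq.contDiff.continuous

theorem hasDerivAt_u (x : ℝ) :
    HasDerivAt (fun y => Real.exp y * q y) (Real.exp x * (q x + deriv q x)) x :=
  ((Real.hasDerivAt_exp x).mul (hq.hasDerivAt x)).congr_deriv (by ring)

/-- The front equation in conjugated form: `u = e^x q` satisfies the linear-looking identity `u'' =
q² u`. -/
theorem hasDerivAt_u' (x : ℝ) :
    HasDerivAt (fun y => Real.exp y * (q y + deriv q y)) (q x ^ 2 * (Real.exp x * q x)) x := by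
  refine ((Real.hasDerivAt_exp x).mul ((hq.hasDerivAt x).add (hq.hasDerivAt_deriv x))).congr_deriv ?_
  have := hq.ode x
  simp only [Pi.add_apply]
  linear_combination Real.exp x * this

theorem tendsto_u_atBot : Tendsto (fun y => Real.exp y * q y) Filter.atBot (𝓝 0) := by
  simpa using Real.tendsto_exp_atBot.mul hq.atBot

theorem continuous_u : Continuous (fun y => Real.exp y * q y) :=
  Real.continuous_exp.mul hq.continuous

theorem exists_half_lt : ∃ a, ∀ x ≤ a, 1 / 2 < q x :=
  eventually_atBot.1 (hq.atBot.eventually (lt_mem_nhds (by norm_num)))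

/-- Near `-∞` the front is above `1/2`, so `u` is positive and strictly convex. Were `u'` negative
at some point, `u` would decrease on the whole half-line to its left from its limit `0`,
contradicting positivity. -/
theorem exists_left_pos :
    ∃ a, ∀ x ≤ a, 0 < Real.exp x * q x ∧ 0 < Real.exp x * (q x + deriv q x) := by
  obtain ⟨a, ha⟩ := hq.exists_half_lt
  have hu : ∀ x ≤ a, 0 < Real.exp x * q x := fun x hx =>
    mul_pos (Real.exp_pos x) (by linarith [ha x hx])
  have hmono : StrictMonoOn (fun y => Real.exp y * (q y + deriv q y)) (Iic a) := by
    refine strictMonoOn_of_deriv_pos (convex_Iic a)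
      (fun x _ => (hq.hasDerivAt_u' x).continuousAt.continuousWithinAt) fun x hx => ?_
    rw [interior_Iic] at hx
    rw [(hq.hasDerivAt_u' x).deriv]
    have := ha x (le_of_lt hx)
    exact mul_pos (by positivity) (hu x (le_of_lt hx))
  have hnn : ∀ x ≤ a, 0 ≤ Real.exp x * (q x + deriv q x) := by
    intro x hx
    by_contra! hlt
    have hanti : AntitoneOn (fun y => Real.exp y * q y) (Iic x) := by
      refine antitoneOn_of_deriv_nonpos (convex_Iic x) hq.continuous_u.continuousOn
        (fun y _ => (hq.hasDerivAt_u y).differentiableAt.differentiableWithinAt) fun y hy => ?_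
      rw [interior_Iic] at hy
      rw [(hq.hasDerivAt_u y).deriv]
      exact (hmono.monotoneOn (le_trans (le_of_lt hy) hx) hx (le_of_lt hy)).trans hlt.le
    have : Real.exp x * q x ≤ 0 := ge_of_tendsto hq.tendsto_u_atBot
      (eventually_atBot.2 ⟨x, fun y hy => hanti hy (mem_Iic.2 le_rfl) hy⟩)
    linarith [hu x hx]
  refine ⟨a, fun x hx => ⟨hu x hx, ?_⟩⟩
  -- Strict monotonicity between `x - 1` and `x` upgrades nonnegativity to positivity.
  refine (hnn (x - 1) (by linarith)).trans_lt ?_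
  exact hmono (mem_Iic.2 (by linarith)) hx (by linarith)

/-- Positivity propagates from the left because `(u u')' = u'² + q² u² ≥ 0`: the product `u u'`
stays positive, so `u` cannot reach zero, and then `u'` keeps its sign. -/
theorem u_pos_and (x : ℝ) : 0 < Real.exp x * q x ∧ 0 < Real.exp x * (q x + deriv q x) := by
  obtain ⟨a, ha⟩ := hq.exists_left_pos
  rcases le_or_gt x a with hx | hx
  · exact ha x hx
  have hm : Monotone fun y => (Real.exp y * q y) * (Real.exp y * (q y + deriv q y)) := by
    refine monotone_of_hasDerivAt_nonneg (fun y => (hq.hasDerivAt_u y).mul (hq.hasDerivAt_u' y))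
      fun y => ?_
    have : 0 ≤ q y ^ 2 * (Real.exp y * q y) ^ 2 := by positivity
    simp only [Pi.zero_apply]
    nlinarith [sq_nonneg (Real.exp y * (q y + deriv q y))]
  have hpos : ∀ y, a ≤ y → 0 < (Real.exp y * q y) * (Real.exp y * (q y + deriv q y)) :=
    fun y hy => (mul_pos (ha a le_rfl).1 (ha a le_rfl).2).trans_le (hm hy)
  have hu : 0 < Real.exp x * q x := by
    by_contra! hle
    obtain ⟨y, hy, h0⟩ := intermediate_value_Icc' hx.le hq.continuous_u.continuousOn
      ⟨hle, (ha a le_rfl).1.le⟩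
    have := hpos y hy.1
    simp only at h0
    rw [h0] at this; simp at this
  exact ⟨hu, (pos_iff_pos_of_mul_pos (hpos x hx.le)).1 hu⟩

theorem pos (x : ℝ) : 0 < q x := (mul_pos_iff_of_pos_left (Real.exp_pos x)).1 (hq.u_pos_and x).1

theorem u'_monotone : Monotone fun y => Real.exp y * (q y + deriv q y) :=
  monotone_of_hasDerivAt_nonneg hq.hasDerivAt_u' fun y => by
    have := hq.pos y
    simp only [Pi.zero_apply]; positivity

theorem u_monotone : Monotone fun y => Real.exp y * q y :=
  monotone_of_hasDerivAt_nonneg hq.hasDerivAt_u fun y => (hq.u_pos_and y).2.le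

/-- A crude first bound, to be improved afterwards. Once `q ≤ 1/4`, the quantity `y = u' + u/4`
satisfies `y' = q² u + u'/4 ≤ y/4`. -/
theorem exists_u_le_exp : ∃ a C, 0 < C ∧ ∀ x, a ≤ x → Real.exp x * q x ≤ C * Real.exp (x / 4) := by
  have : ∀ᶠ x in Filter.atTop, q x < 1 / 4 := hq.atTop.eventually (gt_mem_nhds (by norm_num))
  obtain ⟨a, ha⟩ := eventually_atTop.1 this
  let y : ℝ → ℝ := fun x => Real.exp x * (q x + deriv q x) + (Real.exp x * q x) / 4
  have hy : ∀ x, HasDerivAt (fun t => Real.exp (-t / 4) * y t)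
      (Real.exp (-x / 4) * (q x ^ 2 * (Real.exp x * q x) + Real.exp x * (q x + deriv q x) / 4
        - y x / 4)) x := fun x => by
    have h1 : HasDerivAt (fun t : ℝ => Real.exp (-t / 4)) (Real.exp (-x / 4) * (-1 / 4)) x :=
      ((hasDerivAt_id x).neg.div_const 4).exp
    refine (h1.mul ((hq.hasDerivAt_u' x).add ((hq.hasDerivAt_u x).div_const 4))).congr_deriv ?_
    simp only [y, Pi.add_apply]; ring
  have hanti : AntitoneOn (fun t => Real.exp (-t / 4) * y t) (Ici a) := by
    refine antitoneOn_of_deriv_nonpos (convex_Ici a)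
      (fun x _ => (hy x).continuousAt.continuousWithinAt)
      (fun x _ => (hy x).differentiableAt.differentiableWithinAt) fun x hx => ?_
    rw [interior_Ici] at hx
    rw [(hy x).deriv]
    refine mul_nonpos_of_nonneg_of_nonpos (Real.exp_pos _).le ?_
    have h1 := ha x (le_of_lt hx)
    have h2 := hq.pos x
    have h3 : q x ^ 2 ≤ 1 / 16 := by nlinarith
    have := mul_le_mul_of_nonneg_right h3 (hq.u_pos_and x).1.le
    simp only [y]; linarith
  refine ⟨a, 4 * (Real.exp (-a / 4) * y a), ?_, fun x hx => ?_⟩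
  · have := hq.u_pos_and a
    have : 0 < y a := by simp only [y]; linarith
    positivity
  · have h1 : Real.exp (-x / 4) * y x ≤ Real.exp (-a / 4) * y a :=
      hanti (mem_Ici.2 le_rfl) hx hx
    have h2 : y x = Real.exp (x / 4) * (Real.exp (-x / 4) * y x) := by
      rw [← mul_assoc, ← Real.exp_add]; ring_nf; simp
    have h3 : Real.exp x * q x ≤ 4 * y x := by
      have := (hq.u_pos_and x).2
      simp only [y]; linarith
    rw [h2] at h3
    nlinarith [mul_le_mul_of_nonneg_left h1 (Real.exp_pos (x / 4)).le]

/-- Bootstrap from the crude bound: `u'' = e^{-2x} u³ ≤ C³ e^{-5x/4}` is integrable at `+∞`. The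
extra exponential in the antitone function below is minus the primitive of this bound. -/
theorem exists_u'_le : ∃ M, 0 < M ∧ ∀ x, Real.exp x * (q x + deriv q x) ≤ M := by
  obtain ⟨a, C, hC, h⟩ := hq.exists_u_le_exp
  have hd : ∀ x, HasDerivAt (fun t => Real.exp t * (q t + deriv q t)
      + C ^ 3 * (4 / 5) * Real.exp (-(5 / 4) * t))
      (q x ^ 2 * (Real.exp x * q x) - C ^ 3 * Real.exp (-(5 / 4) * x)) x := fun x => by
    have h1 : HasDerivAt (fun t : ℝ => Real.exp (-(5 / 4) * t))
        (Real.exp (-(5 / 4) * x) * (-(5 / 4) * 1)) x :=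
      ((hasDerivAt_id x).const_mul (-(5 / 4))).exp
    exact ((hq.hasDerivAt_u' x).add (h1.const_mul (C ^ 3 * (4 / 5)))).congr_deriv (by ring)
  have hanti : AntitoneOn (fun t => Real.exp t * (q t + deriv q t)
      + C ^ 3 * (4 / 5) * Real.exp (-(5 / 4) * t)) (Ici a) := by
    refine antitoneOn_of_deriv_nonpos (convex_Ici a)
      (fun x _ => (hd x).continuousAt.continuousWithinAt)
      (fun x _ => (hd x).differentiableAt.differentiableWithinAt) fun x hx => ?_
    rw [interior_Ici] at hx
    rw [(hd x).deriv]
    have h1 := h x (le_of_lt hx)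
    have h2 := (hq.u_pos_and x).1
    have h3 : (Real.exp x * q x) ^ 3 ≤ (C * Real.exp (x / 4)) ^ 3 := by gcongr
    have e1 : q x ^ 2 * (Real.exp x * q x) = Real.exp (-(2 * x)) * (Real.exp x * q x) ^ 3 := by
      have : Real.exp (-(2 * x)) * (Real.exp x * Real.exp x) = 1 := by
        rw [← Real.exp_add, ← Real.exp_add]; ring_nf; simp
      linear_combination (-(q x ^ 3) * Real.exp x) * this
    have e2 : C ^ 3 * Real.exp (-(5 / 4) * x) = Real.exp (-(2 * x)) * (C * Real.exp (x / 4)) ^ 3 := by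
      rw [mul_pow, ← Real.exp_nat_mul, mul_left_comm, ← Real.exp_add]
      congr 2; push_cast; ring
    rw [e1, e2, sub_nonpos]
    exact mul_le_mul_of_nonneg_left h3 (Real.exp_pos _).le
  refine ⟨Real.exp a * (q a + deriv q a) + C ^ 3 * (4 / 5) * Real.exp (-(5 / 4) * a), ?_,
    fun x => ?_⟩
  · have := (hq.u_pos_and a).2
    positivity
  · refine (hq.u'_monotone (le_max_left x a)).trans ?_
    have := hanti (mem_Ici.2 le_rfl) (mem_Ici.2 (le_max_right x a)) (le_max_right x a)
    simp only at this
    refine le_trans ?_ this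
    have : 0 < C ^ 3 * (4 / 5) * Real.exp (-(5 / 4) * (max x a)) := by positivity
    simp only
    linarith

theorem exists_u_le : ∃ C, 0 < C ∧ ∀ x, 0 ≤ x → Real.exp x * q x ≤ C * (1 + x) := by
  obtain ⟨M, hM, h⟩ := hq.exists_u'_le
  have hanti : Antitone fun t => Real.exp t * q t - M * t := by
    refine antitone_of_hasDerivAt_nonpos
      (fun x => (hq.hasDerivAt_u x).sub ((hasDerivAt_id x).const_mul M)) fun x => ?_
    have := h x
    simp only [Pi.zero_apply]; linarith
  have hp := hq.pos 0
  refine ⟨q 0 + M, by linarith, fun x hx => ?_⟩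
  have := hanti hx
  simp at this
  nlinarith

/-- Convexity gives `u' ≥ u'(0) > 0` on the right. This linear lower bound is what later excludes
`u` itself as a bounded solution. -/
theorem exists_u_ge : ∃ c, 0 < c ∧ ∀ x, 0 ≤ x → c * (1 + x) ≤ Real.exp x * q x := by
  have hp := (hq.u_pos_and 0).2
  have hm : MonotoneOn (fun t => Real.exp t * q t - (Real.exp 0 * (q 0 + deriv q 0)) * t)
      (Ici 0) := by
    have hd := fun x => (hq.hasDerivAt_u x).sub
      ((hasDerivAt_id x).const_mul (Real.exp 0 * (q 0 + deriv q 0)))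
    refine monotoneOn_of_deriv_nonneg (convex_Ici 0)
      (fun x _ => (hd x).continuousAt.continuousWithinAt)
      (fun x _ => (hd x).differentiableAt.differentiableWithinAt) fun x hx => ?_
    rw [interior_Ici] at hx
    have e := (hd x).deriv
    refine le_of_le_of_eq ?_ e.symm
    have := hq.u'_monotone (le_of_lt hx)
    simp only at this; linarith
  have hq0 := hq.pos 0
  refine ⟨min (q 0) (Real.exp 0 * (q 0 + deriv q 0)), lt_min hq0 hp, fun x hx => ?_⟩
  have := hm (mem_Ici.2 le_rfl) hx hx
  simp only [Real.exp_zero, one_mul, mul_zero, sub_zero] at this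
  have h1 : min (q 0) (Real.exp 0 * (q 0 + deriv q 0)) ≤ q 0 := min_le_left _ _
  have h2 : min (q 0) (Real.exp 0 * (q 0 + deriv q 0)) ≤ q 0 + deriv q 0 :=
    (min_le_right _ _).trans (by simp)
  nlinarith

/-- With `p = 1 - q` one has `p'' + 2p' = q(1+q) p`, and `q(1+q) > 1` near `-∞`. Since `(1/4)² + 2 ·
(1/4) = 9/16 < 1`, the function `C e^{x/4}` is a supersolution, and the maximum principle is applied
to `C e^{x/4} ∓ p`. -/
theorem exists_left_bound : ∃ C, 0 < C ∧ ∀ x ≤ 0, |1 - q x| ≤ C * Real.exp (x / 4) := by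
  obtain ⟨a, ha⟩ : ∃ a, ∀ x ≤ a, 1 < q x * (1 + q x) := by
    have : Tendsto (fun x => q x * (1 + q x)) Filter.atBot (𝓝 (1 * (1 + 1))) :=
      hq.atBot.mul (hq.atBot.const_add 1)
    exact eventually_atBot.1 (this.eventually (lt_mem_nhds (by norm_num)))
  have hexp : Tendsto (fun x : ℝ => Real.exp (x / 4)) Filter.atBot (𝓝 0) :=
    Real.tendsto_exp_atBot.comp (tendsto_id.atBot_div_const (by norm_num))
  have key : ∀ s : ℝ, s ^ 2 = 1 → ∀ x ≤ a,
      0 ≤ (|1 - q a| * Real.exp (-a / 4)) * Real.exp (x / 4) - s * (1 - q x) := by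
    intro s hs
    set C := |1 - q a| * Real.exp (-a / 4) with hC
    have hC0 : 0 ≤ C := by positivity
    have h1 : ∀ x, HasDerivAt (fun t : ℝ => Real.exp (t / 4)) (Real.exp (x / 4) * (1 / 4)) x :=
      fun x => ((hasDerivAt_id x).div_const 4).exp
    have hd : ∀ x, HasDerivAt (fun t => C * Real.exp (t / 4) - s * (1 - q t))
        (C / 4 * Real.exp (x / 4) + s * deriv q x) x := fun x =>
      (((h1 x).const_mul C).sub (((hq.hasDerivAt x).const_sub 1).const_mul s)).congr_deriv
        (by ring)
    have hdd : ∀ x, HasDerivAt (fun t => C / 4 * Real.exp (t / 4) + s * deriv q t)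
        (C / 16 * Real.exp (x / 4) + s * deriv (deriv q) x) x := fun x =>
      (((h1 x).const_mul (C / 4)).add ((hq.hasDerivAt_deriv x).const_mul s)).congr_deriv
        (by ring)
    have ed : deriv (fun t => C * Real.exp (t / 4) - s * (1 - q t)) =
        fun t => C / 4 * Real.exp (t / 4) + s * deriv q t := funext fun x => (hd x).deriv
    refine nonneg_of_deriv_deriv_neg_of_neg
      (continuous_iff_continuousAt.2 fun x => (hd x).continuousAt) ?_ ?_ ?_
    · have : C * Real.exp (a / 4) = |1 - q a| := by
        rw [hC, mul_assoc, ← Real.exp_add]; ring_nf; simp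
      rw [this]
      have : |s| = 1 := by
        rw [← sq_eq_sq₀ (abs_nonneg s) zero_le_one, sq_abs, hs]; ring
      have h2 := le_abs_self (s * (1 - q a))
      rw [abs_mul, this, one_mul] at h2
      linarith
    · simpa using (hexp.const_mul C).sub ((hq.atBot.const_sub 1).const_mul s)
    · intro x hx hneg h0
      rw [ed] at h0 ⊢
      rw [(hdd x).deriv]
      simp only at h0
      have hode := hq.ode x
      have hc := ha x hx.le
      set E := Real.exp (x / 4)
      have hE : 0 < E := Real.exp_pos _
      -- The vanishing first derivative of the comparison function is used here to replace `s q'` by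
      -- `-(C/4) e^{x/4}`.
      have e : s * deriv (deriv q) x = 2 * (C / 4 * E)
          - (q x * (1 + q x)) * (s * (1 - q x)) := by
        linear_combination s * hode - 2 * h0
      rw [e]
      have h3 : C * E < s * (1 - q x) := by linarith
      have h4 : 0 ≤ C * E := by positivity
      nlinarith
  refine exists_forall_Iic_le_mul (continuous_const.sub hq.continuous)
    (Real.continuous_exp.comp (continuous_id.div_const 4)) (fun x => Real.exp_pos _) (a := a)
    (C := |1 - q a| * Real.exp (-a / 4)) (fun x hx => ?_) 0
  have k1 := key 1 (by norm_num) x hx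
  have k2 := key (-1) (by norm_num) x hx
  rw [abs_le]
  constructor <;> simp only [Pi.sub_apply, Function.comp_apply, id] <;> linarith

theorem exists_le : ∃ C, 0 < C ∧ ∀ x, q x ≤ C := by
  obtain ⟨C, hC, h⟩ := hq.exists_left_bound
  obtain ⟨D, hD, h'⟩ := hq.exists_u_le
  refine ⟨1 + C + D, by positivity, fun x => ?_⟩
  rcases le_total x 0 with hx | hx
  · have h1 := (abs_le.1 (h x hx)).1
    have h2 : Real.exp (x / 4) ≤ 1 := Real.exp_le_one_iff.2 (by linarith)
    nlinarith
  · have h1 := h' x hx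
    have h2 := Real.add_one_le_exp x
    have h3 : Real.exp x * q x ≤ Real.exp x * D := by nlinarith
    have := le_of_mul_le_mul_left h3 (Real.exp_pos x)
    linarith

/-- The equation reads `(e^{2x} q')' = -e^{2x} q(1+q)(1-q)`, which is `O(e^{9x/4})` by the bound on
`1 - q`. It is integrated from `-∞`, where `e^{2x} q'` vanishes. -/
theorem exists_left_deriv_bound : ∃ C, 0 < C ∧ ∀ x ≤ 0, |deriv q x| ≤ C * Real.exp (x / 4) := by
  obtain ⟨C, hC, h⟩ := hq.exists_left_bound
  obtain ⟨Q, hQ, hQ'⟩ := hq.exists_le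
  obtain ⟨M, hM, hM'⟩ := hq.exists_u'_le
  set K := Q * (1 + Q) * C with hK
  have hK0 : 0 < K := by positivity
  have hd2 : ∀ x, HasDerivAt (fun t : ℝ => Real.exp (2 * t)) (Real.exp (2 * x) * (2 * 1)) x :=
    fun x => ((hasDerivAt_id x).const_mul 2).exp
  have hY : ∀ x, HasDerivAt (fun t => Real.exp (2 * t) * deriv q t)
      (-(Real.exp (2 * x) * (q x * (1 + q x) * (1 - q x)))) x := fun x => by
    refine ((hd2 x).mul (hq.hasDerivAt_deriv x)).congr_deriv ?_
    linear_combination Real.exp (2 * x) * hq.ode x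
  have h9 : ∀ x, HasDerivAt (fun t : ℝ => K * Real.exp (9 / 4 * t))
      (K * (Real.exp (9 / 4 * x) * (9 / 4 * 1))) x :=
    fun x => (((hasDerivAt_id x).const_mul (9 / 4)).exp).const_mul K
  have hYb : ∀ x ≤ 0, |Real.exp (2 * x) * (q x * (1 + q x) * (1 - q x))|
      ≤ K * Real.exp (9 / 4 * x) := fun x hx => by
    have h1 := h x hx
    have h2 := hQ' x
    have h3 := hq.pos x
    have e : Real.exp (9 / 4 * x) = Real.exp (2 * x) * Real.exp (x / 4) := by
      rw [← Real.exp_add]; ring_nf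
    rw [abs_mul, abs_mul, abs_of_pos (Real.exp_pos _),
      abs_of_pos (by positivity : 0 < q x * (1 + q x)), e, hK]
    calc Real.exp (2 * x) * (q x * (1 + q x) * |1 - q x|)
        ≤ Real.exp (2 * x) * (Q * (1 + Q) * (C * Real.exp (x / 4))) := by gcongr
      _ = _ := by ring
  have t2 : Tendsto (fun x : ℝ => Real.exp (2 * x)) Filter.atBot (𝓝 0) :=
    Real.tendsto_exp_atBot.comp (tendsto_id.const_mul_atBot (by norm_num))
  have t9 : Tendsto (fun x : ℝ => K * Real.exp (9 / 4 * x)) Filter.atBot (𝓝 0) := by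
    simpa using (Real.tendsto_exp_atBot.comp
      ((tendsto_id (α := ℝ)).const_mul_atBot (by norm_num : (0 : ℝ) < 9 / 4))).const_mul K
  have tY : Tendsto (fun t => Real.exp (2 * t) * deriv q t) Filter.atBot (𝓝 0) := by
    -- No decay of `q'` is known yet, but `e^t q' = u' - u` with `u'` already bounded.
    have e : ∀ t, Real.exp (2 * t) * deriv q t
        = Real.exp t * (Real.exp t * (q t + deriv q t)) - Real.exp (2 * t) * q t := fun t => by
      rw [two_mul, Real.exp_add]; ring
    simp only [e]
    have a1 : Tendsto (fun t => Real.exp t * (Real.exp t * (q t + deriv q t))) Filter.atBot (𝓝 0) := by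
      refine squeeze_zero (fun t => ?_) (fun t => ?_) (by simpa using Real.tendsto_exp_atBot.mul_const M)
      · exact mul_nonneg (Real.exp_pos t).le (hq.u_pos_and t).2.le
      · exact mul_le_mul_of_nonneg_left (hM' t) (Real.exp_pos t).le
    simpa using a1.sub (t2.mul hq.atBot)
  have hanti : AntitoneOn (fun t => Real.exp (2 * t) * deriv q t - K * Real.exp (9 / 4 * t))
      (Iic 0) := by
    have hd := fun x => (hY x).sub (h9 x)
    refine antitoneOn_of_deriv_nonpos (convex_Iic 0)
      (fun x _ => (hd x).continuousAt.continuousWithinAt)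
      (fun x _ => (hd x).differentiableAt.differentiableWithinAt) fun x hx => ?_
    rw [interior_Iic] at hx
    refine le_of_eq_of_le (hd x).deriv ?_
    have := (abs_le.1 (hYb x (le_of_lt hx))).1
    have := mul_pos hK0 (Real.exp_pos (9 / 4 * x))
    linarith
  have hmono : MonotoneOn (fun t => Real.exp (2 * t) * deriv q t + K * Real.exp (9 / 4 * t))
      (Iic 0) := by
    have hd := fun x => (hY x).add (h9 x)
    refine monotoneOn_of_deriv_nonneg (convex_Iic 0)
      (fun x _ => (hd x).continuousAt.continuousWithinAt)
      (fun x _ => (hd x).differentiableAt.differentiableWithinAt) fun x hx => ?_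
    rw [interior_Iic] at hx
    refine le_of_le_of_eq ?_ (hd x).deriv.symm
    have := (abs_le.1 (hYb x (le_of_lt hx))).2
    have := mul_pos hK0 (Real.exp_pos (9 / 4 * x))
    linarith
  refine ⟨K, hK0, fun x hx => ?_⟩
  have u1 : Real.exp (2 * x) * deriv q x - K * Real.exp (9 / 4 * x) ≤ 0 :=
    ge_of_tendsto (by simpa using tY.sub t9)
      (eventually_atBot.2 ⟨x, fun y hy => hanti (hy.trans hx) hx hy⟩)
  have u2 : 0 ≤ Real.exp (2 * x) * deriv q x + K * Real.exp (9 / 4 * x) :=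
    le_of_tendsto (by simpa using tY.add t9)
      (eventually_atBot.2 ⟨x, fun y hy => hmono (hy.trans hx) hx hy⟩)
  have e : Real.exp (9 / 4 * x) = Real.exp (2 * x) * Real.exp (x / 4) := by
    rw [← Real.exp_add]; ring_nf
  rw [e] at u1 u2
  rw [abs_le]
  constructor
  · refine le_of_mul_le_mul_left ?_ (Real.exp_pos (2 * x)); linarith
  · refine le_of_mul_le_mul_left ?_ (Real.exp_pos (2 * x)); linarith

end IsCriticalFront

/-! ### The explicit two-sided weight and tail integrals. -/

/-- `f` lies in the weighted space `L^ℓ` with the two-sided weight `e^{η|x|}`. -/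
def EMem (η : ℝ) (ℓ : ℝ≥0∞) (f : ℝ → ℂ) : Prop :=
  MemLp (fun x => (Real.exp (η * |x|) : ℂ) * f x) ℓ volume

theorem continuous_exp_abs (η : ℝ) : Continuous fun x : ℝ => Real.exp (η * |x|) := by fun_prop

theorem integrable_exp_neg_mul_abs {κ : ℝ} (hκ : 0 < κ) :
    Integrable (fun x : ℝ => Real.exp (-κ * |x|)) := by
  rw [← integrableOn_univ, ← Iic_union_Ioi (a := (0 : ℝ))]
  refine IntegrableOn.union ?_ ?_
  · refine (integrableOn_exp_mul_Iic hκ 0).congr_fun (fun x hx => ?_) measurableSet_Iic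
    simp only [abs_of_nonpos (mem_Iic.1 hx)]; ring_nf
  · refine (integrableOn_exp_mul_Ioi (neg_lt_zero.2 hκ) 0).congr_fun (fun x hx => ?_)
      measurableSet_Ioi
    simp only [abs_of_pos (mem_Ioi.1 hx)]

theorem memLp_exp_neg_mul_abs {κ : ℝ} (hκ : 0 < κ) {ℓ : ℝ≥0∞} (hℓ : ℓ = 1 ∨ ℓ = ⊤) :
    MemLp (fun x : ℝ => Real.exp (-κ * |x|)) ℓ volume := by
  rcases hℓ with rfl | rfl
  · exact memLp_one_iff_integrable.2 (integrable_exp_neg_mul_abs hκ)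
  · refine memLp_top_of_bound (continuous_exp_abs (-κ)).aestronglyMeasurable 1
      (Eventually.of_forall fun x => ?_)
    rw [Real.norm_eq_abs, Real.abs_exp, Real.exp_le_one_iff]
    have := abs_nonneg x
    nlinarith

theorem exists_bound_of_memLp_top {E : Type*} [NormedAddCommGroup E] {f : ℝ → E}
    (hf : MemLp f ⊤ volume) : ∃ C : ℝ, ∀ᵐ x, ‖f x‖ ≤ C := by
  refine ⟨(eLpNorm f ⊤ volume).toReal, ?_⟩
  have h := hf.2
  rw [eLpNorm_exponent_top] at h ⊢
  filter_upwards [enorm_ae_le_eLpNormEssSup f volume] with x hx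
  rw [← toReal_enorm]
  exact ENNReal.toReal_mono h.ne hx

namespace EMem

variable {η : ℝ} {ℓ : ℝ≥0∞} {f g : ℝ → ℂ}

theorem aestronglyMeasurable (h : EMem η ℓ f) : AEStronglyMeasurable f volume := by
  have h1 := h.1
  have h2 : AEStronglyMeasurable (fun x : ℝ => (Real.exp (-η * |x|) : ℂ)) volume :=
    (Complex.continuous_ofReal.comp (continuous_exp_abs (-η))).aestronglyMeasurable
  refine (h2.mul h1).congr (Eventually.of_forall fun x => ?_)
  simp only [Pi.mul_apply]
  rw [← mul_assoc, ← Complex.ofReal_mul, ← Real.exp_add]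
  simp

theorem add (hf : EMem η ℓ f) (hg : EMem η ℓ g) : EMem η ℓ (fun x => f x + g x) := by
  refine (MemLp.add hf hg).ae_eq (Eventually.of_forall fun x => ?_)
  simp only [Pi.add_apply]; ring

theorem mono (hg : EMem η ℓ g) (hf : AEStronglyMeasurable f volume) {C : ℝ}
    (h : ∀ᵐ x, ‖f x‖ ≤ C * ‖g x‖) : EMem η ℓ f := by
  refine MemLp.of_le_mul (c := C) hg
    ((Complex.continuous_ofReal.comp (continuous_exp_abs η)).aestronglyMeasurable.mul hf) ?_
  filter_upwards [h] with x hx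
  rw [norm_mul, norm_mul]
  nlinarith [norm_nonneg (Real.exp (η * |x|) : ℂ)]

theorem congr (hf : EMem η ℓ f) (h : f =ᵐ[volume] g) : EMem η ℓ g :=
  hf.mono (hf.aestronglyMeasurable.congr h) (C := 1) (by
    filter_upwards [h] with x hx; rw [hx, one_mul])

theorem norm (hf : EMem η ℓ f) : EMem η ℓ (fun x => (‖f x‖ : ℂ)) :=
  hf.mono (Complex.continuous_ofReal.comp_aestronglyMeasurable hf.aestronglyMeasurable.norm)
    (C := 1) (Eventually.of_forall fun x => by simp)

theorem mul_bdd {a : ℝ → ℂ} (hf : EMem η ℓ f) (ha : AEStronglyMeasurable a volume) {C : ℝ}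
    (hC : ∀ x, ‖a x‖ ≤ C) : EMem η ℓ (fun x => a x * f x) :=
  hf.mono (ha.mul hf.aestronglyMeasurable) (C := C) (Eventually.of_forall fun x => by
    rw [norm_mul]; exact mul_le_mul_of_nonneg_right (hC x) (norm_nonneg _))

theorem const_mul (hf : EMem η ℓ f) (c : ℂ) : EMem η ℓ (fun x => c * f x) :=
  hf.mul_bdd (a := fun _ => c) aestronglyMeasurable_const (fun _ => le_rfl)

theorem of_exp {κ C : ℝ} (hκ : η < κ) (hℓ : ℓ = 1 ∨ ℓ = ⊤)
    (hf : AEStronglyMeasurable f volume) (h : ∀ᵐ x, ‖f x‖ ≤ C * Real.exp (-κ * |x|)) :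
    EMem η ℓ f := by
  refine MemLp.of_le_mul (c := C) (memLp_exp_neg_mul_abs (sub_pos.2 hκ) hℓ)
    ((Complex.continuous_ofReal.comp (continuous_exp_abs η)).aestronglyMeasurable.mul hf) ?_
  filter_upwards [h] with x hx
  rw [norm_mul, Complex.norm_real, Real.norm_eq_abs, Real.abs_exp, Real.norm_eq_abs, Real.abs_exp]
  have e : -(κ - η) * |x| = η * |x| + -κ * |x| := by ring
  rw [e, Real.exp_add]
  nlinarith [Real.exp_pos (η * |x|)]

/-- Giving up half of the rate treats `ℓ = 1` and `ℓ = ∞` together, and what remains still absorbs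
the linear growth of `u`. -/
theorem integrable_exp_half (hη : 0 < η) (hℓ : ℓ = 1 ∨ ℓ = ⊤) (hf : EMem η ℓ f) :
    Integrable (fun x => (Real.exp (η / 2 * |x|) : ℂ) * f x) := by
  have e : ∀ x : ℝ, (Real.exp (η / 2 * |x|) : ℂ) * f x =
      (Real.exp (-(η / 2) * |x|) : ℂ) * ((Real.exp (η * |x|) : ℂ) * f x) := fun x => by
    rw [← mul_assoc, ← Complex.ofReal_mul, ← Real.exp_add]; congr 3; ring
  simp_rw [e]
  have hc : AEStronglyMeasurable (fun x : ℝ => (Real.exp (-(η / 2) * |x|) : ℂ)) volume :=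
    (Complex.continuous_ofReal.comp (continuous_exp_abs _)).aestronglyMeasurable
  rcases hℓ with rfl | rfl
  · refine (memLp_one_iff_integrable.1 hf).bdd_mul (c := 1) hc (Eventually.of_forall fun x => ?_)
    rw [Complex.norm_real, Real.norm_eq_abs, Real.abs_exp, Real.exp_le_one_iff]
    have := abs_nonneg x
    nlinarith
  · have hi : Integrable (fun x : ℝ => (Real.exp (-(η / 2) * |x|) : ℂ)) :=
      (integrable_exp_neg_mul_abs (half_pos hη)).ofReal
    obtain ⟨C, hC⟩ := exists_bound_of_memLp_top hf
    exact hi.mul_bdd (c := C) hf.1 hC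

theorem integrable (hη : 0 < η) (hℓ : ℓ = 1 ∨ ℓ = ⊤) (hf : EMem η ℓ f) : Integrable f := by
  refine (hf.integrable_exp_half hη hℓ).mono hf.aestronglyMeasurable
    (Eventually.of_forall fun x => ?_)
  rw [norm_mul, Complex.norm_real, Real.norm_eq_abs, Real.abs_exp]
  have : 1 ≤ Real.exp (η / 2 * |x|) := Real.one_le_exp (by positivity)
  nlinarith [norm_nonneg (f x)]

end EMem

noncomputable section

/-- The mass of `‖f‖` on the half-line beyond `x`, seen from the origin. -/
def tailInt (f : ℝ → ℂ) (x : ℝ) : ℝ :=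
  if 0 ≤ x then ∫ t in Ioi x, ‖f t‖ else ∫ t in Iic x, ‖f t‖

end

theorem tailInt_nonneg (f : ℝ → ℂ) (x : ℝ) : 0 ≤ tailInt f x := by
  unfold tailInt
  split_ifs <;> exact integral_nonneg fun _ => norm_nonneg _

theorem measurable_tailInt {f : ℝ → ℂ} (hf : Integrable f) : Measurable (tailInt f) := by
  refine Measurable.ite measurableSet_Ici ?_ ?_
  · refine Antitone.measurable fun x y hxy => ?_
    exact setIntegral_mono_set hf.norm.integrableOn (Eventually.of_forall fun _ => norm_nonneg _)
      (Ioi_subset_Ioi hxy).eventuallyLE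
  · refine Monotone.measurable fun x y hxy => ?_
    exact setIntegral_mono_set hf.norm.integrableOn (Eventually.of_forall fun _ => norm_nonneg _)
      (Iic_subset_Iic.2 hxy).eventuallyLE

/-- For `t` beyond `x` as seen from the origin, `|x| = |t| - |x - t|`. Hence the weighted tail is at
most the convolution of the integrable kernel `e^{-η|z|}` with `e^{η|t|} ‖f‖`, and such a
convolution preserves both `L¹` and `L^∞`. -/
theorem EMem.tailInt {η : ℝ} {ℓ : ℝ≥0∞} {f : ℝ → ℂ} (hη : 0 < η) (hℓ : ℓ = 1 ∨ ℓ = ⊤)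
    (hf : EMem η ℓ f) : EMem η ℓ (fun x => (tailInt f x : ℂ)) := by
  have hi := hf.integrable hη hℓ
  set k : ℝ → ℝ := fun z => Real.exp (-η * |z|) with hk
  set g : ℝ → ℝ := fun t => Real.exp (η * |t|) * ‖f t‖ with hg
  have hkc : Continuous k := continuous_exp_abs (-η)
  have hki : Integrable k := integrable_exp_neg_mul_abs hη
  have hgL : MemLp g ℓ volume := by
    refine (MemLp.norm hf).ae_eq (Eventually.of_forall fun x => ?_)
    rw [norm_mul, Complex.norm_real, Real.norm_eq_abs, Real.abs_exp]
  have hm : AEStronglyMeasurable (fun x => (Real.exp (η * |x|) : ℂ) * (GLFront.tailInt f x : ℂ))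
      volume :=
    ((Complex.continuous_ofReal.comp (continuous_exp_abs η)).measurable.mul
      (Complex.measurable_ofReal.comp (measurable_tailInt hi))).aestronglyMeasurable
  have hkx : ∀ x, Integrable (fun t => k (x - t)) := fun x => hki.comp_sub_left x
  have hconv : ∀ x, Integrable (fun t => k (x - t) * g t) := by
    intro x
    rcases hℓ with rfl | rfl
    · refine (memLp_one_iff_integrable.1 hgL).bdd_mul (c := 1) (hkx x).1
        (Eventually.of_forall fun t => ?_)
      rw [hk, Real.norm_eq_abs, Real.abs_exp, Real.exp_le_one_iff]
      have := abs_nonneg (x - t)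
      nlinarith
    · obtain ⟨C, hC⟩ := exists_bound_of_memLp_top hgL
      exact (hkx x).mul_bdd (c := C) hgL.1 hC
  have hpos : ∀ x t, 0 ≤ k (x - t) * g t := fun x t => by positivity
  have key : ∀ x, Real.exp (η * |x|) * GLFront.tailInt f x ≤ ∫ t, k (x - t) * g t := by
    have aux : ∀ (x : ℝ) (s : Set ℝ), MeasurableSet s → (∀ t ∈ s, |x| = |t| - |x - t|) →
        Real.exp (η * |x|) * ∫ t in s, ‖f t‖ ≤ ∫ t, k (x - t) * g t := by
      intro x s hs hxs
      rw [← integral_const_mul]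
      have : ∫ t in s, Real.exp (η * |x|) * ‖f t‖ = ∫ t in s, k (x - t) * g t := by
        refine setIntegral_congr_fun hs fun t ht => ?_
        simp only [hk, hg]
        rw [hxs t ht, ← mul_assoc, ← Real.exp_add]
        ring_nf
      rw [this]
      exact setIntegral_le_integral (hconv x) (Eventually.of_forall (hpos x))
    intro x
    unfold GLFront.tailInt
    split_ifs with h0
    · refine aux x _ measurableSet_Ioi fun t ht => ?_
      have ht' : x < t := ht
      rw [abs_of_nonneg h0, abs_of_nonneg (h0.trans ht'.le), abs_of_nonpos (by linarith)]; ring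
    · refine aux x _ measurableSet_Iic fun t ht => ?_
      have ht' : t ≤ x := ht
      rw [abs_of_neg (by linarith), abs_of_neg (by linarith : t < 0), abs_of_nonneg (by linarith)]
      ring
  have hnorm : ∀ x, ‖(Real.exp (η * |x|) : ℂ) * (GLFront.tailInt f x : ℂ)‖
      = Real.exp (η * |x|) * GLFront.tailInt f x := fun x => by
    rw [norm_mul, Complex.norm_real, Complex.norm_real, Real.norm_eq_abs, Real.abs_exp,
      Real.norm_of_nonneg (tailInt_nonneg f x)]
  rcases hℓ with rfl | rfl
  · have hc : Integrable (fun x => ∫ t, k (x - t) * g t) := by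
      have := (memLp_one_iff_integrable.1 hgL).integrable_convolution
        (ContinuousLinearMap.mul ℝ ℝ) hki
      refine this.congr (Eventually.of_forall fun x => ?_)
      simp only [MeasureTheory.convolution_def, ContinuousLinearMap.mul_apply']
      exact integral_congr_ae (Eventually.of_forall fun t => mul_comm _ _)
    refine memLp_one_iff_integrable.2 (hc.mono hm (Eventually.of_forall fun x => ?_))
    rw [hnorm]
    exact (key x).trans (le_abs_self _)
  · obtain ⟨C, hC⟩ := exists_bound_of_memLp_top hgL
    refine memLp_top_of_bound hm (C * ∫ t, k t) (Eventually.of_forall fun x => ?_)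
    rw [hnorm]
    refine (key x).trans ?_
    have : ∫ t, k (x - t) * g t ≤ ∫ t, k (x - t) * C := by
      refine integral_mono_ae (hconv x) ((hkx x).mul_const C) ?_
      filter_upwards [hC] with t ht
      exact mul_le_mul_of_nonneg_left ((le_abs_self _).trans ht) (Real.exp_pos _).le
    refine this.trans (le_of_eq ?_)
    rw [integral_mul_const, integral_sub_left_eq_self k volume x, mul_comm]

theorem EMem.of_outside {η : ℝ} {ℓ : ℝ≥0∞} {F : ℝ → ℂ} {H : ℝ → ℂ} (hη : 0 < η)
    (hℓ : ℓ = 1 ∨ ℓ = ⊤) (hF : AEStronglyMeasurable F volume) (hH : EMem η ℓ H) {R C D : ℝ}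
    (hD : ∀ᵐ x, |x| ≤ R → ‖F x‖ ≤ D) (h : ∀ᵐ x, R ≤ |x| → ‖F x‖ ≤ C * ‖H x‖) :
    EMem η ℓ F := by
  -- On `|x| ≤ R` this rapidly decaying function is at least `|D|`, so it dominates the bounded
  -- inner part.
  have h1 : EMem η ℓ fun x => ((|D| * Real.exp ((η + 1) * R) * Real.exp (-(η + 1) * |x|) : ℝ) : ℂ) :=
    EMem.of_exp (κ := η + 1) (C := |D| * Real.exp ((η + 1) * R)) (by linarith) hℓ
      (by fun_prop) (Eventually.of_forall fun x => by
        rw [Complex.norm_real, Real.norm_of_nonneg (by positivity)])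
  have h2 := (hH.norm.const_mul ((|C| : ℝ) : ℂ)).add h1
  refine h2.mono hF (C := 1) ?_
  filter_upwards [hD, h] with x hx1 hx2
  rw [← Complex.ofReal_mul, ← Complex.ofReal_add, Complex.norm_real,
    Real.norm_of_nonneg (by positivity), one_mul]
  rcases le_total |x| R with hx | hx
  · have e : |D| * Real.exp ((η + 1) * R) * Real.exp (-(η + 1) * |x|)
        = |D| * Real.exp ((η + 1) * (R - |x|)) := by
      rw [mul_assoc, ← Real.exp_add]; ring_nf
    have h3 : 1 ≤ Real.exp ((η + 1) * (R - |x|)) :=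
      Real.one_le_exp (mul_nonneg (by linarith) (by linarith))
    rw [e]
    have := hx1 hx
    have := le_abs_self D
    have : 0 ≤ |C| * ‖H x‖ := by positivity
    nlinarith [abs_nonneg D]
  · have h3 := mul_le_mul_of_nonneg_right (le_abs_self C) (norm_nonneg (H x))
    have : 0 ≤ |D| * Real.exp ((η + 1) * R) * Real.exp (-(η + 1) * |x|) := by positivity
    have := hx2 hx
    linarith

/-! ### Completeness of the weighted Sobolev spaces -/

section Complete

variable {ηm ηp : ℝ} (W : ExpWeight ηm ηp) (k : ℕ) (ℓ : ℝ≥0∞)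

theorem ExpWeight.continuous : Continuous W := W.smooth.continuous

theorem ExpWeight.aestronglyMeasurable_of_mul {W : ExpWeight ηm ηp} {f : ℝ → ℂ}
    (h : AEStronglyMeasurable (W.mul f) volume) : AEStronglyMeasurable f volume := by
  have h2 : AEStronglyMeasurable (fun x : ℝ => ((W x)⁻¹ : ℂ)) volume := by
    have : Continuous fun x : ℝ => ((W x)⁻¹ : ℂ) :=
      (Complex.continuous_ofReal.comp W.continuous).inv₀
        fun x => Complex.ofReal_ne_zero.2 (W.pos x).ne'
    exact this.aestronglyMeasurable
  refine (h2.mul h).congr (Eventually.of_forall fun x => ?_)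
  simp only [Pi.mul_apply, ExpWeight.mul]
  rw [← mul_assoc, inv_mul_cancel₀ (Complex.ofReal_ne_zero.2 (W.pos x).ne'), one_mul]

theorem ExpWeight.mul_inv_mul (g : ℝ → ℂ) : (W.mul fun x => ((W x)⁻¹ : ℂ) * g x) = g := by
  funext x
  simp only [ExpWeight.mul]
  rw [← mul_assoc, mul_inv_cancel₀ (Complex.ofReal_ne_zero.2 (W.pos x).ne'), one_mul]

/-- The element of the weighted Sobolev space with a given representative. -/
noncomputable def ExpSobolev.mk (f : ℝ → ℂ) (hm : AEStronglyMeasurable f volume)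
    (h : MemSobolev k ℓ (W.mul f)) : ExpSobolev W k ℓ :=
  ⟨AEEqFun.mk f hm, h.congr (by
    filter_upwards [AEEqFun.coeFn_mk f hm] with x hx
    simp only [ExpWeight.mul, hx])⟩

theorem ExpSobolev.coeFn_mk (f : ℝ → ℂ) (hm : AEStronglyMeasurable f volume)
    (h : MemSobolev k ℓ (W.mul f)) : (ExpSobolev.mk W k ℓ f hm h : ℝ → ℂ) =ᵐ[volume] f :=
  AEEqFun.coeFn_mk f hm

theorem ExpSobolev.ext {f g : ExpSobolev W k ℓ} (h : (f : ℝ → ℂ) =ᵐ[volume] (g : ℝ → ℂ)) :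
    f = g := Subtype.ext (AEEqFun.ext h)

theorem ExpSobolev.coeFn_add (f g : ExpSobolev W k ℓ) :
    ((f + g : ExpSobolev W k ℓ) : ℝ → ℂ) =ᵐ[volume] fun x => f x + g x :=
  AEEqFun.coeFn_add f.1 g.1

theorem ExpSobolev.coeFn_smul (c : ℂ) (f : ExpSobolev W k ℓ) :
    ((c • f : ExpSobolev W k ℓ) : ℝ → ℂ) =ᵐ[volume] fun x => c * f x :=
  AEEqFun.coeFn_smul c f.1

theorem ExpSobolev.coeFn_zero : ((0 : ExpSobolev W k ℓ) : ℝ → ℂ) =ᵐ[volume] fun _ => 0 :=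
  AEEqFun.coeFn_zero (α := ℝ) (β := ℂ) (μ := volume)

variable [Fact (1 ≤ ℓ)]

theorem ExpSobolev.isometry_derivs : Isometry (ExpSobolev.derivs W k ℓ) :=
  AddMonoidHomClass.isometry_of_norm _ fun _ => rfl

/-- The `j`-th weak derivative of `W f` as a bounded operator into `L^ℓ`. -/
noncomputable def ExpSobolev.derivL (j : Fin (k + 1)) :
    ExpSobolev W k ℓ →L[ℂ] Lp ℂ ℓ (volume : Measure ℝ) :=
  (PiLp.proj ℓ (𝕜 := ℂ) (fun _ : Fin (k + 1) => Lp ℂ ℓ (volume : Measure ℝ)) j).comp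
    ⟨ExpSobolev.derivs W k ℓ, (ExpSobolev.isometry_derivs W k ℓ).continuous⟩

theorem ExpSobolev.coeFn_derivL (j : Fin (k + 1)) (f : ExpSobolev W k ℓ) :
    (ExpSobolev.derivL W k ℓ j f : ℝ → ℂ) =ᵐ[volume] weakDeriv^[j] (W.mul f) :=
  MemLp.coeFn_toLp ((f.memSobolev W k ℓ).memLp_iterate (Nat.lt_succ_iff.1 j.2))

omit [Fact (1 ≤ ℓ)] in
theorem ExpSobolev.memSobolev_derivs (f : ExpSobolev W k ℓ) (j : ℕ) (hj : j < k) :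
    IsWeakDeriv (weakDeriv^[j] (W.mul f)) (weakDeriv^[j + 1] (W.mul f)) := by
  obtain ⟨g, h0, h1, h2⟩ := f.memSobolev W k ℓ
  rw [← h0]
  exact (h1 j hj).congr (iterate_weakDeriv_ae h1 j hj.le).symm
    (iterate_weakDeriv_ae h1 (j + 1) hj).symm

/-- Hölder pairing with the conjugate exponent; a continuous function of compact support lies in
every `L^p`, so all exponents are covered. -/
theorem continuous_integral_smul_Lp {ψ : ℝ → ℝ} (hψ : Continuous ψ) (hc : HasCompactSupport ψ) :
    Continuous fun f : Lp ℂ ℓ (volume : Measure ℝ) => ∫ x, ψ x • f x := by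
  have hm : MemLp (fun x => (ψ x : ℂ)) (ENNReal.conjExponent ℓ) volume :=
    (Complex.continuous_ofReal.comp hψ).memLp_of_hasCompactSupport
      (hc.comp_left Complex.ofReal_zero)
  let B := ContinuousLinearMap.mul ℂ ℂ
  have : Fact (1 ≤ ENNReal.conjExponent ℓ) := ⟨by unfold ENNReal.conjExponent; simp⟩
  have hH : ENNReal.HolderConjugate (ENNReal.conjExponent ℓ) ℓ :=
    (inferInstance : ENNReal.HolderConjugate ℓ (ENNReal.conjExponent ℓ)).symm
  have e : (fun f : Lp ℂ ℓ (volume : Measure ℝ) => ∫ x, ψ x • f x) =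
      fun f => B.lpPairing volume (ENNReal.conjExponent ℓ) ℓ (hm.toLp _) f := by
    funext f
    rw [ContinuousLinearMap.lpPairing_eq_integral]
    refine integral_congr_ae ?_
    filter_upwards [hm.coeFn_toLp] with x hx
    simp [B, hx]
  rw [e]
  exact ContinuousLinearMap.continuous _

theorem locallyIntegrable_Lp (f : Lp ℂ ℓ (volume : Measure ℝ)) :
    LocallyIntegrable (f : ℝ → ℂ) volume :=
  (Lp.memLp f).locallyIntegrable Fact.out

/-- For a fixed test function the defining identity equates two continuous functionals of the pair,
and local integrability is automatic in `L^ℓ`. -/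
theorem isClosed_setOf_isWeakDeriv :
    IsClosed {p : Lp ℂ ℓ (volume : Measure ℝ) × Lp ℂ ℓ (volume : Measure ℝ) |
      IsWeakDeriv p.1 p.2} := by
  have e : {p : Lp ℂ ℓ (volume : Measure ℝ) × Lp ℂ ℓ (volume : Measure ℝ) |
      IsWeakDeriv p.1 p.2} = ⋂ (φ : ℝ → ℝ) (_ : ContDiff ℝ ∞ φ) (_ : HasCompactSupport φ),
        {p | ∫ x, (deriv φ x) • p.1 x = -∫ x, φ x • p.2 x} := by
    ext p
    simp only [IsWeakDeriv, mem_iInter, mem_ofPred_eq]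
    exact ⟨fun h => h.2.2, fun h => ⟨locallyIntegrable_Lp ℓ _, locallyIntegrable_Lp ℓ _, h⟩⟩
  rw [e]
  refine isClosed_iInter fun φ => isClosed_iInter fun h1 => isClosed_iInter fun h2 =>
    isClosed_eq ?_ ?_
  · exact (continuous_integral_smul_Lp ℓ (h1.continuous_deriv (by simp)) h2.deriv).comp
      continuous_fst
  · exact ((continuous_integral_smul_Lp ℓ h1.continuous h2).comp continuous_snd).neg

/-- Describing the range by weak-derivative relations between consecutive components shows that it
is closed. -/
theorem ExpSobolev.range_derivs : range (ExpSobolev.derivs W k ℓ) =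
    {G | ∀ j : Fin k, IsWeakDeriv (G j.castSucc : ℝ → ℂ) (G j.succ : ℝ → ℂ)} := by
  ext G
  constructor
  · rintro ⟨f, rfl⟩ j
    exact (ExpSobolev.memSobolev_derivs W k ℓ f j j.2).congr
      (ExpSobolev.coeFn_derivL W k ℓ j.castSucc f).symm
      (ExpSobolev.coeFn_derivL W k ℓ j.succ f).symm
  · intro hG
    let g : ℕ → ℝ → ℂ := fun j => if h : j < k + 1 then (G ⟨j, h⟩ : ℝ → ℂ) else 0
    have hg : ∀ j (h : j < k + 1), g j = (G ⟨j, h⟩ : ℝ → ℂ) := fun j h => dif_pos h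
    have hw : ∀ j < k, IsWeakDeriv (g j) (g (j + 1)) := fun j hj => by
      rw [hg j (by omega), hg (j + 1) (by omega)]
      exact hG ⟨j, hj⟩
    have hS : MemSobolev k ℓ (g 0) := ⟨g, rfl, hw, fun j hj => by
      rw [hg j (by omega)]; exact Lp.memLp _⟩
    let f : ℝ → ℂ := fun x => ((W x)⁻¹ : ℂ) * g 0 x
    have ef : W.mul f = g 0 := W.mul_inv_mul (g 0)
    have hm : AEStronglyMeasurable f volume :=
      ExpWeight.aestronglyMeasurable_of_mul (W := W) (by
        rw [ef, hg 0 (by omega)]; exact (Lp.memLp _).1)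
    refine ⟨ExpSobolev.mk W k ℓ f hm (by rw [ef]; exact hS), ?_⟩
    ext1 j
    refine Lp.ext ((ExpSobolev.coeFn_derivL W k ℓ j _).trans ?_)
    have e0 : W.mul (ExpSobolev.mk W k ℓ f hm (by rw [ef]; exact hS)) =ᵐ[volume] g 0 := by
      refine EventuallyEq.trans ?_ (Eventually.of_forall (congrFun ef))
      filter_upwards [ExpSobolev.coeFn_mk W k ℓ f hm (by rw [ef]; exact hS)] with x hx
      simp only [ExpWeight.mul, hx]
    have hj : (j : ℕ) ≤ k := Nat.lt_succ_iff.1 j.2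
    refine ((ExpSobolev.memSobolev W k ℓ _).iterate_congr e0 hj).trans ?_
    refine (iterate_weakDeriv_ae hw j hj).trans ?_
    rw [hg j j.2]

/-- The space is isometric to a closed subspace of a finite product of `L^ℓ` spaces. Completeness is
needed for the bounded inverse theorem. -/
instance ExpSobolev.completeSpace : CompleteSpace (ExpSobolev W k ℓ) := by
  refine (ExpSobolev.isometry_derivs W k ℓ).isUniformInducing.completeSpace ?_
  refine IsClosed.isComplete ?_
  rw [ExpSobolev.range_derivs, ofPred_forall]
  refine isClosed_iInter fun j => ?_
  have hc : Continuous fun G : PiLp ℓ (fun _ : Fin (k + 1) => Lp ℂ ℓ (volume : Measure ℝ)) =>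
      (G j.castSucc, G j.succ) :=
    (PiLp.proj ℓ (𝕜 := ℂ) (fun _ : Fin (k + 1) => Lp ℂ ℓ (volume : Measure ℝ))
      j.castSucc).continuous.prodMk (PiLp.proj ℓ (𝕜 := ℂ)
        (fun _ : Fin (k + 1) => Lp ℂ ℓ (volume : Measure ℝ)) j.succ).continuous
  exact (isClosed_setOf_isWeakDeriv ℓ).preimage hc

omit [Fact (1 ≤ ℓ)] in
theorem memSobolev_zero_iff {f : ℝ → ℂ} : MemSobolev 0 ℓ f ↔ MemLp f ℓ volume :=
  ⟨fun h => h.memLp_iterate (le_refl 0), fun h => ⟨fun _ => f, rfl, by simp, fun _ _ => h⟩⟩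

/-- Division by the weight, from `L^ℓ` to the weighted space, as a plain function. -/
noncomputable def ExpSobolev.ofLpFun (g : Lp ℂ ℓ (volume : Measure ℝ)) : ExpSobolev W 0 ℓ :=
  ExpSobolev.mk W 0 ℓ (fun x => ((W x)⁻¹ : ℂ) * g x)
    (ExpWeight.aestronglyMeasurable_of_mul (W := W) (by
      rw [W.mul_inv_mul]; exact Lp.aestronglyMeasurable g))
    (by rw [W.mul_inv_mul]; exact (memSobolev_zero_iff ℓ).2 (Lp.memLp g))

omit [Fact (1 ≤ ℓ)] in
theorem ExpSobolev.coeFn_ofLpFun (g : Lp ℂ ℓ (volume : Measure ℝ)) :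
    (ExpSobolev.ofLpFun W ℓ g : ℝ → ℂ) =ᵐ[volume] fun x => ((W x)⁻¹ : ℂ) * g x :=
  AEEqFun.coeFn_mk _ _

/-- Division by the weight, from `L^ℓ` to the weighted space. -/
noncomputable def ExpSobolev.ofLp :
    Lp ℂ ℓ (volume : Measure ℝ) →L[ℂ] ExpSobolev W 0 ℓ where
  toFun := ExpSobolev.ofLpFun W ℓ
  map_add' f g := by
    refine ExpSobolev.ext W 0 ℓ ((ExpSobolev.coeFn_ofLpFun W ℓ _).trans ?_)
    refine EventuallyEq.symm ((ExpSobolev.coeFn_add W 0 ℓ _ _).trans ?_)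
    filter_upwards [ExpSobolev.coeFn_ofLpFun W ℓ f, ExpSobolev.coeFn_ofLpFun W ℓ g,
      Lp.coeFn_add f g] with x h1 h2 h3
    rw [h1, h2, h3, Pi.add_apply, mul_add]
  map_smul' c g := by
    refine ExpSobolev.ext W 0 ℓ ((ExpSobolev.coeFn_ofLpFun W ℓ _).trans ?_)
    refine EventuallyEq.symm ((ExpSobolev.coeFn_smul W 0 ℓ _ _).trans ?_)
    filter_upwards [ExpSobolev.coeFn_ofLpFun W ℓ g, Lp.coeFn_smul c g] with x h1 h3
    rw [h1, h3, Pi.smul_apply, smul_eq_mul, RingHom.id_apply, mul_left_comm]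
  cont := by
    refine (ExpSobolev.isometry_derivs W 0 ℓ).isUniformInducing.isInducing.continuous_iff.2 ?_
    have e : (ExpSobolev.derivs W 0 ℓ) ∘ (ExpSobolev.ofLpFun W ℓ) =
        fun g => WithLp.toLp ℓ fun _ => g := by
      funext g
      ext1 j
      refine Lp.ext ((ExpSobolev.coeFn_derivL W 0 ℓ j _).trans ?_)
      have hj : (j : ℕ) = 0 := by omega
      rw [hj]
      refine EventuallyEq.trans ?_ (Eventually.of_forall (congrFun (W.mul_inv_mul (g : ℝ → ℂ))))
      filter_upwards [ExpSobolev.coeFn_ofLpFun W ℓ g] with x h1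
      simp only [Function.iterate_zero, id, ExpWeight.mul, h1]
    exact e ▸ (PiLp.continuous_toLp ℓ _).comp (continuous_pi fun j => continuous_id)

theorem ExpSobolev.coeFn_ofLp (g : Lp ℂ ℓ (volume : Measure ℝ)) :
    (ExpSobolev.ofLp W ℓ g : ℝ → ℂ) =ᵐ[volume] fun x => ((W x)⁻¹ : ℂ) * g x :=
  ExpSobolev.coeFn_ofLpFun W ℓ g

/-- Multiplication by a bounded measurable function on `L^ℓ`. -/
noncomputable def mulLp {B : ℝ → ℂ} (hB : MemLp B ⊤ volume) :
    Lp ℂ ℓ (volume : Measure ℝ) →L[ℂ] Lp ℂ ℓ (volume : Measure ℝ) :=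
  (ContinuousLinearMap.mul ℂ ℂ).holderL volume ⊤ ℓ ℓ (hB.toLp B)

theorem coeFn_mulLp {B : ℝ → ℂ} (hB : MemLp B ⊤ volume) (g : Lp ℂ ℓ (volume : Measure ℝ)) :
    (mulLp ℓ hB g : ℝ → ℂ) =ᵐ[volume] fun x => B x * g x := by
  refine ((ContinuousLinearMap.mul ℂ ℂ).coeFn_holder (hB.toLp B) g).trans ?_
  filter_upwards [hB.coeFn_toLp] with x hx
  rw [hx]; rfl

end Complete

/-! ### Bounds on weights and their derivatives. -/

theorem exists_bound_of_outside {E : Type*} [NormedAddCommGroup E] {F : ℝ → E}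
    (hF : Continuous F) {R D : ℝ} (h : ∀ x, R ≤ |x| → ‖F x‖ ≤ D) :
    ∃ C, 0 < C ∧ ∀ x, ‖F x‖ ≤ C := by
  obtain ⟨K, hK⟩ := (isCompact_closedBall (0 : ℝ) R).exists_bound_of_continuousOn hF.continuousOn
  refine ⟨max (max D K) 1, by positivity, fun x => ?_⟩
  rcases le_total R |x| with hx | hx
  · exact (h x hx).trans ((le_max_left _ _).trans (le_max_left _ _))
  · exact (hK x (by simpa using hx)).trans ((le_max_right _ _).trans (le_max_left _ _))

namespace ExpWeight

variable {ηm ηp : ℝ} (W : ExpWeight ηm ηp)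

theorem inv_smooth : ContDiff ℝ ∞ fun x => (W x)⁻¹ := W.smooth.inv fun x => (W.pos x).ne'

theorem continuous_inv_deriv : Continuous (deriv fun x => (W x)⁻¹) :=
  W.inv_smooth.continuous_deriv (by simp)

theorem inv_deriv_smooth : ContDiff ℝ ∞ (deriv fun x => (W x)⁻¹) :=
  (contDiff_infty_iff_deriv.1 W.inv_smooth).2

theorem continuous_inv_deriv_deriv : Continuous (deriv (deriv fun x => (W x)⁻¹)) :=
  W.inv_deriv_smooth.continuous_deriv (by simp)

theorem hasDerivAt_inv (x : ℝ) : HasDerivAt (fun y => (W y)⁻¹) (deriv (fun y => (W y)⁻¹) x) x :=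
  (W.inv_smooth.differentiable (by simp) x).hasDerivAt

theorem hasDerivAt_inv_deriv (x : ℝ) : HasDerivAt (deriv fun y => (W y)⁻¹)
    (deriv (deriv fun y => (W y)⁻¹) x) x :=
  (W.inv_deriv_smooth.differentiable (by simp) x).hasDerivAt

/-- Where the weight is a pure exponential the logarithmic-type coefficients are constant, which
gives both their boundedness and the limiting operators at `±∞`. -/
theorem deriv_inv_mul_of_eventuallyEq {c x : ℝ} (h : ∀ᶠ y in 𝓝 x, W y = Real.exp (c * y)) :
    deriv (fun y => (W y)⁻¹) x * W x = -c ∧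
      deriv (deriv fun y => (W y)⁻¹) x * W x = c ^ 2 := by
  have e : (fun y => (W y)⁻¹) =ᶠ[𝓝 x] fun y => Real.exp (-c * y) := by
    filter_upwards [h] with y hy
    rw [hy, ← Real.exp_neg]; ring_nf
  have d1 : ∀ y, HasDerivAt (fun y => Real.exp (-c * y)) (-c * Real.exp (-c * y)) y := fun y =>
    (((hasDerivAt_id y).const_mul (-c)).exp).congr_deriv (by simp only [id]; ring)
  have e1 : deriv (fun y => (W y)⁻¹) =ᶠ[𝓝 x] fun y => -c * Real.exp (-c * y) := by
    filter_upwards [e.eventuallyEq_nhds] with y hy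
    rw [hy.deriv_eq, (d1 y).deriv]
  have hm : Real.exp (-c * x) * W x = 1 := by
    rw [h.self_of_nhds, ← Real.exp_add]; ring_nf; simp
  constructor
  · rw [e1.self_of_nhds]; linear_combination (-c) * hm
  · rw [e1.deriv_eq, ((d1 x).const_mul (-c)).deriv]; linear_combination c ^ 2 * hm

theorem deriv_inv_mul_right {x : ℝ} (hx : 1 < x) :
    deriv (fun y => (W y)⁻¹) x * W x = -ηp ∧
      deriv (deriv fun y => (W y)⁻¹) x * W x = ηp ^ 2 :=
  W.deriv_inv_mul_of_eventuallyEq (by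
    filter_upwards [Ioi_mem_nhds hx] with y hy using W.right y (le_of_lt hy))

theorem deriv_inv_mul_left {x : ℝ} (hx : x < -1) :
    deriv (fun y => (W y)⁻¹) x * W x = -ηm ∧
      deriv (deriv fun y => (W y)⁻¹) x * W x = ηm ^ 2 :=
  W.deriv_inv_mul_of_eventuallyEq (by
    filter_upwards [Iio_mem_nhds hx] with y hy using W.left y (le_of_lt hy))

theorem exists_bound_deriv_inv_mul :
    ∃ C, 0 < C ∧ ∀ x, |deriv (fun y => (W y)⁻¹) x * W x| ≤ C := by
  refine exists_bound_of_outside (W.continuous_inv_deriv.mul W.continuous) (R := 2)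
    (D := |ηp| + |ηm|) fun x hx => ?_
  rw [Real.norm_eq_abs]
  rcases le_abs.1 hx with h | h
  · rw [Pi.mul_apply, (W.deriv_inv_mul_right (by linarith)).1, abs_neg]
    linarith [abs_nonneg ηm]
  · rw [Pi.mul_apply, (W.deriv_inv_mul_left (by linarith)).1, abs_neg]
    linarith [abs_nonneg ηp]

theorem exists_bound_deriv_deriv_inv_mul :
    ∃ C, 0 < C ∧ ∀ x, |deriv (deriv fun y => (W y)⁻¹) x * W x| ≤ C := by
  refine exists_bound_of_outside (W.continuous_inv_deriv_deriv.mul W.continuous) (R := 2)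
    (D := |ηp ^ 2| + |ηm ^ 2|) fun x hx => ?_
  rw [Real.norm_eq_abs]
  rcases le_abs.1 hx with h | h
  · rw [Pi.mul_apply, (W.deriv_inv_mul_right (by linarith)).2]
    linarith [abs_nonneg (ηm ^ 2)]
  · rw [Pi.mul_apply, (W.deriv_inv_mul_left (by linarith)).2]
    linarith [abs_nonneg (ηp ^ 2)]

end ExpWeight

section TwoSided

variable {η : ℝ} (W : ExpWeight (-η) η)

theorem ExpWeight.eq_exp_abs {x : ℝ} (hx : 1 ≤ |x|) : W x = Real.exp (η * |x|) := by
  rcases le_abs.1 hx with h | h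
  · rw [W.right x h, abs_of_pos (by linarith)]
  · rw [W.left x (by linarith), abs_of_neg (by linarith)]; ring_nf

theorem ExpWeight.exists_le_exp_abs : ∃ C, 0 < C ∧ ∀ x, W x ≤ C * Real.exp (η * |x|) := by
  obtain ⟨C, hC, h⟩ := exists_bound_of_outside
    (F := fun x => W x / Real.exp (η * |x|)) (R := 1) (D := 1)
    (W.continuous.div (continuous_exp_abs η) fun x => (Real.exp_pos _).ne') fun x hx => by
      rw [W.eq_exp_abs hx, div_self (Real.exp_pos _).ne']; simp
  refine ⟨C, hC, fun x => ?_⟩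
  have := h x
  rw [Real.norm_of_nonneg (div_pos (W.pos x) (Real.exp_pos _)).le,
    div_le_iff₀ (Real.exp_pos _)] at this
  exact this

theorem ExpWeight.exists_exp_abs_le : ∃ C, 0 < C ∧ ∀ x, Real.exp (η * |x|) ≤ C * W x := by
  obtain ⟨C, hC, h⟩ := exists_bound_of_outside
    (F := fun x => Real.exp (η * |x|) / W x) (R := 1) (D := 1)
    ((continuous_exp_abs η).div W.continuous fun x => (W.pos x).ne') fun x hx => by
      rw [W.eq_exp_abs hx, div_self (Real.exp_pos _).ne']; simp
  refine ⟨C, hC, fun x => ?_⟩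
  have := h x
  rw [Real.norm_of_nonneg (div_pos (Real.exp_pos _) (W.pos x)).le,
    div_le_iff₀ (W.pos x)] at this
  exact this

theorem EMem.memLp_mul {ℓ : ℝ≥0∞} {f : ℝ → ℂ} (hf : EMem η ℓ f) {a : ℝ → ℝ} (ha : Continuous a)
    {C : ℝ} (h : ∀ x, |a x| ≤ C * Real.exp (η * |x|)) :
    MemLp (fun x => (a x : ℂ) * f x) ℓ volume := by
  refine MemLp.of_le_mul (c := C) hf
    ((Complex.continuous_ofReal.comp ha).aestronglyMeasurable.mul hf.aestronglyMeasurable)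
    (Eventually.of_forall fun x => ?_)
  rw [norm_mul, norm_mul, Complex.norm_real, Complex.norm_real, Real.norm_eq_abs, Real.norm_eq_abs,
    Real.abs_exp, ← mul_assoc]
  exact mul_le_mul_of_nonneg_right (h x) (norm_nonneg _)

theorem memLp_weight_mul_iff {ℓ : ℝ≥0∞} {f : ℝ → ℂ} :
    MemLp (W.mul f) ℓ volume ↔ EMem η ℓ f := by
  constructor
  · intro h
    obtain ⟨C, hC, hW⟩ := W.exists_exp_abs_le
    refine MemLp.of_le_mul (c := C) h
      ((Complex.continuous_ofReal.comp (continuous_exp_abs η)).aestronglyMeasurable.mul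
        (ExpWeight.aestronglyMeasurable_of_mul h.1)) (Eventually.of_forall fun x => ?_)
    rw [ExpWeight.mul, norm_mul, norm_mul, Complex.norm_real, Complex.norm_real, Real.norm_eq_abs,
      Real.norm_eq_abs, Real.abs_exp, abs_of_pos (W.pos x), ← mul_assoc]
    exact mul_le_mul_of_nonneg_right (hW x) (norm_nonneg _)
  · intro h
    obtain ⟨C, hC, hW⟩ := W.exists_le_exp_abs
    exact h.memLp_mul W.continuous (C := C) fun x => by
      rw [abs_of_pos (W.pos x)]; exact hW x

theorem isPrim_ofReal {a a' : ℝ → ℝ} (h : ∀ x, HasDerivAt a (a' x) x) (hc : Continuous a') :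
    IsPrim (fun x => (a x : ℂ)) (fun x => (a' x : ℂ)) :=
  IsPrim.of_hasDerivAt (fun x => (h x).ofReal_comp) (Complex.continuous_ofReal.comp hc)

/-- Far out, `W` is an exponential of rate `±η`, so `|W'|` and `|W''|` are `|η| W` and `η² W`; the
middle region is compact. -/
theorem ExpWeight.exists_deriv_le_exp_abs :
    ∃ C, ∀ x, |deriv W x| ≤ C * Real.exp (η * |x|) ∧
      |deriv (deriv W) x| ≤ C * Real.exp (η * |x|) := by
  have d1 : ∀ c y : ℝ, HasDerivAt (fun y => Real.exp (c * y)) (c * Real.exp (c * y)) y :=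
    fun c y => (((hasDerivAt_id y).const_mul c).exp).congr_deriv (by simp only [id]; ring)
  have key : ∀ c x : ℝ, (∀ᶠ y in 𝓝 x, W y = Real.exp (c * y)) →
      deriv W x = c * W x ∧ deriv (deriv W) x = c ^ 2 * W x := by
    intro c x h
    have e : W.toFun =ᶠ[𝓝 x] fun y => Real.exp (c * y) := h
    have e1 : deriv W =ᶠ[𝓝 x] fun y => c * Real.exp (c * y) := by
      filter_upwards [e.eventuallyEq_nhds] with y hy
      rw [hy.deriv_eq, (d1 c y).deriv]
    rw [e1.self_of_nhds, e1.deriv_eq, ((d1 c x).const_mul c).deriv, h.self_of_nhds]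
    exact ⟨rfl, by ring⟩
  have cW1 : Continuous (deriv W) := W.smooth.continuous_deriv (by simp)
  have cW2 : Continuous (deriv (deriv W)) :=
    (contDiff_infty_iff_deriv.1 W.smooth).2.continuous_deriv (by simp)
  have out : ∀ x : ℝ, 2 ≤ |x| → |deriv W x / Real.exp (η * |x|)| ≤ |η| + η ^ 2 ∧
      |deriv (deriv W) x / Real.exp (η * |x|)| ≤ |η| + η ^ 2 := by
    intro x hx
    have hE := W.eq_exp_abs (x := x) (by linarith)
    have hk : ∃ c : ℝ, |c| = |η| ∧ ∀ᶠ y in 𝓝 x, W y = Real.exp (c * y) := by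
      rcases le_abs.1 hx with h | h
      · exact ⟨η, rfl, by
          filter_upwards [Ioi_mem_nhds (show 1 < x by linarith)] with y hy
            using W.right y (le_of_lt hy)⟩
      · exact ⟨-η, abs_neg η, by
          filter_upwards [Iio_mem_nhds (show x < -1 by linarith)] with y hy
            using W.left y (le_of_lt hy)⟩
    obtain ⟨c, hc, hev⟩ := hk
    obtain ⟨k1, k2⟩ := key c x hev
    have hc2 : c ^ 2 = η ^ 2 := by rw [← sq_abs, hc, sq_abs]
    rw [k1, k2, hE, mul_div_assoc, mul_div_assoc, div_self (Real.exp_pos _).ne', mul_one, mul_one,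
      hc, hc2, abs_of_nonneg (sq_nonneg η)]
    exact ⟨by linarith [sq_nonneg η], by linarith [abs_nonneg η]⟩
  obtain ⟨C1, h1, H1⟩ := exists_bound_of_outside (R := 2) (D := |η| + η ^ 2)
    (cW1.div (continuous_exp_abs η) fun x => (Real.exp_pos _).ne') fun x hx => (out x hx).1
  obtain ⟨C2, h2, H2⟩ := exists_bound_of_outside (R := 2) (D := |η| + η ^ 2)
    (cW2.div (continuous_exp_abs η) fun x => (Real.exp_pos _).ne') fun x hx => (out x hx).2
  refine ⟨C1 + C2, fun x => ⟨?_, ?_⟩⟩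
  · have := H1 x
    rw [Real.norm_eq_abs, Pi.div_apply, abs_div, Real.abs_exp, div_le_iff₀ (Real.exp_pos _)] at this
    nlinarith [Real.exp_pos (η * |x|)]
  · have := H2 x
    rw [Real.norm_eq_abs, Pi.div_apply, abs_div, Real.abs_exp, div_le_iff₀ (Real.exp_pos _)] at this
    nlinarith [Real.exp_pos (η * |x|)]

variable {ℓ : ℝ≥0∞}

/-- Passage from an explicitly constructed function to the weighted space: the derivatives of `W f`
expand by Leibniz into terms that are each controlled by `e^{η|x|}` times `f`, `f'` or `f''`. -/
theorem ExpSobolev.exists_of_eMem {f f1 f2 : ℝ → ℂ} (h1 : IsPrim f f1) (h2 : IsPrim f1 f2)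
    (m0 : EMem η ℓ f) (m1 : EMem η ℓ f1) (m2 : EMem η ℓ f2) :
    ∃ v : ExpSobolev W 2 ℓ, (v : ℝ → ℂ) =ᵐ[volume] f := by
  have cW1 : Continuous (deriv W) := W.smooth.continuous_deriv (by simp)
  have sW1 := (contDiff_infty_iff_deriv.1 W.smooth).2
  have cW2 : Continuous (deriv (deriv W)) := sW1.continuous_deriv (by simp)
  have p0 := isPrim_ofReal (fun x => (W.smooth.differentiable (by simp) x).hasDerivAt) cW1
  have p1 := isPrim_ofReal (fun x => (sW1.differentiable (by simp) x).hasDerivAt) cW2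
  have k1 := h1.mul p0
  have k2 := (h1.mul p1).add (h2.mul p0)
  obtain ⟨C0, -, hC0⟩ := W.exists_le_exp_abs
  obtain ⟨C, hC⟩ := W.exists_deriv_le_exp_abs
  have mm := fun {f : ℝ → ℂ} (hf : EMem η ℓ f) => hf.memLp_mul W.continuous (C := C0) fun x => by
      rw [abs_of_pos (W.pos x)]; exact hC0 x
  have mm1 := fun {f : ℝ → ℂ} (hf : EMem η ℓ f) => hf.memLp_mul cW1 fun x => (hC x).1
  have mm2 := fun {f : ℝ → ℂ} (hf : EMem η ℓ f) => hf.memLp_mul cW2 fun x => (hC x).2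
  let g : ℕ → ℝ → ℂ := fun j => match j with
    | 0 => W.mul f
    | 1 => fun x => ((deriv W x : ℝ) : ℂ) * f x + (W x : ℂ) * f1 x
    | _ => (fun x => ((deriv (deriv W) x : ℝ) : ℂ) * f x + ((deriv W x : ℝ) : ℂ) * f1 x) +
        fun x => ((deriv W x : ℝ) : ℂ) * f1 x + (W x : ℂ) * f2 x
  refine ⟨ExpSobolev.mk W 2 ℓ f h1.continuous.aestronglyMeasurable ⟨g, rfl, ?_, ?_⟩,
    ExpSobolev.coeFn_mk W 2 ℓ _ _ _⟩
  · intro j hj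
    interval_cases j
    · exact k1.isWeakDeriv
    · exact k2.isWeakDeriv
  · intro j hj
    interval_cases j
    · exact mm m0
    · exact (mm1 m0).add (mm m1)
    · exact ((mm2 m0).add (mm1 m1)).add ((mm1 m1).add (mm m2))

theorem ExpSobolev.eMem (v : ExpSobolev W 2 ℓ) : EMem η ℓ v :=
  (memLp_weight_mul_iff W).1 ((v.memSobolev W 2 ℓ).memLp_iterate (j := 0) (by norm_num))

theorem ExpSobolev.eMem_zero (v : ExpSobolev W 0 ℓ) : EMem η ℓ v :=
  (memLp_weight_mul_iff W).1 ((v.memSobolev W 0 ℓ).memLp_iterate (j := 0) (by norm_num))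

end TwoSided

/-! ### The coefficients of `L_ψ` and its boundedness between weighted spaces. -/

section WeakDerivs

variable {ηm ηp : ℝ} (W : ExpWeight ηm ηp) {ℓ : ℝ≥0∞}

/-- The norm only sees derivatives of `W v`; those of `v` are recovered from `v = W⁻¹ (W v)` by the
product rule. -/
theorem ExpSobolev.isWeakDeriv (v : ExpSobolev W 2 ℓ) :
    ∃ v1 v2 : ℝ → ℂ, IsWeakDeriv v v1 ∧ IsWeakDeriv v1 v2 ∧
      v1 =ᵐ[volume] (fun x => ((deriv (fun y => (W y)⁻¹) x : ℝ) : ℂ) * W.mul v x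
        + (((W x)⁻¹ : ℝ) : ℂ) * weakDeriv (W.mul v) x) ∧
      v2 =ᵐ[volume] (fun x => ((deriv (deriv fun y => (W y)⁻¹) x : ℝ) : ℂ) * W.mul v x
        + 2 * ((deriv (fun y => (W y)⁻¹) x : ℝ) : ℂ) * weakDeriv (W.mul v) x
        + (((W x)⁻¹ : ℝ) : ℂ) * weakDeriv (weakDeriv (W.mul v)) x) := by
  have h0 : IsWeakDeriv (W.mul v) (weakDeriv (W.mul v)) :=
    ExpSobolev.memSobolev_derivs W 2 ℓ v 0 (by norm_num)
  have h1 : IsWeakDeriv (weakDeriv (W.mul v)) (weakDeriv (weakDeriv (W.mul v))) :=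
    ExpSobolev.memSobolev_derivs W 2 ℓ v 1 (by norm_num)
  have p0 := isPrim_ofReal W.hasDerivAt_inv W.continuous_inv_deriv
  have p1 := isPrim_ofReal W.hasDerivAt_inv_deriv W.continuous_inv_deriv_deriv
  have k0 := h0.mul p0
  have k1 := (h0.mul p1).add (h1.mul p0)
  refine ⟨_, _, k0.congr (Eventually.of_forall fun x => ?_) (ae_eq_refl _), k1, ae_eq_refl _,
    Eventually.of_forall fun x => ?_⟩
  · simp only [ExpWeight.mul]
    rw [← mul_assoc, ← Complex.ofReal_mul, inv_mul_cancel₀ (W.pos x).ne', Complex.ofReal_one,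
      one_mul]
  · simp only [Pi.add_apply]; ring

end WeakDerivs

noncomputable section

/-- The first-order coefficient of `L_ψ`. -/
def coefB (w : ℝ → ℝ) (x : ℝ) : ℝ := 2 * (1 + deriv (fun y => (w y)⁻¹) x * w x)

/-- The zeroth-order coefficient of `L_ψ` without the term `-q²`. -/
def coefC (w : ℝ → ℝ) (x : ℝ) : ℝ :=
  deriv (deriv fun y => (w y)⁻¹) x * w x + 2 * (deriv (fun y => (w y)⁻¹) x * w x) + 1

end

theorem continuous_coefB {ηm ηp : ℝ} (w : ExpWeight ηm ηp) : Continuous (coefB w) :=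
  continuous_const.mul (continuous_const.add (w.continuous_inv_deriv.mul w.continuous))

theorem continuous_coefC {ηm ηp : ℝ} (w : ExpWeight ηm ηp) : Continuous (coefC w) :=
  ((w.continuous_inv_deriv_deriv.mul w.continuous).add
    (continuous_const.mul (w.continuous_inv_deriv.mul w.continuous))).add continuous_const

/-- To the right `L_ψ` is `∂ₓₓ - q²`: the weight `e^x` moves the double root `-1` of the front's
linearization at zero to the origin. -/
theorem coef_right (w : ExpWeight 0 1) {x : ℝ} (hx : 1 < x) : coefB w x = 0 ∧ coefC w x = 0 := by
  obtain ⟨h1, h2⟩ := w.deriv_inv_mul_right hx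
  simp only [coefB, coefC]
  rw [h1, h2]; norm_num

/-- To the left the weight is trivial and `L_ψ = ∂ₓₓ + 2∂ₓ + 1 - q²`, which tends to `∂ₓₓ + 2∂ₓ`. -/
theorem coef_left (w : ExpWeight 0 1) {x : ℝ} (hx : x < -1) : coefB w x = 2 ∧ coefC w x = 1 := by
  obtain ⟨h1, h2⟩ := w.deriv_inv_mul_left hx
  simp only [coefB, coefC]
  rw [h1, h2]; norm_num

theorem Lpsi_ae {q w : ℝ → ℝ} {f f1 f2 : ℝ → ℂ} (h1 : IsWeakDeriv f f1) (h2 : IsWeakDeriv f1 f2) :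
    Lpsi q w f =ᵐ[volume] fun x => f2 x + (coefB w x : ℂ) * f1 x
      + ((coefC w x - q x ^ 2 : ℝ) : ℂ) * f x := by
  have e1 := h1.weakDeriv_ae
  have e2 := (h2.congr e1.symm (ae_eq_refl _)).weakDeriv_ae
  filter_upwards [e1, e2] with x hx1 hx2
  simp only [Lpsi, hx1, hx2, coefB, coefC]

section Operators

variable {ηm ηp : ℝ} (W : ExpWeight ηm ηp) (ℓ : ℝ≥0∞) [Fact (1 ≤ ℓ)]

theorem exists_inclusion : ∃ J : ExpSobolev W 2 ℓ →L[ℂ] ExpSobolev W 0 ℓ,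
    ∀ v : ExpSobolev W 2 ℓ, (J v : ℝ → ℂ) =ᵐ[volume] v := by
  refine ⟨(ExpSobolev.ofLp W ℓ).comp (ExpSobolev.derivL W 2 ℓ 0), fun v => ?_⟩
  refine (ExpSobolev.coeFn_ofLp W ℓ (ExpSobolev.derivL W 2 ℓ 0 v)).trans ?_
  filter_upwards [ExpSobolev.coeFn_derivL W 2 ℓ 0 v] with x hx
  rw [hx]
  simp only [Fin.val_zero, Function.iterate_zero, id, ExpWeight.mul]
  rw [← mul_assoc, inv_mul_cancel₀ (Complex.ofReal_ne_zero.2 (W.pos x).ne'), one_mul]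

theorem memLp_top_ofReal {a : ℝ → ℝ} (ha : Continuous a) {C : ℝ} (hC : ∀ x, |a x| ≤ C) :
    MemLp (fun x => (a x : ℂ)) ⊤ volume :=
  memLp_top_of_bound (Complex.continuous_ofReal.comp ha).aestronglyMeasurable C
    (Eventually.of_forall fun x => by rw [Complex.norm_real]; exact hC x)

/-- Written in terms of `W v` and its derivatives, `W L_ψ v` has bounded coefficients, so the
operator is assembled from multiplications on `L^ℓ` followed by division by `W`. -/
theorem exists_lpsi_operator {q : ℝ → ℝ} (hq : Continuous q) {Q : ℝ} (hQ : ∀ x, |q x| ≤ Q)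
    {ζm ζp : ℝ} (w : ExpWeight ζm ζp) :
    ∃ A : ExpSobolev W 2 ℓ →L[ℂ] ExpSobolev W 0 ℓ,
      ∀ v : ExpSobolev W 2 ℓ, (A v : ℝ → ℂ) =ᵐ[volume] Lpsi q w v := by
  obtain ⟨C1, -, h1⟩ := W.exists_bound_deriv_inv_mul
  obtain ⟨C2, -, h2⟩ := W.exists_bound_deriv_deriv_inv_mul
  obtain ⟨K1, -, k1⟩ := w.exists_bound_deriv_inv_mul
  obtain ⟨K2, -, k2⟩ := w.exists_bound_deriv_deriv_inv_mul
  have hb : ∀ x, |coefB w x| ≤ 2 * (1 + K1) := fun x => by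
    have := k1 x
    rw [coefB, abs_mul, abs_two]
    have := abs_add_le 1 (deriv (fun y => (w y)⁻¹) x * w x)
    rw [abs_one] at this
    linarith
  have hc : ∀ x, |coefC w x| ≤ K2 + 2 * K1 + 1 := fun x => by
    have e1 := abs_le.1 (k1 x)
    have e2 := abs_le.1 (k2 x)
    rw [coefC, abs_le]
    constructor <;> linarith
  have hq2 : ∀ x, |q x ^ 2| ≤ Q ^ 2 := fun x => by
    rw [abs_pow]; exact pow_le_pow_left₀ (abs_nonneg _) (hQ x) 2
  have cr := W.continuous_inv_deriv.mul W.continuous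
  have m1 : MemLp (fun x => ((2 * (deriv (fun y => (W y)⁻¹) x * W x) + coefB w x : ℝ) : ℂ))
      ⊤ volume :=
    memLp_top_ofReal ((continuous_const.mul cr).add (continuous_coefB w))
      (C := 2 * C1 + 2 * (1 + K1)) fun x => by
        have e1 := abs_le.1 (h1 x)
        have e2 := abs_le.1 (hb x)
        rw [abs_le]; constructor <;> linarith
  have m0 : MemLp (fun x => ((deriv (deriv fun y => (W y)⁻¹) x * W x
      + coefB w x * (deriv (fun y => (W y)⁻¹) x * W x) + (coefC w x - q x ^ 2) : ℝ) : ℂ))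
      ⊤ volume :=
    memLp_top_ofReal (((W.continuous_inv_deriv_deriv.mul W.continuous).add
      ((continuous_coefB w).mul cr)).add ((continuous_coefC w).sub (hq.pow 2)))
      (C := C2 + 2 * (1 + K1) * C1 + (K2 + 2 * K1 + 1 + Q ^ 2)) fun x => by
        have e0 := abs_mul (coefB w x) (deriv (fun y => (W y)⁻¹) x * W x)
        have e3 := mul_le_mul (hb x) (h1 x) (abs_nonneg _) ((abs_nonneg _).trans (hb x))
        rw [← e0] at e3
        have e1 := abs_le.1 e3
        have e2 := abs_le.1 (h2 x)
        have e4 := abs_le.1 (hc x)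
        have e5 := abs_le.1 (hq2 x)
        rw [abs_le]; constructor <;> linarith
  refine ⟨(ExpSobolev.ofLp W ℓ).comp (ExpSobolev.derivL W 2 ℓ 2
    + (mulLp ℓ m1).comp (ExpSobolev.derivL W 2 ℓ 1)
    + (mulLp ℓ m0).comp (ExpSobolev.derivL W 2 ℓ 0)), fun v => ?_⟩
  obtain ⟨v1, v2, hv1, hv2, e1, e2⟩ := ExpSobolev.isWeakDeriv W v
  refine EventuallyEq.trans ?_ (Lpsi_ae hv1 hv2).symm
  refine (ExpSobolev.coeFn_ofLp W ℓ (ExpSobolev.derivL W 2 ℓ 2 v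
    + mulLp ℓ m1 (ExpSobolev.derivL W 2 ℓ 1 v) + mulLp ℓ m0 (ExpSobolev.derivL W 2 ℓ 0 v))).trans ?_
  have a0 := Lp.coeFn_add (ExpSobolev.derivL W 2 ℓ 2 v
    + mulLp ℓ m1 (ExpSobolev.derivL W 2 ℓ 1 v)) (mulLp ℓ m0 (ExpSobolev.derivL W 2 ℓ 0 v))
  have a1 := Lp.coeFn_add (ExpSobolev.derivL W 2 ℓ 2 v)
    (mulLp ℓ m1 (ExpSobolev.derivL W 2 ℓ 1 v))
  filter_upwards [a0, a1, coeFn_mulLp ℓ m1 (ExpSobolev.derivL W 2 ℓ 1 v),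
    coeFn_mulLp ℓ m0 (ExpSobolev.derivL W 2 ℓ 0 v), ExpSobolev.coeFn_derivL W 2 ℓ 0 v,
    ExpSobolev.coeFn_derivL W 2 ℓ 1 v, ExpSobolev.coeFn_derivL W 2 ℓ 2 v, e1, e2]
    with x x0 x1 x2 x3 x4 x5 x6 x7 x8
  rw [x0, Pi.add_apply, x1, Pi.add_apply, x2, x3, x4, x5, x6, x7, x8]
  have hW : (W x : ℂ) ≠ 0 := Complex.ofReal_ne_zero.2 (W.pos x).ne'
  have n0 : weakDeriv^[((0 : Fin (2 + 1)) : ℕ)] (W.mul v) x = W x * v x := rfl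
  have n1 : weakDeriv^[((1 : Fin (2 + 1)) : ℕ)] (W.mul v) x = weakDeriv (W.mul v) x := rfl
  have n2 : weakDeriv^[((2 : Fin (2 + 1)) : ℕ)] (W.mul v) x
    = weakDeriv (weakDeriv (W.mul v)) x := rfl
  rw [n0, n1, n2]
  simp only [ExpWeight.mul]
  push_cast
  field_simp
  ring

end Operators

/-! ### Analytic families of exponentials -/

section ExpFamily

variable {η : ℝ} (W : ExpWeight (-η) η) (ℓ : ℝ≥0∞) [Fact (1 ≤ ℓ)]

theorem norm_exp_sub_one_sub_le (z : ℂ) :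
    ‖Complex.exp z - 1 - z‖ ≤ ‖z‖ ^ 2 * Real.exp ‖z‖ := by
  have := Complex.norm_exp_sub_sum_le_norm_mul_exp z 2
  simpa [Finset.sum_range_succ, sub_sub] using this

theorem sq_le_exp_mul {s : ℝ} (hs : 0 < s) {y : ℝ} (hy : 0 ≤ y) :
    y ^ 2 ≤ 2 / s ^ 2 * Real.exp (s * y) := by
  have := Real.pow_div_factorial_le_exp (s * y) (by positivity) 2
  rw [div_mul_eq_mul_div, le_div_iff₀ (by positivity)]
  simp only [Nat.factorial] at this
  norm_num at this
  nlinarith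

/-- The derivative in `z` is multiplication by `x`. For `‖z‖ < κ - η` the decay of `a` beats both
the weight and the exponential, with room left for polynomial factors. -/
theorem exists_expFamily {a : ℝ → ℂ} (ha : Continuous a) {κ C : ℝ}
    (hC : ∀ x, ‖a x‖ ≤ C * Real.exp (-κ * |x|)) (hℓ : ℓ = 1 ∨ ℓ = ⊤) :
    ∃ Φ : ℂ → ExpSobolev W 0 ℓ, DifferentiableOn ℂ Φ (Metric.ball 0 (κ - η)) ∧
      ∀ z ∈ Metric.ball (0 : ℂ) (κ - η),
        (Φ z : ℝ → ℂ) =ᵐ[volume] fun x => a x * Complex.exp (z * x) := by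
  obtain ⟨CW, hCW, hW⟩ := W.exists_le_exp_abs
  have hC0 : 0 ≤ C := by
    have := (norm_nonneg _).trans (hC 0); simpa using this
  have hexp : ∀ (z : ℂ) (x : ℝ), ‖Complex.exp (z * x)‖ ≤ Real.exp (‖z‖ * |x|) := fun z x => by
    refine (Complex.norm_exp_le_exp_norm _).trans (le_of_eq ?_)
    rw [norm_mul, Complex.norm_real, Real.norm_eq_abs]
  have hWn : ∀ x, ‖(W x : ℂ)‖ ≤ CW * Real.exp (η * |x|) := fun x => by
    rw [Complex.norm_real, Real.norm_of_nonneg (W.pos x).le]; exact hW x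
  have hcont : ∀ z : ℂ, Continuous fun x : ℝ => (W x : ℂ) * (a x * Complex.exp (z * x)) :=
    fun z => (Complex.continuous_ofReal.comp W.continuous).mul (ha.mul (by fun_prop))
  have hmem : ∀ z ∈ Metric.ball (0 : ℂ) (κ - η),
      MemLp (fun x : ℝ => (W x : ℂ) * (a x * Complex.exp (z * x))) ℓ volume := by
    intro z hz
    have hz' : ‖z‖ < κ - η := by simpa using hz
    refine MemLp.of_le_mul (c := CW * C) (memLp_exp_neg_mul_abs (sub_pos.2 hz') hℓ)
      (hcont z).aestronglyMeasurable (Eventually.of_forall fun x => ?_)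
    rw [Real.norm_eq_abs, Real.abs_exp, norm_mul, norm_mul]
    calc ‖(W x : ℂ)‖ * (‖a x‖ * ‖Complex.exp (z * x)‖)
        ≤ (CW * Real.exp (η * |x|)) * (C * Real.exp (-κ * |x|) * Real.exp (‖z‖ * |x|)) := by
          gcongr
          exacts [hWn x, hC x, hexp z x]
      _ = CW * C * Real.exp (-(κ - η - ‖z‖) * |x|) := by
          have : -(κ - η - ‖z‖) * |x| = η * |x| + (-κ * |x| + ‖z‖ * |x|) := by ring
          rw [this, Real.exp_add, Real.exp_add]; ring
  classical
  let Ψ : ℂ → Lp ℂ ℓ (volume : Measure ℝ) := fun z =>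
    if h : z ∈ Metric.ball (0 : ℂ) (κ - η) then (hmem z h).toLp _ else 0
  have hΨ : ∀ z ∈ Metric.ball (0 : ℂ) (κ - η),
      (Ψ z : ℝ → ℂ) =ᵐ[volume] fun x => (W x : ℂ) * (a x * Complex.exp (z * x)) := by
    intro z hz
    simp only [Ψ, dif_pos hz]
    exact (hmem z hz).coeFn_toLp
  refine ⟨fun z => ExpSobolev.ofLp W ℓ (Ψ z), ?_, fun z hz => ?_⟩
  · refine (ExpSobolev.ofLp W ℓ).differentiable.comp_differentiableOn ?_
    intro z₀ hz₀
    have hz₀' : ‖z₀‖ < κ - η := by simpa using hz₀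
    -- The spare decay is split in three: one share absorbs `x²`, one absorbs `e^{|z - z₀||x|}`, and
    -- one keeps the remainder in `L^ℓ`.
    set s := (κ - η - ‖z₀‖) / 3 with hs
    have hs0 : 0 < s := by rw [hs]; linarith
    have hB : MemLp (fun x : ℝ => Real.exp (-s * |x|)) ℓ volume := memLp_exp_neg_mul_abs hs0 hℓ
    set M := CW * C * (2 / s ^ 2) with hM
    have hDb : ∀ x : ℝ, ‖(W x : ℂ) * (a x * ((x : ℂ) * Complex.exp (z₀ * x)))‖
        ≤ CW * C * (1 / s) * ‖Real.exp (-s * |x|)‖ := fun x => by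
      rw [Real.norm_eq_abs, Real.abs_exp, norm_mul, norm_mul, norm_mul]
      have hx1 : ‖(x : ℂ)‖ ≤ (1 / s) * Real.exp (s * |x|) := by
        rw [Complex.norm_real, Real.norm_eq_abs, div_mul_eq_mul_div, le_div_iff₀ hs0, one_mul]
        have := Real.add_one_le_exp (s * |x|)
        linarith
      calc ‖(W x : ℂ)‖ * (‖a x‖ * (‖(x : ℂ)‖ * ‖Complex.exp (z₀ * x)‖))
          ≤ (CW * Real.exp (η * |x|)) * (C * Real.exp (-κ * |x|) *
              ((1 / s) * Real.exp (s * |x|) * Real.exp (‖z₀‖ * |x|))) := by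
            gcongr
            exacts [hWn x, hC x, hexp z₀ x]
        _ = CW * C * (1 / s) * Real.exp (-(2 * s) * |x|) := by
            have : -(2 * s) * |x| = η * |x| + (-κ * |x| + (s * |x| + ‖z₀‖ * |x|)) := by
              rw [hs]; ring
            rw [this, Real.exp_add, Real.exp_add, Real.exp_add]; ring
        _ ≤ _ := by
            gcongr
            nlinarith [abs_nonneg x]
    have hDm : MemLp (fun x : ℝ => (W x : ℂ) * (a x * ((x : ℂ) * Complex.exp (z₀ * x)))) ℓ volume :=
      MemLp.of_le_mul (c := CW * C * (1 / s)) hB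
        ((Complex.continuous_ofReal.comp W.continuous).mul
          (ha.mul (by fun_prop))).aestronglyMeasurable (Eventually.of_forall hDb)
    refine HasDerivAt.differentiableAt (f' := hDm.toLp _) ?_ |>.differentiableWithinAt
    rw [hasDerivAt_iff_isLittleO]
    refine Asymptotics.IsBigO.trans_isLittleO ?_
      (Asymptotics.isLittleO_pow_sub_sub z₀ one_lt_two)
    refine Asymptotics.IsBigO.of_bound (M * ‖hB.toLp _‖) ?_
    filter_upwards [Metric.ball_mem_nhds z₀ hs0, Metric.isOpen_ball.mem_nhds hz₀] with z hzs hz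
    have hzs' : ‖z - z₀‖ < s := by simpa [dist_eq_norm] using hzs
    rw [norm_pow, norm_norm]
    have key : ‖Ψ z - Ψ z₀ - (z - z₀) • hDm.toLp _‖ ≤ (M * ‖z - z₀‖ ^ 2) * ‖hB.toLp _‖ := by
      refine Lp.norm_le_mul_norm_of_ae_le_mul ?_
      filter_upwards [Lp.coeFn_sub (Ψ z - Ψ z₀) ((z - z₀) • hDm.toLp _), Lp.coeFn_sub (Ψ z) (Ψ z₀),
        Lp.coeFn_smul (z - z₀) (hDm.toLp _), hΨ z hz, hΨ z₀ hz₀, hDm.coeFn_toLp, hB.coeFn_toLp]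
        with x x1 x2 x3 x4 x5 x6 x7
      rw [x1, Pi.sub_apply, x2, Pi.sub_apply, x3, Pi.smul_apply, x4, x5, x6, x7, smul_eq_mul]
      have e : (W x : ℂ) * (a x * Complex.exp (z * x)) - (W x : ℂ) * (a x * Complex.exp (z₀ * x))
          - (z - z₀) * ((W x : ℂ) * (a x * ((x : ℂ) * Complex.exp (z₀ * x))))
          = (W x : ℂ) * (a x * (Complex.exp (z₀ * x) *
            (Complex.exp ((z - z₀) * x) - 1 - (z - z₀) * x))) := by
        have : Complex.exp (z * x) = Complex.exp (z₀ * x) * Complex.exp ((z - z₀) * x) := by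
          rw [← Complex.exp_add]; ring_nf
        rw [this]; ring
      rw [e, norm_mul, norm_mul, norm_mul, Real.norm_eq_abs, Real.abs_exp]
      have h1 : ‖Complex.exp ((z - z₀) * x) - 1 - (z - z₀) * x‖
          ≤ ‖z - z₀‖ ^ 2 * ((2 / s ^ 2) * Real.exp (s * |x|)) * Real.exp (s * |x|) := by
        refine (norm_exp_sub_one_sub_le _).trans ?_
        rw [norm_mul, Complex.norm_real, Real.norm_eq_abs, mul_pow]
        have := sq_le_exp_mul hs0 (abs_nonneg x)
        gcongr
      calc ‖(W x : ℂ)‖ * (‖a x‖ * (‖Complex.exp (z₀ * x)‖ *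
            ‖Complex.exp ((z - z₀) * x) - 1 - (z - z₀) * x‖))
          ≤ (CW * Real.exp (η * |x|)) * (C * Real.exp (-κ * |x|) * (Real.exp (‖z₀‖ * |x|) *
            (‖z - z₀‖ ^ 2 * ((2 / s ^ 2) * Real.exp (s * |x|)) * Real.exp (s * |x|)))) := by
            gcongr
            exacts [hWn x, hC x, hexp z₀ x]
        _ = M * ‖z - z₀‖ ^ 2 * Real.exp (-s * |x|) := by
            have : -s * |x| = η * |x| + (-κ * |x| + (‖z₀‖ * |x| + (s * |x| + s * |x|))) := by
              rw [hs]; ring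
            rw [this, Real.exp_add, Real.exp_add, Real.exp_add, Real.exp_add, hM]; ring
    refine key.trans (le_of_eq (by ring))
  · refine (ExpSobolev.coeFn_ofLp W ℓ _).trans ?_
    filter_upwards [hΨ z hz] with x hx
    rw [hx, ← mul_assoc, inv_mul_cancel₀ (Complex.ofReal_ne_zero.2 (W.pos x).ne'), one_mul]

end ExpFamily

theorem hasDerivAt_cexp_mul (z : ℂ) (x : ℝ) :
    HasDerivAt (fun y : ℝ => Complex.exp (z * y)) (z * Complex.exp (z * x)) x := by
  have h := ((Complex.ofRealCLM.hasDerivAt (x := x)).const_mul z).cexp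
  simp only [Complex.ofRealCLM_apply, Complex.ofReal_one, mul_one] at h
  rw [mul_comm]; exact h

theorem isPrim_mode {θ : ℝ → ℝ} (hθ : ContDiff ℝ ∞ θ) (z : ℂ) :
    IsPrim (fun x => (θ x : ℂ) * Complex.exp (z * x))
      (fun x => (((deriv θ x : ℝ) : ℂ) + z * (θ x : ℂ)) * Complex.exp (z * x)) ∧
    IsPrim (fun x => (((deriv θ x : ℝ) : ℂ) + z * (θ x : ℂ)) * Complex.exp (z * x))
      (fun x => (((deriv (deriv θ) x : ℝ) : ℂ) + 2 * z * ((deriv θ x : ℝ) : ℂ)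
        + z ^ 2 * (θ x : ℂ)) * Complex.exp (z * x)) := by
  have s1 := (contDiff_infty_iff_deriv.1 hθ).2
  have c0 := Complex.continuous_ofReal.comp hθ.continuous
  have c1 := Complex.continuous_ofReal.comp s1.continuous
  have c2 := Complex.continuous_ofReal.comp (s1.continuous_deriv (by simp))
  have ce : Continuous fun x : ℝ => Complex.exp (z * x) := by fun_prop
  have d0 := fun x => (hθ.differentiable (by simp) x).hasDerivAt.ofReal_comp
  have d1 := fun x => (s1.differentiable (by simp) x).hasDerivAt.ofReal_comp
  constructor
  · refine IsPrim.of_hasDerivAt (fun x => ?_) ((c1.add (continuous_const.mul c0)).mul ce)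
    exact ((d0 x).mul (hasDerivAt_cexp_mul z x)).congr_deriv (by ring)
  · refine IsPrim.of_hasDerivAt (fun x => ?_)
      (((c2.add (continuous_const.mul c1)).add (continuous_const.mul c0)).mul ce)
    exact (((d1 x).add ((d0 x).const_mul z)).mul (hasDerivAt_cexp_mul z x)).congr_deriv
      (by simp only [Pi.add_apply]; ring)

/-! ### Residuals of the far-field modes. -/

section Modes

variable {η : ℝ} (W : ExpWeight (-η) η) (ℓ : ℝ≥0∞) [Fact (1 ≤ ℓ)]

/-- Applying `L_ψ - γ²` to `θ e^{ζx}` gives `e^{ζx}` times `L_ψ θ + 2ζ θ' + (ζ² + βζ - γ²) θ`, where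
`β` is the drift coefficient on the support of `θ`. The dispersion relation kills the last term, so
only localized coefficients remain. -/
theorem exists_mode_family {q : ℝ → ℝ} (hq : Continuous q) (w : ExpWeight 0 1) {θ : ℝ → ℝ}
    (hθ : ContDiff ℝ ∞ θ) {β κ C : ℝ} (hκ : η < κ) (hβ : ∀ x, coefB w x * θ x = β * θ x)
    (h0 : ∀ x, |deriv (deriv θ) x + coefB w x * deriv θ x + (coefC w x - q x ^ 2) * θ x|
      ≤ C * Real.exp (-κ * |x|))
    (h1 : ∀ x, |2 * deriv θ x| ≤ C * Real.exp (-κ * |x|)) (hℓ : ℓ = 1 ∨ ℓ = ⊤)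
    {ζ : ℂ → ℂ} {r : ℝ} (hr : 0 < r) (hζ : DifferentiableOn ℂ ζ (Metric.ball 0 r)) (hζ0 : ζ 0 = 0)
    (hdisp : ∀ γ ∈ Metric.ball (0 : ℂ) r, ζ γ ^ 2 + β * ζ γ = γ ^ 2) :
    ∃ δ, 0 < δ ∧ ∃ m : ℂ → ExpSobolev W 0 ℓ, DifferentiableOn ℂ m (Metric.ball 0 δ) ∧
      ∀ γ ∈ Metric.ball (0 : ℂ) δ, (m γ : ℝ → ℂ) =ᵐ[volume]
        LpsiShift q w γ (fun x => (θ x : ℂ) * Complex.exp (ζ γ * x)) := by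
  have s1 := (contDiff_infty_iff_deriv.1 hθ).2
  have c1 := s1.continuous
  have c2 : Continuous (deriv (deriv θ)) := s1.continuous_deriv (by simp)
  have ca0 : Continuous fun x => ((deriv (deriv θ) x + coefB w x * deriv θ x
      + (coefC w x - q x ^ 2) * θ x : ℝ) : ℂ) :=
    Complex.continuous_ofReal.comp ((c2.add ((continuous_coefB w).mul c1)).add
      (((continuous_coefC w).sub (hq.pow 2)).mul hθ.continuous))
  have ca1 : Continuous fun x => ((2 * deriv θ x : ℝ) : ℂ) :=
    Complex.continuous_ofReal.comp (continuous_const.mul c1)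
  obtain ⟨Φ0, hd0, he0⟩ := exists_expFamily W ℓ ca0 (κ := κ) (C := C)
    (fun x => by rw [Complex.norm_real]; exact h0 x) hℓ
  obtain ⟨Φ1, hd1, he1⟩ := exists_expFamily W ℓ ca1 (κ := κ) (C := C)
    (fun x => by rw [Complex.norm_real]; exact h1 x) hℓ
  have hcont : ContinuousAt ζ 0 :=
    (hζ.differentiableAt (Metric.ball_mem_nhds 0 hr)).continuousAt
  -- As `ζ` vanishes at `0`, small `γ` keep the exponent inside the disc where the exponential
  -- family is holomorphic.
  obtain ⟨δ', hδ', hball⟩ := Metric.continuousAt_iff.1 hcont (κ - η) (sub_pos.2 hκ)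
  have hmaps : MapsTo ζ (Metric.ball 0 (min δ' r)) (Metric.ball 0 (κ - η)) := by
    intro γ hγ
    have := hball (lt_of_lt_of_le hγ (min_le_left _ _))
    rwa [hζ0] at this
  have hζ' : DifferentiableOn ℂ ζ (Metric.ball 0 (min δ' r)) :=
    hζ.mono (Metric.ball_subset_ball (min_le_right _ _))
  refine ⟨min δ' r, lt_min hδ' hr, fun γ => Φ0 (ζ γ) + ζ γ • Φ1 (ζ γ),
    (hd0.comp hζ' hmaps).add (hζ'.smul (hd1.comp hζ' hmaps)), fun γ hγ => ?_⟩
  obtain ⟨p1, p2⟩ := isPrim_mode hθ (ζ γ)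
  have eL := Lpsi_ae (q := q) (w := w) p1.isWeakDeriv p2.isWeakDeriv
  have hdγ := hdisp γ (Metric.ball_subset_ball (min_le_right _ _) hγ)
  filter_upwards [ExpSobolev.coeFn_add W 0 ℓ (Φ0 (ζ γ)) (ζ γ • Φ1 (ζ γ)),
    ExpSobolev.coeFn_smul W 0 ℓ (ζ γ) (Φ1 (ζ γ)), he0 _ (hmaps hγ), he1 _ (hmaps hγ), eL]
    with x x1 x2 x3 x4 x5
  have hb : (coefB w x : ℂ) * (θ x : ℂ) = (β : ℂ) * (θ x : ℂ) := by
    exact_mod_cast hβ x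
  rw [x1, x2, x3, x4, LpsiShift, x5]
  push_cast
  linear_combination (- ζ γ * Complex.exp (ζ γ * x)) * hb
    - (θ x : ℂ) * Complex.exp (ζ γ * x) * hdγ

theorem nuPlus_sq (lam : ℂ) : nuPlus lam ^ 2 + 2 * nuPlus lam = lam := by
  have : ((1 + lam) ^ (1 / 2 : ℂ)) ^ 2 = 1 + lam := by
    rw [← Complex.cpow_nat_mul]; norm_num
  rw [nuPlus]; linear_combination this

theorem nuPlus_zero : nuPlus 0 = 0 := by simp [nuPlus]

theorem differentiableOn_nuPlus_sq :
    DifferentiableOn ℂ (fun γ => nuPlus (γ ^ 2)) (Metric.ball 0 1) := by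
  intro γ hγ
  have hγ' : ‖γ‖ < 1 := by simpa using hγ
  have hs : 1 + γ ^ 2 ∈ Complex.slitPlane := by
    apply Complex.mem_slitPlane_of_norm_lt_one
    rw [norm_pow]; nlinarith [norm_nonneg γ]
  have : DifferentiableAt ℂ (fun γ : ℂ => (1 + γ ^ 2) ^ (1 / 2 : ℂ)) γ :=
    DifferentiableAt.cpow_const (by fun_prop) hs
  exact (this.const_add (-1)).differentiableWithinAt

/-- From `q ≤ D (1 + x) e^{-x}`, each factor `1 + x` being at most `4 e^{x/4}`. The version with `(1
+ x)²` handles `q² U`, where `U` may initially grow quadratically. -/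
theorem IsCriticalFront.exists_sq_le {q : ℝ → ℝ} (hq : IsCriticalFront q) :
    ∃ C, 0 < C ∧ (∀ x, 0 ≤ x → q x ^ 2 ≤ C * Real.exp (-x)) ∧
      ∀ x, 0 ≤ x → q x ^ 2 * (1 + x) ^ 2 ≤ C * Real.exp (-x) := by
  obtain ⟨D, hD, h⟩ := hq.exists_u_le
  have key : ∀ x, 0 ≤ x → q x ^ 2 * (1 + x) ^ 2 ≤ 256 * D ^ 2 * Real.exp (-x) := by
    intro x hx
    have h1 := h x hx
    have h2 : 1 + x ≤ 4 * Real.exp (x / 4) := by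
      have := Real.add_one_le_exp (x / 4); linarith
    have h0 := hq.pos x
    have e1 : q x * (1 + x) = Real.exp (-x) * ((Real.exp x * q x) * (1 + x)) := by
      rw [← mul_assoc, ← mul_assoc, ← Real.exp_add]; simp
    have h3 : q x * (1 + x) ≤ Real.exp (-x) * (D * (4 * Real.exp (x / 4)) * (4 * Real.exp (x / 4))) := by
      rw [e1]
      refine mul_le_mul_of_nonneg_left (mul_le_mul (h1.trans ?_) h2 (by linarith) (by positivity))
        (Real.exp_pos _).le
      exact mul_le_mul_of_nonneg_left h2 hD.le
    have e2 : Real.exp (-x) * (D * (4 * Real.exp (x / 4)) * (4 * Real.exp (x / 4)))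
        = 16 * D * Real.exp (-x / 2) := by
      have : Real.exp (-x / 2) = Real.exp (-x) * (Real.exp (x / 4) * Real.exp (x / 4)) := by
        rw [← Real.exp_add, ← Real.exp_add]; ring_nf
      rw [this]; ring
    rw [e2] at h3
    have e3 : 256 * D ^ 2 * Real.exp (-x) = (16 * D * Real.exp (-x / 2)) ^ 2 := by
      have : Real.exp (-x) = Real.exp (-x / 2) * Real.exp (-x / 2) := by
        rw [← Real.exp_add]; ring_nf
      rw [this]; ring
    rw [e3, ← mul_pow]
    exact pow_le_pow_left₀ (by positivity) h3 2
  refine ⟨256 * D ^ 2, by positivity, fun x hx => le_trans ?_ (key x hx), key⟩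
  have : 1 ≤ (1 + x) ^ 2 := by nlinarith
  nlinarith [sq_nonneg (q x)]

theorem IsCriticalFront.exists_one_sub_sq_le {q : ℝ → ℝ} (hq : IsCriticalFront q) :
    ∃ C, 0 < C ∧ ∀ x ≤ 0, |1 - q x ^ 2| ≤ C * Real.exp (x / 4) := by
  obtain ⟨C, hC, h⟩ := hq.exists_left_bound
  obtain ⟨Q, hQ, h'⟩ := hq.exists_le
  refine ⟨C * (1 + Q), by positivity, fun x hx => ?_⟩
  have e : 1 - q x ^ 2 = (1 - q x) * (1 + q x) := by ring
  have h0 := hq.pos x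
  rw [e, abs_mul, abs_of_pos (by linarith : 0 < 1 + q x)]
  have := h x hx
  have := h' x
  calc |1 - q x| * (1 + q x) ≤ (C * Real.exp (x / 4)) * (1 + Q) := by gcongr
    _ = _ := by ring

theorem exists_le_exp_of_outside {f : ℝ → ℝ} (hf : Continuous f) {R D κ : ℝ}
    (h : ∀ x, R ≤ |x| → |f x| ≤ D * Real.exp (-κ * |x|)) :
    ∃ C, 0 < C ∧ ∀ x, |f x| ≤ C * Real.exp (-κ * |x|) := by
  obtain ⟨C, hC, hb⟩ := exists_bound_of_outside (F := fun x => f x / Real.exp (-κ * |x|)) (R := R)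
    (D := D) (hf.div (continuous_exp_abs _) fun x => (Real.exp_pos _).ne') fun x hx => by
      rw [Real.norm_eq_abs, abs_div, Real.abs_exp, div_le_iff₀ (Real.exp_pos _)]
      exact h x hx
  refine ⟨C, hC, fun x => ?_⟩
  have := hb x
  rwa [Real.norm_eq_abs, abs_div, Real.abs_exp, div_le_iff₀ (Real.exp_pos _)] at this

theorem deriv_eq_zero_of_eventuallyEq_const {f : ℝ → ℝ} {c x : ℝ} (h : ∀ᶠ y in 𝓝 x, f y = c) :
    deriv f x = 0 ∧ deriv (deriv f) x = 0 := by
  have e : f =ᶠ[𝓝 x] fun _ => c := h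
  have e1 : deriv f =ᶠ[𝓝 x] fun _ => 0 := by simpa using e.deriv
  exact ⟨e1.self_of_nhds, by simpa using e1.deriv_eq⟩

namespace IsCutoff

variable {χ : ℝ → ℝ} (hχ : IsCutoff χ)
include hχ

theorem deriv_left {x : ℝ} (hx : x < 2) : deriv χ x = 0 ∧ deriv (deriv χ) x = 0 :=
  deriv_eq_zero_of_eventuallyEq_const (c := 0) (by
    filter_upwards [Iio_mem_nhds hx] with y hy using hχ.left y (le_of_lt hy))

theorem deriv_right {x : ℝ} (hx : 3 < x) : deriv χ x = 0 ∧ deriv (deriv χ) x = 0 :=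
  deriv_eq_zero_of_eventuallyEq_const (c := 1) (by
    filter_upwards [Ioi_mem_nhds hx] with y hy using hχ.right y (le_of_lt hy))

theorem reflect_smooth : ContDiff ℝ ∞ fun x => χ (-x) := hχ.smooth.comp contDiff_neg

theorem reflect_deriv_right {x : ℝ} (hx : -2 < x) :
    deriv (fun y => χ (-y)) x = 0 ∧ deriv (deriv fun y => χ (-y)) x = 0 :=
  deriv_eq_zero_of_eventuallyEq_const (c := 0) (by
    filter_upwards [Ioi_mem_nhds hx] with y hy
      using hχ.left _ (by have : -2 < y := hy; linarith))

theorem reflect_deriv_left {x : ℝ} (hx : x < -3) :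
    deriv (fun y => χ (-y)) x = 0 ∧ deriv (deriv fun y => χ (-y)) x = 0 :=
  deriv_eq_zero_of_eventuallyEq_const (c := 1) (by
    filter_upwards [Iio_mem_nhds hx] with y hy
      using hχ.right _ (by have : y < -3 := hy; linarith))

end IsCutoff

/-- Beyond the transition of the cutoff only `-q²` survives at `+∞`. The drift is zero there, so `ζ
= -γ` solves the dispersion relation. -/
theorem exists_modeRight_family {q : ℝ → ℝ} (hq : IsCriticalFront q) (w : ExpWeight 0 1)
    {χ : ℝ → ℝ} (hχ : IsCutoff χ) (hη : η < 1 / 4) (hℓ : ℓ = 1 ∨ ℓ = ⊤) :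
    ∃ δ, 0 < δ ∧ ∃ m : ℂ → ExpSobolev W 0 ℓ, DifferentiableOn ℂ m (Metric.ball 0 δ) ∧
      ∀ γ ∈ Metric.ball (0 : ℂ) δ, (m γ : ℝ → ℂ) =ᵐ[volume]
        LpsiShift q w γ (modeRight χ γ) := by
  obtain ⟨D, hD, hq2, -⟩ := hq.exists_sq_le
  have s1 := (contDiff_infty_iff_deriv.1 hχ.smooth).2
  have c1 := s1.continuous
  have c2 : Continuous (deriv (deriv χ)) := s1.continuous_deriv (by simp)
  -- For `|x| ≥ 4` the cutoff is constant and the coefficients of `L_ψ` have their limiting form.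
  obtain ⟨C0, hC0, h0⟩ := exists_le_exp_of_outside (R := 4) (D := D) (κ := 1 / 4)
    (f := fun x => deriv (deriv χ) x + coefB w x * deriv χ x + (coefC w x - q x ^ 2) * χ x)
    ((c2.add ((continuous_coefB w).mul c1)).add
      (((continuous_coefC w).sub (hq.continuous.pow 2)).mul hχ.smooth.continuous))
    fun x hx => by
      rcases le_abs.1 hx with h | h
      · have hd := hχ.deriv_right (x := x) (by linarith)
        have hc := coef_right w (x := x) (by linarith)
        rw [hd.1, hd.2, hc.1, hc.2, hχ.right x (by linarith), abs_of_pos (by linarith : 0 < x)]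
        have := hq2 x (by linarith)
        have e : |0 + 0 * 0 + (0 - q x ^ 2) * 1| = q x ^ 2 := by
          rw [show (0 : ℝ) + 0 * 0 + (0 - q x ^ 2) * 1 = -(q x ^ 2) by ring, abs_neg,
            abs_of_nonneg (sq_nonneg _)]
        rw [e]
        refine this.trans (mul_le_mul_of_nonneg_left (Real.exp_le_exp.2 (by linarith)) hD.le)
      · have hd := hχ.deriv_left (x := x) (by linarith)
        rw [hd.1, hd.2, hχ.left x (by linarith)]
        simp; positivity
  obtain ⟨C1, hC1, h1⟩ := exists_le_exp_of_outside (R := 4) (D := 0) (κ := 1 / 4)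
    (f := fun x => 2 * deriv χ x) (continuous_const.mul c1) fun x hx => by
      rcases le_abs.1 hx with h | h
      · simp [(hχ.deriv_right (x := x) (by linarith)).1]
      · simp [(hχ.deriv_left (x := x) (by linarith)).1]
  refine exists_mode_family W ℓ hq.continuous w hχ.smooth (β := 0) (κ := 1 / 4) (C := C0 + C1) hη
    (fun x => ?_) (fun x => (h0 x).trans ?_) (fun x => (h1 x).trans ?_) hℓ (ζ := fun γ => -γ)
    one_pos differentiable_neg.differentiableOn neg_zero (fun γ _ => by push_cast; ring)
  · rcases le_or_gt x 1 with h | h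
    · rw [hχ.left x (by linarith)]; ring
    · rw [(coef_right w h).1]
  · exact mul_le_mul_of_nonneg_right (by linarith) (Real.exp_pos _).le
  · exact mul_le_mul_of_nonneg_right (by linarith) (Real.exp_pos _).le

/-- On the left the surviving coefficient is `1 - q²`, of rate `1/4`. The drift is `2`, and `ν⁺(γ²)`
is the root of `ζ² + 2ζ = γ²` that vanishes at `γ = 0`. -/
theorem exists_modeLeft_family {q : ℝ → ℝ} (hq : IsCriticalFront q) (w : ExpWeight 0 1)
    {χ : ℝ → ℝ} (hχ : IsCutoff χ) (hη : η < 1 / 4) (hℓ : ℓ = 1 ∨ ℓ = ⊤) :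
    ∃ δ, 0 < δ ∧ ∃ m : ℂ → ExpSobolev W 0 ℓ, DifferentiableOn ℂ m (Metric.ball 0 δ) ∧
      ∀ γ ∈ Metric.ball (0 : ℂ) δ, (m γ : ℝ → ℂ) =ᵐ[volume]
        LpsiShift q w γ (modeLeft χ γ) := by
  obtain ⟨D, hD, hq2⟩ := hq.exists_one_sub_sq_le
  have s1 := (contDiff_infty_iff_deriv.1 hχ.reflect_smooth).2
  have c1 := s1.continuous
  have c2 : Continuous (deriv (deriv fun x => χ (-x))) := s1.continuous_deriv (by simp)
  obtain ⟨C0, hC0, h0⟩ := exists_le_exp_of_outside (R := 4) (D := D) (κ := 1 / 4)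
    (f := fun x => deriv (deriv fun y => χ (-y)) x + coefB w x * deriv (fun y => χ (-y)) x
      + (coefC w x - q x ^ 2) * χ (-x))
    ((c2.add ((continuous_coefB w).mul c1)).add
      (((continuous_coefC w).sub (hq.continuous.pow 2)).mul hχ.reflect_smooth.continuous))
    fun x hx => by
      rcases le_abs.1 hx with h | h
      · have hd := hχ.reflect_deriv_right (x := x) (by linarith)
        rw [hd.1, hd.2, hχ.left (-x) (by linarith)]
        simp; positivity
      · have hd := hχ.reflect_deriv_left (x := x) (by linarith)
        have hc := coef_left w (x := x) (by linarith)
        rw [hd.1, hd.2, hc.1, hc.2, hχ.right (-x) (by linarith), abs_of_neg (by linarith : x < 0)]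
        have := hq2 x (by linarith)
        rw [show (0 : ℝ) + 2 * 0 + (1 - q x ^ 2) * 1 = 1 - q x ^ 2 by ring]
        refine this.trans (mul_le_mul_of_nonneg_left (Real.exp_le_exp.2 (by linarith)) hD.le)
  obtain ⟨C1, hC1, h1⟩ := exists_le_exp_of_outside (R := 4) (D := 0) (κ := 1 / 4)
    (f := fun x => 2 * deriv (fun y => χ (-y)) x) (continuous_const.mul c1) fun x hx => by
      rcases le_abs.1 hx with h | h
      · simp [(hχ.reflect_deriv_right (x := x) (by linarith)).1]
      · simp [(hχ.reflect_deriv_left (x := x) (by linarith)).1]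
  refine exists_mode_family W ℓ hq.continuous w hχ.reflect_smooth (β := 2) (κ := 1 / 4)
    (C := C0 + C1) hη
    (fun x => ?_) (fun x => (h0 x).trans ?_) (fun x => (h1 x).trans ?_) hℓ
    (ζ := fun γ => nuPlus (γ ^ 2))
    one_pos differentiableOn_nuPlus_sq (by simp [nuPlus_zero])
    (fun γ _ => by push_cast; exact nuPlus_sq _)
  · rcases le_or_gt (-1) x with h | h
    · rw [hχ.left (-x) (by linarith)]; ring
    · rw [(coef_left w h).1]
  · exact mul_le_mul_of_nonneg_right (by linarith) (Real.exp_pos _).le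
  · exact mul_le_mul_of_nonneg_right (by linarith) (Real.exp_pos _).le

end Modes

/-! ### Conjugation of `L_ψ` to a Schrödinger operator -/

noncomputable section

/-- The conjugating factor `e^x / w(x)`. -/
def conj0 (w : ℝ → ℝ) (x : ℝ) : ℝ := Real.exp x * (w x)⁻¹

/-- The first derivative of `conj0`. -/
def conj1 (w : ℝ → ℝ) (x : ℝ) : ℝ := Real.exp x * ((w x)⁻¹ + deriv (fun y => (w y)⁻¹) x)

/-- The second derivative of `conj0`. -/
def conj2 (w : ℝ → ℝ) (x : ℝ) : ℝ :=
  Real.exp x * ((w x)⁻¹ + 2 * deriv (fun y => (w y)⁻¹) x + deriv (deriv fun y => (w y)⁻¹) x)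

end

section Conj

variable {ηm ηp : ℝ} (w : ExpWeight ηm ηp)

theorem conj0_pos (x : ℝ) : 0 < conj0 w x := mul_pos (Real.exp_pos x) (inv_pos.2 (w.pos x))

theorem hasDerivAt_conj0 (x : ℝ) : HasDerivAt (conj0 w) (conj1 w x) x :=
  ((Real.hasDerivAt_exp x).mul (w.hasDerivAt_inv x)).congr_deriv (by rw [conj1]; ring)

theorem hasDerivAt_conj1 (x : ℝ) : HasDerivAt (conj1 w) (conj2 w x) x :=
  ((Real.hasDerivAt_exp x).mul ((w.hasDerivAt_inv x).add (w.hasDerivAt_inv_deriv x))).congr_deriv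
    (by rw [conj2]; simp only [Pi.add_apply]; ring)

theorem continuous_conj0 : Continuous (conj0 w) :=
  continuous_iff_continuousAt.2 fun x => (hasDerivAt_conj0 w x).continuousAt

theorem continuous_conj1 : Continuous (conj1 w) :=
  continuous_iff_continuousAt.2 fun x => (hasDerivAt_conj1 w x).continuousAt

theorem continuous_conj2 : Continuous (conj2 w) :=
  Real.continuous_exp.mul (((w.inv_smooth.continuous).add
    (continuous_const.mul w.continuous_inv_deriv)).add w.continuous_inv_deriv_deriv)

/-- Together with the next identity this says that `e^x ω⁻¹ (L_ψ + q²) ψ = (e^x ω⁻¹ ψ)''`. -/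
theorem conj0_mul_coefB (x : ℝ) : conj0 w x * coefB w x = 2 * conj1 w x := by
  have := (w.pos x).ne'
  rw [conj0, conj1, coefB]; field_simp

theorem conj0_mul_coefC (x : ℝ) : conj0 w x * coefC w x = conj2 w x := by
  have := (w.pos x).ne'
  rw [conj0, conj2, coefC]; field_simp; ring

end Conj

theorem conj0_right (w : ExpWeight 0 1) {x : ℝ} (hx : 1 ≤ x) : conj0 w x = 1 := by
  rw [conj0, w.right x hx, one_mul, mul_inv_cancel₀ (Real.exp_pos x).ne']

theorem conj0_left (w : ExpWeight 0 1) {x : ℝ} (hx : x ≤ -1) : conj0 w x = Real.exp x := by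
  rw [conj0, w.left x hx]; simp

theorem not_integrableOn_Ioi_of_one_le {F : ℝ → ℂ} {a b : ℝ} (h : ∀ x, b ≤ x → 1 ≤ ‖F x‖)
    (hF : IntegrableOn F (Ioi a)) : False := by
  have h1 : IntegrableOn F (Ioi (max a b)) := hF.mono_set (Ioi_subset_Ioi (le_max_left _ _))
  have h2 : IntegrableOn (fun _ : ℝ => (1 : ℝ)) (Ioi (max a b)) := by
    refine Integrable.mono h1 aestronglyMeasurable_const ?_
    filter_upwards [ae_restrict_mem measurableSet_Ioi] with x hx
    rw [norm_one]
    exact h x ((le_max_right a b).trans (le_of_lt hx))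
  rw [integrableOn_const_iff] at h2
  simp at h2

theorem not_integrableOn_Iio_of_one_le {F : ℝ → ℂ} {a b : ℝ} (h : ∀ x, x ≤ b → 1 ≤ ‖F x‖)
    (hF : IntegrableOn F (Iio a)) : False := by
  have h1 : IntegrableOn F (Iio (min a b)) := hF.mono_set (Iio_subset_Iio (min_le_left _ _))
  have h2 : IntegrableOn (fun _ : ℝ => (1 : ℝ)) (Iio (min a b)) := by
    refine Integrable.mono h1 aestronglyMeasurable_const ?_
    filter_upwards [ae_restrict_mem measurableSet_Iio] with x hx
    rw [norm_one]
    exact h x ((le_of_lt hx).trans (min_le_right a b))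
  rw [integrableOn_const_iff] at h2
  simp at h2

/-! ### Injectivity at `γ = 0`. -/

section Uniqueness

variable {q : ℝ → ℝ}

theorem IsCriticalFront.exists_pos_le (hq : IsCriticalFront q) (b : ℝ) :
    ∃ m, 0 < m ∧ ∀ x ≤ b, m ≤ q x := by
  obtain ⟨a, ha⟩ := hq.exists_half_lt
  obtain ⟨C, hC, h⟩ := exists_forall_Iic_le_mul (f := fun _ => 1) (g := q) continuous_const
    hq.continuous hq.pos (a := a) (C := 2) (fun x hx => by
      rw [abs_one]; linarith [ha x hx]) b
  refine ⟨C⁻¹, inv_pos.2 hC, fun x hx => ?_⟩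
  have := h x hx
  rw [abs_one] at this
  rw [inv_le_iff_one_le_mul₀ hC]; linarith

/-- Uniqueness for bounded solutions of the limiting problem. -/
theorem eq_zero_of_solution (hq : IsCriticalFront q) (w : ExpWeight 0 1) {ψ ψ1 ψ2 : ℝ → ℂ}
    (h1 : IsPrim ψ ψ1) (h2 : IsPrim ψ1 ψ2)
    (hL : ∀ᵐ x, ψ2 x + (coefB w x : ℂ) * ψ1 x + ((coefC w x - q x ^ 2 : ℝ) : ℂ) * ψ x = 0)
    {βm βp : ℂ} (hm : IntegrableOn (fun x => ψ x - βm) (Iio (-3)))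
    (hp : IntegrableOn (fun x => ψ x - βp) (Ioi 3)) : ∀ x, ψ x = 0 := by
  have p0 := isPrim_ofReal (hasDerivAt_conj0 w) (continuous_conj1 w)
  have p1 := isPrim_ofReal (hasDerivAt_conj1 w) (continuous_conj2 w)
  set U : ℝ → ℂ := fun x => (conj0 w x : ℂ) * ψ x with hU
  set U1 : ℝ → ℂ := fun x => (conj1 w x : ℂ) * ψ x + (conj0 w x : ℂ) * ψ1 x with hU1
  have k1 : IsPrim U U1 := h1.mul p0
  have k2 : IsPrim U1 (fun x => (q x ^ 2 : ℂ) * U x) := by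
    refine ((h1.mul p1).add (h2.mul p0)).congr ?_
    filter_upwards [hL] with x hx
    have e1 : (conj0 w x : ℂ) * coefB w x = 2 * conj1 w x := by exact_mod_cast conj0_mul_coefB w x
    have e2 : (conj0 w x : ℂ) * coefC w x = conj2 w x := by exact_mod_cast conj0_mul_coefC w x
    simp only [Pi.add_apply, hU]
    push_cast at hx
    linear_combination (conj0 w x : ℂ) * hx - ψ1 x * e1 - ψ x * e2
  have cq : Continuous fun x => (q x : ℂ) := Complex.continuous_ofReal.comp hq.continuous
  have dU := k1.hasDerivAt k2.continuous
  have dU1 := k2.hasDerivAt ((cq.pow 2).mul k1.continuous)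
  set u : ℝ → ℝ := fun y => Real.exp y * q y with hu
  set u1 : ℝ → ℝ := fun y => Real.exp y * (q y + deriv q y) with hu1
  have upos : ∀ x, 0 < u x := fun x => (hq.u_pos_and x).1
  have du : ∀ x, HasDerivAt (fun y => (u y : ℂ)) (u1 x : ℂ) x := fun x =>
    (hq.hasDerivAt_u x).ofReal_comp
  have du1 : ∀ x, HasDerivAt (fun y => (u1 y : ℂ)) ((q x ^ 2 * u x : ℝ) : ℂ) x := fun x =>
    (hq.hasDerivAt_u' x).ofReal_comp
  have une : ∀ x, (u x : ℂ) ≠ 0 := fun x => Complex.ofReal_ne_zero.2 (upos x).ne'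
  -- The Wronskian of `u` and `U` is constant because both solve `y'' = q² y`.
  obtain ⟨c, hc⟩ : ∃ c : ℂ, ∀ x, (u x : ℂ) * U1 x - (u1 x : ℂ) * U x = c := by
    have hd : ∀ x, HasDerivAt (fun y => (u y : ℂ) * U1 y - (u1 y : ℂ) * U y) 0 x := fun x =>
      (((du x).mul (dU1 x)).sub ((du1 x).mul (dU x))).congr_deriv (by push_cast; ring)
    exact ⟨_, fun x => is_const_of_deriv_eq_zero (fun y => (hd y).differentiableAt)
      (fun y => (hd y).deriv) x 0⟩
  have cu : Continuous u := hq.continuous_u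
  let S : ℝ → ℝ := fun x => ∫ t in (0 : ℝ)..x, (u t ^ 2)⁻¹
  have cS : Continuous fun t => (u t ^ 2)⁻¹ := (cu.pow 2).inv₀ fun t => (pow_pos (upos t) 2).ne'
  have dS : ∀ x, HasDerivAt S ((u x ^ 2)⁻¹) x := fun x =>
    intervalIntegral.integral_hasDerivAt_right (cS.intervalIntegrable _ _)
      (cS.stronglyMeasurableAtFilter _ _) cS.continuousAt
  -- Reduction of order: `(U / u)' = c / u²`.
  obtain ⟨A, hA⟩ : ∃ A : ℂ, ∀ x, U x / u x = A + c * S x := by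
    have hd : ∀ x, HasDerivAt (fun y => U y / (u y : ℂ) - c * (S y : ℂ)) 0 x := fun x => by
      refine (((dU x).div (du x) (une x)).sub ((dS x).ofReal_comp.const_mul c)).congr_deriv ?_
      push_cast
      have := une x
      rw [← hc x]
      field_simp
      ring
    refine ⟨_, fun x => eq_add_of_sub_eq ((is_const_of_deriv_eq_zero
      (fun y => (hd y).differentiableAt) (fun y => (hd y).deriv) x 0))⟩
  have hUx : ∀ x, U x = u x * (A + c * S x) := fun x => by
    rw [← hA x]; field_simp [une x]
  obtain ⟨m, hm0, hqm⟩ := hq.exists_pos_le 0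
  have hc0 : c = 0 := by
    by_contra hne
    have hcn : 0 < ‖c‖ := norm_pos_iff.2 hne
    set k := (u 0 ^ 2)⁻¹ with hk
    have hk0 : 0 < k := inv_pos.2 (pow_pos (upos 0) 2)
    -- As `u` is increasing, `u⁻² ≥ u(0)⁻²` to the left of `0`. This linear divergence suffices,
    -- since `q` is bounded below there.
    have hS : ∀ x ≤ 0, S x ≤ k * x := by
      intro x hx
      have hd := fun y => (dS y).sub ((hasDerivAt_id y).const_mul k)
      have hmono : MonotoneOn (fun y => S y - k * y) (Iic 0) := by
        refine monotoneOn_of_deriv_nonneg (convex_Iic 0)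
          (fun y _ => (hd y).continuousAt.continuousWithinAt)
          (fun y _ => (hd y).differentiableAt.differentiableWithinAt) fun y hy => ?_
        rw [interior_Iic] at hy
        refine le_of_le_of_eq ?_ (hd y).deriv.symm
        have h3 : u y ≤ u 0 := hq.u_monotone (le_of_lt hy)
        have h4 : u y ^ 2 ≤ u 0 ^ 2 := pow_le_pow_left₀ (upos y).le h3 2
        have h5 : k ≤ (u y ^ 2)⁻¹ := inv_anti₀ (pow_pos (upos y) 2) h4
        linarith
      have := hmono hx (mem_Iic.2 le_rfl) hx
      simp [S] at this
      simpa [S] using this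
    -- To the left of this threshold `‖A + c S‖ ≥ (‖βm‖ + 1) / m`, hence `‖ψ‖ ≥ ‖βm‖ + 1` and `ψ -
    -- βm` cannot be integrable.
    refine not_integrableOn_Iio_of_one_le (F := fun x => ψ x - βm)
      (b := min (-1) (-((‖A‖ + (‖βm‖ + 1) / m) / (‖c‖ * k)))) (fun x hx => ?_) hm
    have hx1 : x ≤ -1 := hx.trans (min_le_left _ _)
    have hx2 := hx.trans (min_le_right _ _)
    have hψ : ψ x = q x * (A + c * S x) := by
      have h3 := hUx x
      simp only [hU, hu, conj0_left w hx1] at h3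
      have : (Real.exp x : ℂ) ≠ 0 := Complex.ofReal_ne_zero.2 (Real.exp_pos x).ne'
      apply mul_left_cancel₀ this
      rw [h3]; push_cast; ring
    have hx3 : (‖A‖ + (‖βm‖ + 1) / m) ≤ (‖c‖ * k) * (-x) := by
      rw [le_neg] at hx2
      rw [div_le_iff₀ (mul_pos hcn hk0)] at hx2
      linarith
    have h4 : (‖βm‖ + 1) / m ≤ ‖A + c * S x‖ := by
      have h5 : ‖c * (S x : ℂ)‖ - ‖A‖ ≤ ‖A + c * S x‖ := by
        have := norm_sub_norm_le (c * (S x : ℂ)) (-A)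
        rw [norm_neg, sub_neg_eq_add, add_comm (c * _)] at this
        exact this
      have h6 : ‖c‖ * (k * (-x)) ≤ ‖c * (S x : ℂ)‖ := by
        rw [norm_mul, Complex.norm_real, Real.norm_eq_abs]
        have h7 := hS x (by linarith)
        have h8 := neg_le_abs (S x)
        exact mul_le_mul_of_nonneg_left (by linarith) hcn.le
      linarith
    have h5 : ‖βm‖ + 1 ≤ ‖ψ x‖ := by
      rw [hψ, norm_mul, Complex.norm_real, Real.norm_of_nonneg (hq.pos x).le]
      rw [div_le_iff₀ hm0] at h4
      have := hqm x (by linarith)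
      nlinarith [norm_nonneg (A + c * S x)]
    have := norm_sub_norm_le (ψ x) βm
    linarith
  have hA0 : A = 0 := by
    by_contra hne
    have hAn : 0 < ‖A‖ := norm_pos_iff.2 hne
    obtain ⟨d, hd, hdx⟩ := hq.exists_u_ge
    refine not_integrableOn_Ioi_of_one_le (F := fun x => ψ x - βp)
      (b := max 1 ((‖βp‖ + 1) / (‖A‖ * d))) (fun x hx => ?_) hp
    have hx1 : 1 ≤ x := (le_max_left _ _).trans hx
    have hx2 := (le_max_right _ _).trans hx
    rw [div_le_iff₀ (mul_pos hAn hd)] at hx2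
    have hψ : ψ x = u x * A := by
      have h3 := hUx x
      rw [hc0] at h3
      simp only [hU, conj0_right w hx1] at h3
      simpa using h3
    have h5 : ‖βp‖ + 1 ≤ ‖ψ x‖ := by
      rw [hψ, norm_mul, Complex.norm_real, Real.norm_of_nonneg (upos x).le]
      have : d * x ≤ u x := le_trans (by nlinarith) (hdx x (by linarith))
      nlinarith
    have := norm_sub_norm_le (ψ x) βp
    linarith
  intro x
  have h3 := hUx x
  rw [hc0, hA0] at h3
  simp only [hU] at h3
  have : (conj0 w x : ℂ) ≠ 0 := Complex.ofReal_ne_zero.2 (conj0_pos w x).ne'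
  simpa [this] using h3

/-! ### Limits of primitives of integrable functions -/

theorem IsPrim.tendsto_atTop {F g : ℝ → ℂ} (h : IsPrim F g) {a : ℝ} (ha : 0 ≤ a)
    (hi : Integrable (indicator (Ici a) g)) :
    ∃ l, Tendsto F atTop (𝓝 l) ∧ ∀ x, a ≤ x → ‖F x - l‖ ≤ tailInt (indicator (Ici a) g) x := by
  have hon : IntegrableOn g (Ici a) := (integrable_indicator_iff measurableSet_Ici).1 hi
  have key : ∀ x, a ≤ x → Tendsto F atTop (𝓝 (F x + ∫ t in Ioi x, g t)) := by
    intro x hx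
    have := intervalIntegral_tendsto_integral_Ioi x
      (hon.mono_set (Ioi_subset_Ici hx)) (tendsto_id (α := ℝ))
    refine (this.const_add (F x)).congr fun y => ?_
    rw [id, ← h.sub_eq x y]; ring
  refine ⟨F a + ∫ t in Ioi a, g t, key a le_rfl, fun x hx => ?_⟩
  rw [tendsto_nhds_unique (key a le_rfl) (key x hx), sub_add_cancel_left, norm_neg, tailInt,
    if_pos (ha.trans hx)]
  refine (norm_integral_le_integral_norm _).trans (le_of_eq ?_)
  refine setIntegral_congr_fun measurableSet_Ioi fun t ht => ?_
  have : t ∈ Ici a := hx.trans (le_of_lt ht)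
  simp only [indicator_of_mem this]

theorem IsPrim.tendsto_atBot {F g : ℝ → ℂ} (h : IsPrim F g) {a : ℝ} (ha : a < 0)
    (hi : Integrable (indicator (Iic a) g)) :
    ∃ l, Tendsto F atBot (𝓝 l) ∧ ∀ x, x ≤ a → ‖F x - l‖ ≤ tailInt (indicator (Iic a) g) x := by
  have hon : IntegrableOn g (Iic a) := (integrable_indicator_iff measurableSet_Iic).1 hi
  have key : ∀ x, x ≤ a → Tendsto F atBot (𝓝 (F x - ∫ t in Iic x, g t)) := by
    intro x hx
    have := intervalIntegral_tendsto_integral_Iic x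
      (hon.mono_set (Iic_subset_Iic.2 hx)) (tendsto_id (α := ℝ))
    refine (this.const_sub (F x)).congr fun y => ?_
    rw [id, ← h.sub_eq y x]; ring
  refine ⟨F a - ∫ t in Iic a, g t, key a le_rfl, fun x hx => ?_⟩
  rw [tendsto_nhds_unique (key a le_rfl) (key x hx), sub_sub_cancel, tailInt,
    if_neg (by linarith)]
  refine (norm_integral_le_integral_norm _).trans (le_of_eq ?_)
  refine setIntegral_congr_fun measurableSet_Iic fun t ht => ?_
  have : t ∈ Iic a := le_trans ht hx
  simp only [indicator_of_mem this]

theorem tailInt_le_integral {f : ℝ → ℂ} (hf : Integrable f) (x : ℝ) :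
    tailInt f x ≤ ∫ t, ‖f t‖ := by
  unfold tailInt
  split_ifs <;>
  exact setIntegral_le_integral hf.norm (Eventually.of_forall fun _ => norm_nonneg _)

end Uniqueness

/-! ### Solving the limiting problem -/

/-- Undoes the conjugation: dividing by the positive factor `e^x ω⁻¹` turns a solution for `U` into
one for `ψ`. -/
theorem exists_conj_inv {q : ℝ → ℝ} {ηm ηp : ℝ} (w : ExpWeight ηm ηp) {U U1 f : ℝ → ℂ}
    (h1 : IsPrim U U1)
    (h2 : IsPrim U1 (fun x => (q x ^ 2 : ℂ) * U x + (conj0 w x : ℂ) * f x)) :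
    ∃ ψ ψ1 : ℝ → ℂ, IsPrim ψ ψ1 ∧ IsPrim ψ1 (fun x => f x - (coefB w x : ℂ) * ψ1 x
        - ((coefC w x - q x ^ 2 : ℝ) : ℂ) * ψ x) ∧
      ∀ x, (conj0 w x : ℂ) * ψ x = U x ∧ (conj1 w x : ℂ) * ψ x + (conj0 w x : ℂ) * ψ1 x = U1 x := by
  have hne : ∀ x, (conj0 w x : ℂ) ≠ 0 := fun x => Complex.ofReal_ne_zero.2 (conj0_pos w x).ne'
  have hner : ∀ x, conj0 w x ≠ 0 := fun x => (conj0_pos w x).ne'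
  have p1 := isPrim_ofReal (hasDerivAt_conj1 w) (continuous_conj2 w)
  have pinv : IsPrim (fun x => ((conj0 w x)⁻¹ : ℂ)) (fun x => ((-conj1 w x / conj0 w x ^ 2 : ℝ) : ℂ)) := by
    have := isPrim_ofReal (a := fun x => (conj0 w x)⁻¹) (a' := fun x => -conj1 w x / conj0 w x ^ 2)
      (fun x => (hasDerivAt_conj0 w x).inv (hner x))
      ((continuous_conj1 w).neg.div ((continuous_conj0 w).pow 2) fun x => pow_ne_zero 2 (hner x))
    simpa using this
  set ψ : ℝ → ℂ := fun x => ((conj0 w x)⁻¹ : ℂ) * U x with hψ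
  set V : ℝ → ℂ := fun x => U1 x + (-1 : ℂ) * ((conj1 w x : ℂ) * ψ x) with hV
  set ψ1 : ℝ → ℂ := fun x => ((conj0 w x)⁻¹ : ℂ) * V x with hψ1
  have k1 : IsPrim ψ ψ1 := by
    refine (h1.mul pinv).congr (Eventually.of_forall fun x => ?_)
    have := hne x
    simp only [hψ1, hV, hψ]; push_cast; field_simp; ring
  have k2 : IsPrim V _ := h2.add ((k1.mul p1).const_smul (-1))
  refine ⟨ψ, ψ1, k1, (k2.mul pinv).congr (Eventually.of_forall fun x => ?_), fun x => ⟨?_, ?_⟩⟩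
  · have e1 : (conj0 w x : ℂ) * coefB w x = 2 * conj1 w x := by exact_mod_cast conj0_mul_coefB w x
    have e2 : (conj0 w x : ℂ) * coefC w x = conj2 w x := by exact_mod_cast conj0_mul_coefC w x
    have h0 := hne x
    have eU : U x = (conj0 w x : ℂ) * ψ x := by simp only [hψ]; field_simp
    have eV : V x = (conj0 w x : ℂ) * ψ1 x := by simp only [hψ1]; field_simp
    simp only [Pi.add_apply, Pi.smul_apply, smul_eq_mul]
    rw [eU, eV]
    push_cast
    field_simp
    linear_combination (ψ1 x) * e1 + (ψ x) * e2
  · simp only [hψ]; field_simp [hne x]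
  · have h0 := hne x
    simp only [hψ1, hV]; field_simp; ring

/-- Variation of constants: `U = u (σ - A)` solves `U'' = q² U + g` as soon as `(u² σ')' = u g`.
Integrating `u g` from `-∞` keeps the other homogeneous solution out of the left end; `A` remains
free. -/
theorem IsCriticalFront.exists_reduction {q : ℝ → ℝ} (hq : IsCriticalFront q) {g : ℝ → ℂ}
    (hg : Integrable fun t => ((Real.exp t * q t : ℝ) : ℂ) * g t) :
    ∃ G σ : ℝ → ℂ, Continuous G ∧
      (∀ x, G x = ∫ t in Iic x, ((Real.exp t * q t : ℝ) : ℂ) * g t) ∧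
      (∀ x, HasDerivAt σ (G x / ((Real.exp x * q x : ℝ) : ℂ) ^ 2) x) ∧ σ 0 = 0 ∧
      ∀ A : ℂ, IsPrim (fun x => ((Real.exp x * q x : ℝ) : ℂ) * (σ x - A))
          (fun x => ((Real.exp x * (q x + deriv q x) : ℝ) : ℂ) * (σ x - A)
            + G x / ((Real.exp x * q x : ℝ) : ℂ)) ∧
        IsPrim (fun x => ((Real.exp x * (q x + deriv q x) : ℝ) : ℂ) * (σ x - A)
            + G x / ((Real.exp x * q x : ℝ) : ℂ))
          (fun x => (q x ^ 2 : ℂ) * (((Real.exp x * q x : ℝ) : ℂ) * (σ x - A)) + g x) := by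
  set u : ℝ → ℝ := fun y => Real.exp y * q y with hu
  set u1 : ℝ → ℝ := fun y => Real.exp y * (q y + deriv q y) with hu1
  have upos : ∀ x, 0 < u x := fun x => (hq.u_pos_and x).1
  have une : ∀ x, (u x : ℂ) ≠ 0 := fun x => Complex.ofReal_ne_zero.2 (upos x).ne'
  have cu : Continuous fun x => (u x : ℂ) := Complex.continuous_ofReal.comp hq.continuous_u
  have cu1r : Continuous u1 := continuous_iff_continuousAt.2 fun x => (hq.hasDerivAt_u' x).continuousAt
  have cu1 : Continuous fun x => (u1 x : ℂ) := Complex.continuous_ofReal.comp cu1r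
  have du : ∀ x, HasDerivAt (fun y => (u y : ℂ)) (u1 x : ℂ) x := fun x =>
    (hq.hasDerivAt_u x).ofReal_comp
  have du1 : ∀ x, HasDerivAt (fun y => (u1 y : ℂ)) ((q x ^ 2 * u x : ℝ) : ℂ) x := fun x =>
    (hq.hasDerivAt_u' x).ofReal_comp
  have cq : Continuous fun x => (q x : ℂ) := Complex.continuous_ofReal.comp hq.continuous
  let G : ℝ → ℂ := fun x => ∫ t in Iic x, (u t : ℂ) * g t
  have pG : IsPrim G (fun t => (u t : ℂ) * g t) := ⟨hg.locallyIntegrable, fun x => by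
    rw [← intervalIntegral.integral_Iic_sub_Iic hg.integrableOn hg.integrableOn]
    simp only [G]; ring⟩
  have cG := pG.continuous
  have cσ : Continuous fun t => G t / (u t : ℂ) ^ 2 :=
    cG.div (cu.pow 2) fun t => pow_ne_zero 2 (une t)
  let σ : ℝ → ℂ := fun x => ∫ t in (0 : ℝ)..x, G t / (u t : ℂ) ^ 2
  have dσ : ∀ x, HasDerivAt σ (G x / (u x : ℂ) ^ 2) x := fun x =>
    intervalIntegral.integral_hasDerivAt_right (cσ.intervalIntegrable _ _)
      (cσ.stronglyMeasurableAtFilter _ _) cσ.continuousAt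
  have csig : Continuous σ := continuous_iff_continuousAt.2 fun x => (dσ x).continuousAt
  refine ⟨G, σ, cG, fun _ => rfl, dσ, by simp [σ], fun A => ⟨?_, ?_⟩⟩
  · refine IsPrim.of_hasDerivAt (fun x => ?_)
      ((cu1.mul (csig.sub continuous_const)).add (cG.div cu une))
    refine ((du x).mul ((dσ x).sub_const A)).congr_deriv ?_
    have := une x
    change _ = (u1 x : ℂ) * (σ x - A) + G x / (u x : ℂ)
    field_simp
  · have a1 : IsPrim (fun x => (u1 x : ℂ) * (σ x - A))
        (fun x => ((q x ^ 2 * u x : ℝ) : ℂ) * (σ x - A) + (u1 x : ℂ) * (G x / (u x : ℂ) ^ 2)) := by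
      refine IsPrim.of_hasDerivAt (fun x => (du1 x).mul ((dσ x).sub_const A)) ?_
      exact ((Complex.continuous_ofReal.comp ((hq.continuous.pow 2).mul hq.continuous_u)).mul
        (csig.sub continuous_const)).add (cu1.mul cσ)
    have pinv : IsPrim (fun x => ((u x)⁻¹ : ℂ)) (fun x => -(u1 x : ℂ) / (u x : ℂ) ^ 2) :=
      IsPrim.of_hasDerivAt (fun x => (du x).inv (une x))
        (cu1.neg.div (cu.pow 2) fun x => pow_ne_zero 2 (une x))
    have a2 := a1.add (pG.mul pinv)
    have e : (fun x => (u1 x : ℂ) * (σ x - A) + G x / (u x : ℂ)) =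
        (fun x => (u1 x : ℂ) * (σ x - A)) + fun x => ((u x)⁻¹ : ℂ) * G x := by
      funext x; simp only [Pi.add_apply]; ring
    rw [e]
    refine a2.congr (Eventually.of_forall fun x => ?_)
    have := une x
    change ((q x ^ 2 * u x : ℝ) : ℂ) * (σ x - A) + (u1 x : ℂ) * (G x / (u x : ℂ) ^ 2)
      + (-(u1 x : ℂ) / (u x : ℂ) ^ 2 * G x + (u x : ℂ)⁻¹ * ((u x : ℂ) * g x))
      = (q x ^ 2 : ℂ) * ((u x : ℂ) * (σ x - A)) + g x
    rw [Complex.ofReal_mul, Complex.ofReal_pow]; field_simp; ring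

theorem one_add_le_exp {a : ℝ} (ha : 0 < a) {x : ℝ} (hx : 0 ≤ x) :
    1 + x ≤ (1 + 1 / a) * Real.exp (a * x) := by
  have h1 := Real.add_one_le_exp (a * x)
  have h2 : 1 ≤ Real.exp (a * x) := Real.one_le_exp (by positivity)
  have h3 : x ≤ (1 / a) * Real.exp (a * x) := by
    rw [div_mul_eq_mul_div, le_div_iff₀ ha, one_mul]; linarith
  linarith

/-- On the right `u` grows only linearly, on the left `u e^x` is bounded; both are absorbed by
`e^{η|x|/2}`. -/
theorem IsCriticalFront.integrable_conj_mul {q : ℝ → ℝ} (hq : IsCriticalFront q)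
    (w : ExpWeight 0 1) {η : ℝ} {ℓ : ℝ≥0∞} {f : ℝ → ℂ} (hη : 0 < η) (hℓ : ℓ = 1 ∨ ℓ = ⊤)
    (hf : EMem η ℓ f) :
    Integrable fun t => ((Real.exp t * q t : ℝ) : ℂ) * ((conj0 w t : ℂ) * f t) := by
  obtain ⟨D, hD, hu⟩ := hq.exists_u_le
  obtain ⟨Q, hQ, hQ'⟩ := hq.exists_le
  have cuc : Continuous fun x => Real.exp x * q x * conj0 w x :=
    hq.continuous_u.mul (continuous_conj0 w)
  obtain ⟨K, hK, hb⟩ := exists_le_exp_of_outside cuc (R := 1)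
    (D := D * (1 + 1 / (η / 2)) + Q) (κ := -(η / 2)) fun x hx => by
      have h0 := (hq.u_pos_and x).1
      rw [neg_neg, abs_of_pos (mul_pos h0 (conj0_pos w x))]
      have hE : 1 ≤ Real.exp (η / 2 * |x|) := Real.one_le_exp (by positivity)
      rcases le_abs.1 hx with h | h
      · rw [conj0_right w h, abs_of_pos (by linarith : 0 < x), mul_one]
        have h1 := hu x (by linarith)
        have h2 := one_add_le_exp (half_pos hη) (by linarith : 0 ≤ x)
        have h3 := mul_le_mul_of_nonneg_left h2 hD.le
        have : 0 < Q * Real.exp (η / 2 * x) := by positivity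
        linarith
      · rw [conj0_left w (by linarith)]
        have h1 := hQ' x
        have h2 : Real.exp x ≤ 1 := Real.exp_le_one_iff.2 (by linarith)
        have h3 : Real.exp x * q x * Real.exp x ≤ Q := by
          have := hq.pos x
          have h5 := Real.exp_pos x
          calc Real.exp x * q x * Real.exp x ≤ 1 * Q * 1 := by gcongr
            _ = Q := by ring
        have : 0 ≤ D * (1 + 1 / (η / 2)) * Real.exp (η / 2 * |x|) := by positivity
        nlinarith
  refine ((hf.integrable_exp_half hη hℓ).norm.const_mul K).mono'
    ((Complex.continuous_ofReal.comp hq.continuous_u).aestronglyMeasurable.mul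
      ((Complex.continuous_ofReal.comp (continuous_conj0 w)).aestronglyMeasurable.mul
        hf.aestronglyMeasurable)) (Eventually.of_forall fun x => ?_)
  have := hb x
  rw [neg_neg] at this
  rw [← mul_assoc, ← Complex.ofReal_mul, norm_mul, norm_mul, Complex.norm_real, Complex.norm_real,
    Real.norm_eq_abs, Real.norm_eq_abs, Real.abs_exp, ← mul_assoc]
  exact mul_le_mul_of_nonneg_right this (norm_nonneg _)

theorem EMem.ofReal_add {η : ℝ} {ℓ : ℝ≥0∞} {a b : ℝ → ℝ} (ha : EMem η ℓ fun x => (a x : ℂ))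
    (hb : EMem η ℓ fun x => (b x : ℂ)) : EMem η ℓ fun x => ((a x + b x : ℝ) : ℂ) :=
  (ha.add hb).congr (Eventually.of_forall fun x => by simp)

theorem IsCriticalFront.exists_solution {q : ℝ → ℝ} (hq : IsCriticalFront q)
    (w : ExpWeight 0 1) {η : ℝ} {ℓ : ℝ≥0∞} {f : ℝ → ℂ} (hη : 0 < η) (hη4 : η < 1 / 4)
    (hℓ : ℓ = 1 ∨ ℓ = ⊤) (hf : EMem η ℓ f) :
    ∃ (ψ ψ1 : ℝ → ℂ) (βm βp : ℂ) (T : ℝ → ℝ) (C : ℝ), IsPrim ψ ψ1 ∧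
      IsPrim ψ1 (fun x => f x - (coefB w x : ℂ) * ψ1 x
        - ((coefC w x - q x ^ 2 : ℝ) : ℂ) * ψ x) ∧
      (∀ x, Real.exp (-(1 / 4) * |x|) ≤ T x) ∧ EMem η ℓ (fun x => (T x : ℂ)) ∧ 0 < C ∧
      (∀ x, x ≤ -2 → ‖ψ x - βm‖ ≤ C * T x ∧ ‖ψ1 x‖ ≤ C * T x) ∧
      (∀ x, 2 ≤ x → ‖ψ x - βp‖ ≤ C * T x ∧ ‖ψ1 x‖ ≤ C * T x) := by
  have hgi := hq.integrable_conj_mul w hη hℓ hf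
  obtain ⟨G, σ, cG, hG, dσ, hσ0, hU⟩ := hq.exists_reduction hgi
  set u : ℝ → ℝ := fun y => Real.exp y * q y with hu
  set u1 : ℝ → ℝ := fun y => Real.exp y * (q y + deriv q y) with hu1
  have upos : ∀ x, 0 < u x := fun x => (hq.u_pos_and x).1
  have une : ∀ x, (u x : ℂ) ≠ 0 := fun x => Complex.ofReal_ne_zero.2 (upos x).ne'
  have cu : Continuous fun x => (u x : ℂ) := Complex.continuous_ofReal.comp hq.continuous_u
  have cq : Continuous fun x => (q x : ℂ) := Complex.continuous_ofReal.comp hq.continuous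
  have cσ' : Continuous fun t => G t / (u t : ℂ) ^ 2 :=
    cG.div (cu.pow 2) fun t => pow_ne_zero 2 (une t)
  have pσ : IsPrim σ (fun t => G t / (u t : ℂ) ^ 2) := IsPrim.of_hasDerivAt dσ cσ'
  have hfi := hf.integrable hη hℓ
  have hTf := hf.tailInt hη hℓ
  obtain ⟨m, hm0, hqm⟩ := hq.exists_pos_le 0
  obtain ⟨Q, hQ0, hQ⟩ := hq.exists_le
  have hnσ : ∀ x, ‖G x / (u x : ℂ) ^ 2‖ = ‖G x‖ / u x ^ 2 := fun x => by
    rw [norm_div, norm_pow, Complex.norm_real, Real.norm_of_nonneg (upos x).le]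
  -- left end
  have hσl : ∀ x ≤ -1, ‖G x / (u x : ℂ) ^ 2‖ ≤ (1 / m) * tailInt f x := by
    intro x hx
    -- On the left the kernel is `u e^t`, and `q ≥ m` gives `m e^t ≤ u`; monotonicity of `u` then
    -- supplies the factor `u(x)²` that cancels in `σ'`.
    have h1 : ‖G x‖ ≤ (u x ^ 2 / m) * tailInt f x := by
      rw [hG x, tailInt, if_neg (by linarith), ← integral_const_mul]
      refine (norm_integral_le_integral_norm _).trans ?_
      refine setIntegral_mono_on hgi.norm.integrableOn (hfi.norm.const_mul _).integrableOn
        measurableSet_Iic fun t ht => ?_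
      have ht' : t ≤ x := ht
      rw [conj0_left w (by linarith), norm_mul, norm_mul, Complex.norm_real, Complex.norm_real,
        Real.norm_of_nonneg (upos t).le, Real.norm_of_nonneg (Real.exp_pos t).le, ← mul_assoc]
      refine mul_le_mul_of_nonneg_right ?_ (norm_nonneg _)
      rw [le_div_iff₀ hm0]
      have h2 : u t ≤ u x := hq.u_monotone ht'
      have h3 := hqm t (by linarith)
      have h4 : Real.exp t * m ≤ u t := mul_le_mul_of_nonneg_left h3 (Real.exp_pos t).le
      have := upos t
      change u t * Real.exp t * m ≤ u x ^ 2
      nlinarith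
    rw [hnσ, div_le_iff₀ (pow_pos (upos x) 2)]
    refine h1.trans (le_of_eq (by ring))
  set s : ℝ → ℂ := indicator (Iic (-1)) fun t => G t / (u t : ℂ) ^ 2 with hs
  have hsE : EMem η ℓ s := hTf.mono (cσ'.aestronglyMeasurable.indicator measurableSet_Iic)
    (C := 1 / m) (Eventually.of_forall fun x => by
      rw [Complex.norm_real, Real.norm_of_nonneg (tailInt_nonneg f x), hs]
      by_cases hx : x ∈ Iic (-1 : ℝ)
      · rw [indicator_of_mem hx]; exact hσl x hx
      · rw [indicator_of_notMem hx, norm_zero]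
        have := tailInt_nonneg f x
        positivity)
  have hsi := hsE.integrable hη hℓ
  obtain ⟨l, -, hl⟩ := pσ.tendsto_atBot (by norm_num : (-1 : ℝ) < 0) hsi
  -- right end
  set KG := ∫ t, ‖((Real.exp t * q t : ℝ) : ℂ) * ((conj0 w t : ℂ) * f t)‖ with hKG
  have hGb : ∀ x, ‖G x‖ ≤ KG := fun x => by
    rw [hG x]
    exact (norm_integral_le_integral_norm _).trans
      (setIntegral_le_integral hgi.norm (Eventually.of_forall fun _ => norm_nonneg _))
  have hKG0 : 0 ≤ KG := (norm_nonneg _).trans (hGb 0)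
  set K1 := KG / u 0 ^ 2 with hK1
  have hK10 : 0 ≤ K1 := div_nonneg hKG0 (sq_nonneg _)
  have hσr : ∀ x, 0 ≤ x → ‖σ x‖ ≤ K1 * x := by
    intro x hx
    have h1 := pσ.sub_eq 0 x
    rw [hσ0, sub_zero] at h1
    rw [h1]
    refine (intervalIntegral.norm_integral_le_of_norm_le_const (C := K1) fun t ht => ?_).trans
      (by rw [sub_zero, abs_of_nonneg hx])
    rw [uIoc_of_le hx] at ht
    have h2 : u 0 ≤ u t := hq.u_monotone ht.1.le
    rw [hnσ, hK1]
    exact div_le_div₀ hKG0 (hGb t) (pow_pos (upos 0) 2) (pow_le_pow_left₀ (upos 0).le h2 2)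
  obtain ⟨D, hD, huD⟩ := hq.exists_u_le
  obtain ⟨Cq, hCq, -, hCq2⟩ := hq.exists_sq_le
  let U : ℂ → ℝ → ℂ := fun A x => (u x : ℂ) * (σ x - A)
  let U1 : ℂ → ℝ → ℂ := fun A x => (u1 x : ℂ) * (σ x - A) + G x / (u x : ℂ)
  let h : ℂ → ℝ → ℂ := fun A x => (q x ^ 2 : ℂ) * U A x + (conj0 w x : ℂ) * f x
  have pU : ∀ A, IsPrim (U A) (U1 A) := fun A => (hU A).1
  have pU1 : ∀ A, IsPrim (U1 A) (h A) := fun A => (hU A).2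
  -- Here `‖U‖` is at most a multiple of `(1 + x)²`, so `q² U` decays like `e^{-x}` and `U''`
  -- inherits the localization of `f`.
  have hhE : ∀ A, EMem η ℓ (indicator (Ici 1) (h A)) := by
    intro A
    have e1 : EMem η ℓ fun x => ((D * (K1 + ‖A‖) * Cq * Real.exp (-1 * |x|) : ℝ) : ℂ) :=
      EMem.of_exp (κ := 1) (C := D * (K1 + ‖A‖) * Cq) (by linarith) hℓ (by fun_prop)
        (Eventually.of_forall fun x => by
          rw [Complex.norm_real, Real.norm_of_nonneg (by positivity)])
    refine (e1.add hf.norm).mono ?_ (C := 1) (Eventually.of_forall fun x => ?_)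
    · refine AEStronglyMeasurable.indicator ?_ measurableSet_Ici
      exact (((cq.pow 2).mul (pU A).continuous).aestronglyMeasurable).add
        ((Complex.continuous_ofReal.comp (continuous_conj0 w)).aestronglyMeasurable.mul
          hf.aestronglyMeasurable)
    rw [← Complex.ofReal_add, Complex.norm_real, Real.norm_of_nonneg (by positivity), one_mul]
    by_cases hx : x ∈ Ici (1 : ℝ)
    · rw [indicator_of_mem hx]
      have hx1 : (1 : ℝ) ≤ x := hx
      simp only [h, U]
      rw [conj0_right w hx1, Complex.ofReal_one, one_mul]
      refine (norm_add_le _ _).trans (add_le_add ?_ le_rfl)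
      rw [norm_mul, norm_mul, norm_pow, Complex.norm_real, Complex.norm_real,
        Real.norm_of_nonneg (hq.pos x).le, Real.norm_of_nonneg (upos x).le,
        abs_of_pos (by linarith : 0 < x)]
      have b1 := huD x (by linarith)
      have b2 : ‖σ x - A‖ ≤ (K1 + ‖A‖) * (1 + x) := by
        refine (norm_sub_le _ _).trans ?_
        have := hσr x (by linarith)
        nlinarith [norm_nonneg A]
      have b3 := hCq2 x (by linarith)
      calc q x ^ 2 * (u x * ‖σ x - A‖)
          ≤ q x ^ 2 * ((D * (1 + x)) * ((K1 + ‖A‖) * (1 + x))) := by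
            refine mul_le_mul_of_nonneg_left (mul_le_mul b1 b2 (norm_nonneg _) ?_) (sq_nonneg _)
            exact (upos x).le.trans b1
        _ = D * (K1 + ‖A‖) * (q x ^ 2 * (1 + x) ^ 2) := by ring
        _ ≤ D * (K1 + ‖A‖) * (Cq * Real.exp (-x)) :=
            mul_le_mul_of_nonneg_left b3 (by positivity)
        _ = _ := by rw [neg_one_mul]; ring
    · rw [indicator_of_notMem hx, norm_zero]; positivity
  obtain ⟨ap, hap, -⟩ := (pU1 0).tendsto_atTop zero_le_one ((hhE 0).integrable hη hℓ)
  obtain ⟨M, hM, hMb⟩ := hq.exists_u'_le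
  have ha0 : Tendsto u1 Filter.atTop (𝓝 (⨆ x, u1 x)) :=
    tendsto_atTop_ciSup hq.u'_monotone ⟨M, by rintro _ ⟨x, rfl⟩; exact hMb x⟩
  set a0 := ⨆ x, u1 x with ha0d
  have ha0p : 0 < a0 := lt_of_lt_of_le (hq.u_pos_and 0).2
    (le_ciSup (f := u1) ⟨M, by rintro _ ⟨x, rfl⟩; exact hMb x⟩ 0)
  -- The limit of `U'` at `+∞` is `ap - A a0`, where `a0 > 0` is the limit of `u'`. This choice of
  -- `A` makes it vanish, which turns linear growth of `U` into convergence.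
  set A : ℂ := ap / (a0 : ℂ) with hA
  obtain ⟨l1, hl1, hl1b⟩ := (pU1 A).tendsto_atTop zero_le_one ((hhE A).integrable hη hℓ)
  have hl10 : l1 = 0 := by
    have e : ∀ x, U1 A x = U1 0 x - A * (u1 x : ℂ) := fun x => by simp only [U1]; ring
    have t1 : Tendsto (fun x => U1 0 x - A * (u1 x : ℂ)) Filter.atTop (𝓝 (ap - A * (a0 : ℂ))) :=
      hap.sub (((Complex.continuous_ofReal.tendsto _).comp ha0).const_mul A)
    have := tendsto_nhds_unique hl1 (t1.congr fun x => (e x).symm)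
    rw [this, hA, div_mul_cancel₀ _ (Complex.ofReal_ne_zero.2 ha0p.ne'), sub_self]
  have hTh := (hhE A).tailInt hη hℓ
  have hU1b : ∀ x, 1 ≤ x → ‖U1 A x‖ ≤ tailInt (indicator (Ici 1) (h A)) x := fun x hx => by
    have := hl1b x hx
    rwa [hl10, sub_zero] at this
  have hkE : EMem η ℓ (indicator (Ici 1) (U1 A)) :=
    hTh.mono ((pU1 A).continuous.aestronglyMeasurable.indicator measurableSet_Ici)
      (C := 1) (Eventually.of_forall fun x => by
        rw [Complex.norm_real, Real.norm_of_nonneg (tailInt_nonneg _ x), one_mul]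
        by_cases hx : x ∈ Ici (1 : ℝ)
        · rw [indicator_of_mem hx]; exact hU1b x hx
        · rw [indicator_of_notMem hx, norm_zero]; exact tailInt_nonneg _ x)
  obtain ⟨βp, -, hβp⟩ := (pU A).tendsto_atTop zero_le_one (hkE.integrable hη hℓ)
  have hTk := hkE.tailInt hη hℓ
  have hTs := hsE.tailInt hη hℓ
  have hE4 : EMem η ℓ fun x => ((Real.exp (-(1 / 4) * |x|) : ℝ) : ℂ) :=
    EMem.of_exp (κ := 1 / 4) (C := 1) hη4 hℓ (by fun_prop)
      (Eventually.of_forall fun x => by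
        rw [Complex.norm_real, Real.norm_of_nonneg (by positivity), one_mul])
  obtain ⟨ψ, ψ1, pψ, pψ1, hψ⟩ := exists_conj_inv w (pU A) (pU1 A)
  obtain ⟨C1, hC1, hq1⟩ := hq.exists_left_bound
  obtain ⟨C2, hC2, hq2⟩ := hq.exists_left_deriv_bound
  set Kσ := ‖l - A‖ + ∫ t, ‖s t‖ with hKσ
  have hKσ0 : 0 ≤ Kσ := add_nonneg (norm_nonneg _) (integral_nonneg fun _ => norm_nonneg _)
  have n1 := fun x => tailInt_nonneg (indicator (Ici 1) (h A)) x
  have n2 := fun x => tailInt_nonneg (indicator (Ici 1) (U1 A)) x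
  have n3 := fun x => tailInt_nonneg s x
  have n4 := fun x => tailInt_nonneg f x
  have n5 := fun x : ℝ => (Real.exp_pos (-(1 / 4) * |x|)).le
  -- One majorant serves both ends: tails of `U''` and `U'` on the right, of `σ'` and `f` on the
  -- left, and `e^{-|x|/4}` for the front's own convergence. On the left `ψ = q (σ - A)` tends to `l
  -- - A`.
  refine ⟨ψ, ψ1, l - A, βp, fun x => tailInt (indicator (Ici 1) (h A)) x
    + tailInt (indicator (Ici 1) (U1 A)) x + tailInt s x + tailInt f x
    + Real.exp (-(1 / 4) * |x|), 1 + Q + C1 * ‖l - A‖ + C2 * Kσ + Q / m, pψ, pψ1,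
    fun x => by linarith [n1 x, n2 x, n3 x, n4 x],
    (((hTh.ofReal_add hTk).ofReal_add hTs).ofReal_add hTf).ofReal_add hE4, by positivity,
    fun x hx => ?_, fun x hx => ?_⟩
  · obtain ⟨e1, e2⟩ := hψ x
    have hc0 := conj0_left w (x := x) (by linarith)
    have hc1 : conj1 w x = Real.exp x := by
      have := conj0_mul_coefB w x
      rw [(coef_left w (by linarith)).1, hc0] at this
      linarith
    have hex : (Real.exp x : ℂ) ≠ 0 := Complex.ofReal_ne_zero.2 (Real.exp_pos x).ne'
    have hux : (u x : ℂ) = (Real.exp x : ℂ) * (q x : ℂ) := by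
      rw [← Complex.ofReal_mul]
    have hu1x : (u1 x : ℂ) = (Real.exp x : ℂ) * ((q x : ℂ) + ((deriv q x : ℝ) : ℂ)) := by
      rw [← Complex.ofReal_add, ← Complex.ofReal_mul]
    rw [hc0] at e1 e2
    rw [hc1] at e2
    have hψx : ψ x = (q x : ℂ) * (σ x - A) := by
      apply mul_left_cancel₀ hex
      rw [e1]; simp only [U]; rw [hux]; ring
    have hψ1x : ψ1 x = ((deriv q x : ℝ) : ℂ) * (σ x - A) + (q x : ℂ) * (G x / (u x : ℂ) ^ 2) := by
      apply mul_left_cancel₀ hex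
      have e3 : (Real.exp x : ℂ) * ((q x : ℂ) * (G x / (u x : ℂ) ^ 2)) = G x / (u x : ℂ) := by
        have := une x
        rw [← mul_assoc, ← hux]; field_simp
      have e4 : (Real.exp x : ℂ) * ψ1 x = U1 A x - (Real.exp x : ℂ) * ψ x := by
        rw [← e2]; ring
      rw [e4, mul_add, e3, hψx]
      simp only [U1]
      rw [hu1x]; ring
    have hls := hl x (by linarith)
    have hE : Real.exp (-(1 / 4) * |x|) = Real.exp (x / 4) := by
      rw [abs_of_neg (by linarith)]; ring_nf
    have hqx := hQ x
    have hq0 := hq.pos x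
    have hq1x := hq1 x (by linarith)
    have hq2x := hq2 x (by linarith)
    have hσA : ‖σ x - A‖ ≤ Kσ := by
      have e : σ x - A = (σ x - l) + (l - A) := by ring
      rw [e]
      refine (norm_add_le _ _).trans ?_
      have := tailInt_le_integral hsi x
      rw [hKσ]; linarith
    have hcomb : ∀ a b, 0 ≤ a → 0 ≤ b →
        Q * tailInt s x + C1 * ‖l - A‖ * Real.exp (x / 4) + C2 * Kσ * Real.exp (x / 4)
          + Q / m * tailInt f x ≤ (1 + Q + C1 * ‖l - A‖ + C2 * Kσ + Q / m) *
            (a + b + tailInt s x + tailInt f x + Real.exp (x / 4)) := by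
      intro a b ha hb
      have z1 : 0 ≤ C1 * ‖l - A‖ := by positivity
      have z2 : 0 ≤ C2 * Kσ := by positivity
      have z3 : 0 ≤ Q / m := by positivity
      have m1 := n3 x
      have m2 := n4 x
      have m3 := (Real.exp_pos (x / 4)).le
      generalize C1 * ‖l - A‖ = y1 at *
      generalize C2 * Kσ = y2 at *
      generalize Q / m = y3 at *
      generalize tailInt s x = t1 at *
      generalize tailInt f x = t2 at *
      generalize Real.exp (x / 4) = t3 at *
      have : 0 ≤ (1 + Q + y1 + y2 + y3) * (a + b) := by positivity
      have : 0 ≤ (1 + y1 + y2 + y3) * t1 := by positivity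
      have : 0 ≤ (1 + Q + y1 + y2) * t2 := by positivity
      have : 0 ≤ (1 + Q + y3) * t3 := by positivity
      linarith
    have hcomb' := hcomb _ _ (n1 x) (n2 x)
    have w1 : 0 ≤ Q * tailInt s x := mul_nonneg hQ0.le (n3 x)
    have w2 : 0 ≤ C1 * ‖l - A‖ * Real.exp (x / 4) := by positivity
    have w3 : 0 ≤ C2 * Kσ * Real.exp (x / 4) := by positivity
    have w4 : 0 ≤ Q / m * tailInt f x := mul_nonneg (by positivity) (n4 x)
    simp only [hE]
    refine ⟨le_trans ?_ hcomb', le_trans ?_ hcomb'⟩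
    · have e : ψ x - (l - A) = (q x : ℂ) * (σ x - l) + ((q x - 1 : ℝ) : ℂ) * (l - A) := by
        rw [hψx]; push_cast; ring
      rw [e]
      refine (norm_add_le _ _).trans ?_
      rw [norm_mul, norm_mul, Complex.norm_real, Complex.norm_real, Real.norm_of_nonneg hq0.le,
        Real.norm_eq_abs, abs_sub_comm]
      have v1 : q x * ‖σ x - l‖ ≤ Q * tailInt s x := mul_le_mul hqx hls (norm_nonneg _) hQ0.le
      have v2 := mul_le_mul_of_nonneg_right hq1x (norm_nonneg (l - A))
      linarith
    · rw [hψ1x]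
      refine (norm_add_le _ _).trans ?_
      rw [norm_mul, norm_mul, Complex.norm_real, Complex.norm_real, Real.norm_of_nonneg hq0.le,
        Real.norm_eq_abs]
      have v1 : |deriv q x| * ‖σ x - A‖ ≤ (C2 * Real.exp (x / 4)) * Kσ :=
        mul_le_mul hq2x hσA (norm_nonneg _) (by positivity)
      have v2 : q x * ‖G x / (u x : ℂ) ^ 2‖ ≤ Q * ((1 / m) * tailInt f x) :=
        mul_le_mul hqx (hσl x (by linarith)) (norm_nonneg _) hQ0.le
      have v3 : Q * ((1 / m) * tailInt f x) = Q / m * tailInt f x := by ring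
      linarith
  · obtain ⟨e1, e2⟩ := hψ x
    have hc0 := conj0_right w (x := x) (by linarith)
    have hc1 : conj1 w x = 0 := by
      have := conj0_mul_coefB w x
      rw [(coef_right w (by linarith)).1, hc0] at this
      linarith
    rw [hc0, Complex.ofReal_one, one_mul] at e1 e2
    rw [hc1, Complex.ofReal_zero, zero_mul, zero_add] at e2
    rw [e1, e2]
    have b1 := hβp x (by linarith)
    have b2 := hU1b x (by linarith)
    have hC : 1 ≤ 1 + Q + C1 * ‖l - A‖ + C2 * Kσ + Q / m := by
      have : 0 ≤ Q + C1 * ‖l - A‖ + C2 * Kσ + Q / m := by positivity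
      linarith
    have hT : ∀ y z, 0 ≤ z → y ≤ z → y ≤ (1 + Q + C1 * ‖l - A‖ + C2 * Kσ + Q / m) * z :=
      fun y z hz hyz => by nlinarith
    constructor
    · exact hT _ _ (by linarith [n1 x, n2 x, n3 x, n4 x, n5 x])
        (by linarith [n1 x, n2 x, n3 x, n4 x, n5 x])
    · exact hT _ _ (by linarith [n1 x, n2 x, n3 x, n4 x, n5 x])
        (by linarith [n1 x, n2 x, n3 x, n4 x, n5 x])

/-! ### Surjectivity at `γ = 0`: extracting the localized core. -/

theorem EMem.of_continuous {η : ℝ} {ℓ : ℝ≥0∞} {F H : ℝ → ℂ} (hη : 0 < η)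
    (hℓ : ℓ = 1 ∨ ℓ = ⊤) (hF : Continuous F) (hH : EMem η ℓ H) {R C : ℝ}
    (h : ∀ x, R ≤ |x| → ‖F x‖ ≤ C * ‖H x‖) : EMem η ℓ F := by
  obtain ⟨D, hD⟩ := (isCompact_closedBall (0 : ℝ) R).exists_bound_of_continuousOn hF.continuousOn
  exact EMem.of_outside hη hℓ hF.aestronglyMeasurable hH (D := D)
    (Eventually.of_forall fun x hx => hD x (by simpa using hx)) (Eventually.of_forall h)

/-- The operator `L_ψ` applied to a smooth real function. -/
noncomputable def lpsiSmooth (q w θ : ℝ → ℝ) (x : ℝ) : ℝ :=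
  deriv (deriv θ) x + coefB w x * deriv θ x + (coefC w x - q x ^ 2) * θ x

theorem Lpsi_ofReal_ae (q w : ℝ → ℝ) {θ : ℝ → ℝ} (hθ : ContDiff ℝ ∞ θ) :
    Lpsi q w (fun x => (θ x : ℂ)) =ᵐ[volume] fun x => (lpsiSmooth q w θ x : ℂ) := by
  have s1 := (contDiff_infty_iff_deriv.1 hθ).2
  have p0 := isPrim_ofReal (fun x => (hθ.differentiable (by simp) x).hasDerivAt) s1.continuous
  have p1 := isPrim_ofReal (fun x => (s1.differentiable (by simp) x).hasDerivAt)
    (s1.continuous_deriv (by simp))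
  filter_upwards [Lpsi_ae (q := q) (w := w) p0.isWeakDeriv p1.isWeakDeriv] with x hx
  rw [hx, lpsiSmooth]
  push_cast
  ring

theorem LpsiShift_modeRight_zero_ae (q w : ℝ → ℝ) {χ : ℝ → ℝ} (hχ : IsCutoff χ) :
    LpsiShift q w 0 (modeRight χ 0) =ᵐ[volume] fun x => (lpsiSmooth q w χ x : ℂ) := by
  have e : modeRight χ 0 = fun x => (χ x : ℂ) := by
    funext x; simp [modeRight]
  filter_upwards [Lpsi_ofReal_ae q w hχ.smooth] with x hx
  rw [LpsiShift, e, hx]; simp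

theorem LpsiShift_modeLeft_zero_ae (q w : ℝ → ℝ) {χ : ℝ → ℝ} (hχ : IsCutoff χ) :
    LpsiShift q w 0 (modeLeft χ 0) =ᵐ[volume]
      fun x => (lpsiSmooth q w (fun y => χ (-y)) x : ℂ) := by
  have e : modeLeft χ 0 = fun x => (χ (-x) : ℂ) := by
    funext x; simp [modeLeft, nuPlus_zero]
  filter_upwards [Lpsi_ofReal_ae q w hχ.reflect_smooth] with x hx
  rw [LpsiShift, e, hx]; simp

theorem exists_coef_bound {q : ℝ → ℝ} (hq : Continuous q) {Q : ℝ} (hQ : ∀ x, |q x| ≤ Q)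
    (w : ExpWeight 0 1) :
    ∃ C, ∀ x, ‖(coefB w x : ℂ)‖ ≤ C ∧ ‖((coefC w x - q x ^ 2 : ℝ) : ℂ)‖ ≤ C := by
  have hq2 : ∀ x, |q x ^ 2| ≤ Q ^ 2 := fun x => by
    rw [abs_pow]; exact pow_le_pow_left₀ (abs_nonneg _) (hQ x) 2
  obtain ⟨C1, -, h1⟩ := exists_bound_of_outside (continuous_coefB w) (R := 2) (D := 2)
    fun x hx => by
      rcases le_abs.1 hx with h | h
      · rw [(coef_right w (by linarith)).1]; norm_num
      · rw [(coef_left w (by linarith)).1]; norm_num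
  obtain ⟨C2, -, h2⟩ := exists_bound_of_outside
    ((continuous_coefC w).sub (hq.pow 2)) (R := 2) (D := 1 + Q ^ 2) fun x hx => by
      refine (norm_sub_le _ _).trans (add_le_add ?_ (hq2 x))
      rcases le_abs.1 hx with h | h
      · rw [(coef_right w (by linarith)).2]; norm_num
      · rw [(coef_left w (by linarith)).2]; norm_num
  refine ⟨max C1 C2, fun x => ⟨?_, ?_⟩⟩
  · rw [Complex.norm_real]; exact (h1 x).trans (le_max_left _ _)
  · rw [Complex.norm_real]; exact (h2 x).trans (le_max_right _ _)

/-- The core is `v = ψ - β₋ χ₋ - β₊ χ₊`; outside a compact set this is `ψ` minus its limit, hence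
localized. -/
theorem IsCriticalFront.exists_core_solution {q : ℝ → ℝ} (hq : IsCriticalFront q)
    (w : ExpWeight 0 1) {χ : ℝ → ℝ} (hχ : IsCutoff χ) {η : ℝ} {ℓ : ℝ≥0∞} {f : ℝ → ℂ}
    (hη : 0 < η) (hη4 : η < 1 / 4) (hℓ : ℓ = 1 ∨ ℓ = ⊤) (hf : EMem η ℓ f)
    (hm : EMem η ℓ fun x => (lpsiSmooth q w (fun y => χ (-y)) x : ℂ))
    (hp : EMem η ℓ fun x => (lpsiSmooth q w χ x : ℂ)) :
    ∃ (v v1 v2 : ℝ → ℂ) (βm βp : ℂ), IsPrim v v1 ∧ IsPrim v1 v2 ∧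
      EMem η ℓ v ∧ EMem η ℓ v1 ∧ EMem η ℓ v2 ∧
      ∀ x, v2 x + (coefB w x : ℂ) * v1 x + ((coefC w x - q x ^ 2 : ℝ) : ℂ) * v x
        + βm * (lpsiSmooth q w (fun y => χ (-y)) x : ℂ) + βp * (lpsiSmooth q w χ x : ℂ) = f x := by
  obtain ⟨ψ, ψ1, βm, βp, T, C, h1, h2, hT0, hT, hC, hl, hr⟩ :=
    hq.exists_solution w hη hη4 hℓ hf
  obtain ⟨Q, hQ0, hQ⟩ := hq.exists_le
  obtain ⟨K, hK⟩ := exists_coef_bound hq.continuous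
    (fun x => by rw [abs_of_pos (hq.pos x)]; exact hQ x) w
  set χm : ℝ → ℝ := fun y => χ (-y) with hχm
  have s1 := (contDiff_infty_iff_deriv.1 hχ.smooth).2
  have t1 := (contDiff_infty_iff_deriv.1 hχ.reflect_smooth).2
  have p0 := isPrim_ofReal (fun x => (hχ.smooth.differentiable (by simp) x).hasDerivAt)
    s1.continuous
  have p1 := isPrim_ofReal (fun x => (s1.differentiable (by simp) x).hasDerivAt)
    (s1.continuous_deriv (by simp))
  have r0 := isPrim_ofReal
    (fun x => (hχ.reflect_smooth.differentiable (by simp) x).hasDerivAt) t1.continuous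
  have r1 := isPrim_ofReal (fun x => (t1.differentiable (by simp) x).hasDerivAt)
    (t1.continuous_deriv (by simp))
  have k1 := (h1.add (r0.const_smul (-βm))).add (p0.const_smul (-βp))
  have k2 := (h2.add (r1.const_smul (-βm))).add (p1.const_smul (-βp))
  set v := (ψ + (-βm) • fun x => (χm x : ℂ)) + (-βp) • fun x => (χ x : ℂ) with hv
  set v1 := (ψ1 + (-βm) • fun x => ((deriv χm x : ℝ) : ℂ)) + (-βp) • fun x =>
    ((deriv χ x : ℝ) : ℂ) with hv1
  have hTn : ∀ x, ‖(T x : ℂ)‖ = T x := fun x => by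
    rw [Complex.norm_real, Real.norm_of_nonneg ((Real.exp_pos _).le.trans (hT0 x))]
  have mv : EMem η ℓ v := EMem.of_continuous hη hℓ k1.continuous hT (R := 4) (C := C)
    fun x hx => by
      rw [hTn]
      rcases le_abs.1 hx with h | h
      · have := (hr x (by linarith)).1
        simpa [hv, hχm, hχ.left (-x) (by linarith), hχ.right x (by linarith),
          ← sub_eq_add_neg] using this
      · have := (hl x (by linarith)).1
        simpa [hv, hχm, hχ.left x (by linarith), hχ.right (-x) (by linarith),
          ← sub_eq_add_neg] using this
  have mv1 : EMem η ℓ v1 := EMem.of_continuous hη hℓ k2.continuous hT (R := 4) (C := C)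
    fun x hx => by
      rw [hTn]
      rcases le_abs.1 hx with h | h
      · have := (hr x (by linarith)).2
        simpa [hv1, hχm, (hχ.deriv_right (x := x) (by linarith)).1,
          (hχ.reflect_deriv_right (x := x) (by linarith)).1] using this
      · have := (hl x (by linarith)).2
        simpa [hv1, hχm, (hχ.deriv_left (x := x) (by linarith)).1,
          (hχ.reflect_deriv_left (x := x) (by linarith)).1] using this
  have cB : Continuous fun x => (coefB w x : ℂ) :=
    Complex.continuous_ofReal.comp (continuous_coefB w)
  have cC : Continuous fun x => ((coefC w x - q x ^ 2 : ℝ) : ℂ) :=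
    Complex.continuous_ofReal.comp ((continuous_coefC w).sub (hq.continuous.pow 2))
  -- The second derivative is read off from the equation, all of whose other terms are already known
  -- to be localized.
  have m2 := (((hf.add ((mv1.mul_bdd cB.aestronglyMeasurable fun x => (hK x).1).const_mul (-1))).add
    ((mv.mul_bdd cC.aestronglyMeasurable fun x => (hK x).2).const_mul (-1))).add
    (hm.const_mul (-βm))).add (hp.const_mul (-βp))
  refine ⟨v, v1, _, βm, βp, k1, k2, mv, mv1, m2.congr (Eventually.of_forall fun x => ?_),
    fun x => ?_⟩
  all_goals
    simp only [hv, hv1, lpsiSmooth, Pi.add_apply, Pi.smul_apply, smul_eq_mul]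
    push_cast
    ring

/-! ### Perturbation in `γ` and assembly of the far-field/core operator. -/

/-- A holomorphic family of operators which is bijective at `0` is invertible near `0`, with
holomorphic inverse. -/
theorem exists_equiv_of_bijective_zero {E G : Type*} [NormedAddCommGroup E] [NormedSpace ℂ E]
    [CompleteSpace E] [NormedAddCommGroup G] [NormedSpace ℂ G] [CompleteSpace G]
    {Φ : ℂ → E →L[ℂ] G} {r : ℝ} (hr : 0 < r) (hΦ : DifferentiableOn ℂ Φ (Metric.ball 0 r))
    (hb : Function.Bijective (Φ 0)) :
    ∃ δ, 0 < δ ∧ δ ≤ r ∧ ∃ F : ℂ → E ≃L[ℂ] G,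
      (∀ γ ∈ Metric.ball (0 : ℂ) δ, (F γ : E →L[ℂ] G) = Φ γ) ∧
      DifferentiableOn ℂ (fun γ => ((F γ).symm : G →L[ℂ] E)) (Metric.ball 0 δ) := by
  classical
  let e0 : E ≃L[ℂ] G := ContinuousLinearEquiv.ofBijective (Φ 0)
    (LinearMap.ker_eq_bot.2 hb.1) (LinearMap.range_eq_top.2 hb.2)
  have he0 : (e0 : E →L[ℂ] G) = Φ 0 := by ext x; rfl
  have hc : ContinuousAt Φ 0 :=
    (hΦ.differentiableAt (Metric.ball_mem_nhds 0 hr)).continuousAt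
  -- Invertible operators form an open set, so continuity of `Φ` makes `Φ γ` invertible near `0`.
  have hn : Set.range ((↑) : (E ≃L[ℂ] G) → E →L[ℂ] G) ∈ 𝓝 (Φ 0) := by
    rw [← he0]; exact ContinuousLinearEquiv.nhds e0
  obtain ⟨δ₁, hδ₁, hball⟩ := Metric.mem_nhds_iff.1 (hc.preimage_mem_nhds hn)
  have hex : ∀ γ ∈ Metric.ball (0 : ℂ) (min δ₁ r), ∃ e : E ≃L[ℂ] G, (e : E →L[ℂ] G) = Φ γ :=
    fun γ hγ => hball (Metric.ball_subset_ball (min_le_left _ _) hγ)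
  have : Nonempty (E ≃L[ℂ] G) := ⟨e0⟩
  choose! F hF using hex
  refine ⟨min δ₁ r, lt_min hδ₁ hr, min_le_right _ _, F, hF, ?_⟩
  have hi : ∀ γ ∈ Metric.ball (0 : ℂ) (min δ₁ r),
      ((F γ).symm : G →L[ℂ] E) = ContinuousLinearMap.inverse (Φ γ) := fun γ hγ => by
    rw [← hF γ hγ, ContinuousLinearMap.inverse_equiv]
  refine DifferentiableOn.congr (fun γ hγ => ?_) hi
  have h1 : DifferentiableAt ℂ (ContinuousLinearMap.inverse : (E →L[ℂ] G) → G →L[ℂ] E) (Φ γ) := by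
    rw [← hF γ hγ]
    exact (contDiffAt_map_inverse (n := 1) (F γ)).differentiableAt one_ne_zero
  exact h1.comp_differentiableWithinAt γ
    ((hΦ γ (Metric.ball_subset_ball (min_le_right _ _) hγ)).mono
      (Metric.ball_subset_ball (min_le_right _ _)))

section Core

variable {q : ℝ → ℝ} {w : ExpWeight 0 1} {χ : ℝ → ℝ} {η : ℝ} {W : ExpWeight (-η) η} {ℓ : ℝ≥0∞}

theorem farFieldCore_zero_ae (q : ℝ → ℝ) (w : ExpWeight 0 1) (hχ : IsCutoff χ)
    {v f f1 f2 : ℝ → ℂ} (hv : v =ᵐ[volume] f) (h1 : IsPrim f f1) (h2 : IsPrim f1 f2)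
    (βm βp : ℂ) :
    farFieldCore q w χ v βm βp 0 =ᵐ[volume] fun x => f2 x + (coefB w x : ℂ) * f1 x
      + ((coefC w x - q x ^ 2 : ℝ) : ℂ) * f x
      + βm * (lpsiSmooth q w (fun y => χ (-y)) x : ℂ) + βp * (lpsiSmooth q w χ x : ℂ) := by
  filter_upwards [Lpsi_ae (q := q) (w := w) (h1.isWeakDeriv.congr hv.symm (ae_eq_refl _))
    h2.isWeakDeriv, LpsiShift_modeLeft_zero_ae q w hχ, LpsiShift_modeRight_zero_ae q w hχ, hv]
    with x hx1 hx2 hx3 hx4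
  rw [farFieldCore, hx2, hx3, LpsiShift, hx1, hx4]
  simp

/-- The function `v + β₋ χ₋ + β₊ χ₊` solves the homogeneous equation and differs from a constant at
each end by the integrable function `v`, so it vanishes identically. -/
theorem eq_zero_of_farFieldCore_zero (hq : IsCriticalFront q) (hχ : IsCutoff χ) (hη : 0 < η)
    (hℓ : ℓ = 1 ∨ ℓ = ⊤) {v : ExpSobolev W 2 ℓ} {βm βp : ℂ}
    (h : farFieldCore q w χ v βm βp 0 =ᵐ[volume] 0) : v = 0 ∧ βm = 0 ∧ βp = 0 := by
  obtain ⟨v1, v2, hv1, hv2, -, -⟩ := ExpSobolev.isWeakDeriv W v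
  obtain ⟨f1, hf1, h2⟩ := hv2.exists_isPrim
  obtain ⟨f, hf, h1'⟩ := hv1.exists_isPrim
  have h1 : IsPrim f f1 := h1'.congr hf1
  have hfi : Integrable f := (ExpSobolev.eMem W v |>.congr hf).integrable hη hℓ
  have s1 := (contDiff_infty_iff_deriv.1 hχ.smooth).2
  have t1 := (contDiff_infty_iff_deriv.1 hχ.reflect_smooth).2
  have p0 := isPrim_ofReal (fun x => (hχ.smooth.differentiable (by simp) x).hasDerivAt)
    s1.continuous
  have p1 := isPrim_ofReal (fun x => (s1.differentiable (by simp) x).hasDerivAt)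
    (s1.continuous_deriv (by simp))
  have r0 := isPrim_ofReal
    (fun x => (hχ.reflect_smooth.differentiable (by simp) x).hasDerivAt) t1.continuous
  have r1 := isPrim_ofReal (fun x => (t1.differentiable (by simp) x).hasDerivAt)
    (t1.continuous_deriv (by simp))
  have k1 := (h1.add (r0.const_smul βm)).add (p0.const_smul βp)
  have k2 := (h2.add (r1.const_smul βm)).add (p1.const_smul βp)
  have hl : ∀ x ∈ Iio (-3 : ℝ), χ (-x) = 1 ∧ χ x = 0 := fun x hx => by
    have hx' : x < -3 := hx
    exact ⟨hχ.right _ (by linarith), hχ.left _ (by linarith)⟩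
  have hr : ∀ x ∈ Ioi (3 : ℝ), χ (-x) = 0 ∧ χ x = 1 := fun x hx => by
    have hx' : 3 < x := hx
    exact ⟨hχ.left _ (by linarith), hχ.right _ (by linarith)⟩
  have hψ := eq_zero_of_solution hq w k1 k2 (by
    filter_upwards [farFieldCore_zero_ae q w hχ hf h1 h2 βm βp, h] with x hx1 hx2
    rw [hx1] at hx2
    refine Eq.trans ?_ hx2
    simp only [lpsiSmooth, Pi.add_apply, Pi.smul_apply, smul_eq_mul]
    push_cast
    ring) (βm := βm) (βp := βp)
    (hfi.integrableOn.congr_fun (fun x hx => by simp [hl x hx]) measurableSet_Iio)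
    (hfi.integrableOn.congr_fun (fun x hx => by simp [hr x hx]) measurableSet_Ioi)
  simp only [Pi.add_apply, Pi.smul_apply, smul_eq_mul] at hψ
  -- Far to the left the identity says `v = -βm`, and a nonzero constant is not integrable on a
  -- half-line.
  have hm : βm = 0 := by
    have : IntegrableOn (fun _ : ℝ => -βm) (Iio (-3)) :=
      hfi.integrableOn.congr_fun (fun x hx => by
        have := hψ x
        rw [(hl x hx).1, (hl x hx).2] at this
        simp only [Complex.ofReal_one, Complex.ofReal_zero] at this
        linear_combination this) measurableSet_Iio
    simpa [integrableOn_const_iff] using this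
  have hp : βp = 0 := by
    have : IntegrableOn (fun _ : ℝ => -βp) (Ioi 3) :=
      hfi.integrableOn.congr_fun (fun x hx => by
        have := hψ x
        rw [(hr x hx).1, (hr x hx).2] at this
        simp only [Complex.ofReal_one, Complex.ofReal_zero] at this
        linear_combination this) measurableSet_Ioi
    simpa [integrableOn_const_iff] using this
  refine ⟨ExpSobolev.ext W 2 ℓ ?_, hm, hp⟩
  filter_upwards [hf, ExpSobolev.coeFn_zero W 2 ℓ] with x hx hx0
  have := hψ x
  rw [hm, hp] at this
  rw [hx, hx0]
  simpa using this

/-- The elements `mm` and `mp` serve only to certify that the residuals of the cutoffs lie in the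
weighted space. -/
theorem exists_farFieldCore_zero_eq (hq : IsCriticalFront q) (hχ : IsCutoff χ) (hη : 0 < η)
    (hη4 : η < 1 / 4) (hℓ : ℓ = 1 ∨ ℓ = ⊤) {mm mp : ExpSobolev W 0 ℓ}
    (hm : (mm : ℝ → ℂ) =ᵐ[volume] LpsiShift q w 0 (modeLeft χ 0))
    (hp : (mp : ℝ → ℂ) =ᵐ[volume] LpsiShift q w 0 (modeRight χ 0)) (f : ExpSobolev W 0 ℓ) :
    ∃ (v : ExpSobolev W 2 ℓ) (βm βp : ℂ), farFieldCore q w χ v βm βp 0 =ᵐ[volume] f := by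
  obtain ⟨v, v1, v2, βm, βp, h1, h2, m0, m1, m2, he⟩ := hq.exists_core_solution w hχ hη hη4 hℓ
    (ExpSobolev.eMem_zero W f)
    ((ExpSobolev.eMem_zero W mm).congr (hm.trans (LpsiShift_modeLeft_zero_ae q w hχ)))
    ((ExpSobolev.eMem_zero W mp).congr (hp.trans (LpsiShift_modeRight_zero_ae q w hχ)))
  obtain ⟨V, hV⟩ := ExpSobolev.exists_of_eMem W h1 h2 m0 m1 m2
  exact ⟨V, βm, βp, (farFieldCore_zero_ae q w hχ hV h1 h2 βm βp).trans
    (Eventually.of_forall he)⟩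

/-- The dependence on `γ` is polynomial in the core part, and in the far-field part enters through
the holomorphic mode residuals attached to the coordinates `β₋`, `β₊`. -/
theorem exists_farFieldCore_family [Fact (1 ≤ ℓ)] (hq : IsCriticalFront q) (hχ : IsCutoff χ)
    (hη4 : η < 1 / 4) (hℓ : ℓ = 1 ∨ ℓ = ⊤) :
    ∃ r, 0 < r ∧ ∃ Φ : ℂ → (ExpSobolev W 2 ℓ × ℂ × ℂ) →L[ℂ] ExpSobolev W 0 ℓ,
      DifferentiableOn ℂ Φ (Metric.ball 0 r) ∧
      ∀ γ ∈ Metric.ball (0 : ℂ) r, ∀ (v : ExpSobolev W 2 ℓ) (βm βp : ℂ),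
        (Φ γ (v, βm, βp) : ℝ → ℂ) =ᵐ[volume] farFieldCore q w χ v βm βp γ := by
  obtain ⟨δm, hδm, mm, hmd, hm⟩ := exists_modeLeft_family W ℓ hq w hχ hη4 hℓ
  obtain ⟨δp, hδp, mp, hpd, hp⟩ := exists_modeRight_family W ℓ hq w hχ hη4 hℓ
  obtain ⟨J, hJ⟩ := exists_inclusion W ℓ
  obtain ⟨Q, hQ0, hQ⟩ := hq.exists_le
  obtain ⟨A, hA⟩ := exists_lpsi_operator W ℓ hq.continuous
    (fun x => by rw [abs_of_pos (hq.pos x)]; exact hQ x) w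
  let P := ContinuousLinearMap.fst ℂ (ExpSobolev W 2 ℓ) (ℂ × ℂ)
  let P1 := (ContinuousLinearMap.fst ℂ ℂ ℂ).comp
    (ContinuousLinearMap.snd ℂ (ExpSobolev W 2 ℓ) (ℂ × ℂ))
  let P2 := (ContinuousLinearMap.snd ℂ ℂ ℂ).comp
    (ContinuousLinearMap.snd ℂ (ExpSobolev W 2 ℓ) (ℂ × ℂ))
  refine ⟨min δm δp, lt_min hδm hδp, fun γ => (A.comp P - γ ^ 2 • J.comp P)
    + ContinuousLinearMap.smulRightL ℂ _ _ P1 (mm γ)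
    + ContinuousLinearMap.smulRightL ℂ _ _ P2 (mp γ), ?_, fun γ hγ v βm βp => ?_⟩
  · refine DifferentiableOn.add (DifferentiableOn.add ?_ ?_) ?_
    · exact (Differentiable.const_sub (by fun_prop) _).differentiableOn
    · exact (ContinuousLinearMap.differentiable _).comp_differentiableOn
        (hmd.mono (Metric.ball_subset_ball (min_le_left _ _)))
    · exact (ContinuousLinearMap.differentiable _).comp_differentiableOn
        (hpd.mono (Metric.ball_subset_ball (min_le_right _ _)))
  · have e : (A.comp P - γ ^ 2 • J.comp P + ContinuousLinearMap.smulRightL ℂ _ _ P1 (mm γ)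
        + ContinuousLinearMap.smulRightL ℂ _ _ P2 (mp γ)) (v, βm, βp)
        = A v + (-γ ^ 2) • J v + βm • mm γ + βp • mp γ := by
      change A v - γ ^ 2 • J v + βm • mm γ + βp • mp γ = _
      rw [neg_smul, sub_eq_add_neg]
    simp only [e]
    filter_upwards [ExpSobolev.coeFn_add W 0 ℓ (A v + (-γ ^ 2) • J v + βm • mm γ) (βp • mp γ),
      ExpSobolev.coeFn_add W 0 ℓ (A v + (-γ ^ 2) • J v) (βm • mm γ),
      ExpSobolev.coeFn_add W 0 ℓ (A v) ((-γ ^ 2) • J v),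
      ExpSobolev.coeFn_smul W 0 ℓ (-γ ^ 2) (J v), ExpSobolev.coeFn_smul W 0 ℓ βm (mm γ),
      ExpSobolev.coeFn_smul W 0 ℓ βp (mp γ), hA v, hJ v,
      hm γ (Metric.ball_subset_ball (min_le_left _ _) hγ),
      hp γ (Metric.ball_subset_ball (min_le_right _ _) hγ)] with x a1 a2 a3 a4 a5 a6 a7 a8 a9 a10
    rw [a1, a2, a3, a4, a5, a6, a7, a8, a9, a10, farFieldCore, show LpsiShift q w γ v x
      = Lpsi q w v x - γ ^ 2 * v x from rfl]
    ring

end Core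

end GLFront

/-! ### The main theorem. -/

open GLFront in
theorem mainTheorem6 (q : ℝ → ℝ) (hq : GLFront.IsCriticalFront q)
    (w : GLFront.ExpWeight 0 1) (χ : ℝ → ℝ) (hχ : GLFront.IsCutoff χ) :
    ∃ η₀ : ℝ, 0 < η₀ ∧ ∀ η : ℝ, 0 < η → η < η₀ →
      ∀ (W : GLFront.ExpWeight (-η) η) (ℓ : ℝ≥0∞) [Fact (1 ≤ ℓ)], ℓ = 1 ∨ ℓ = ⊤ →
        ∃ δ : ℝ, 0 < δ ∧
          ∃ (F : ℂ → ((GLFront.ExpSobolev W 2 ℓ × ℂ × ℂ) ≃L[ℂ] GLFront.ExpSobolev W 0 ℓ))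
            (T : ℂ → (GLFront.ExpSobolev W 0 ℓ →L[ℂ] GLFront.ExpSobolev W 2 ℓ))
            (Bm Bp : ℂ → (GLFront.ExpSobolev W 0 ℓ →L[ℂ] ℂ)),
            (∀ γ ∈ Metric.ball (0 : ℂ) δ,
              ∀ (v : GLFront.ExpSobolev W 2 ℓ) (βm βp : ℂ),
                (F γ (v, βm, βp) : ℝ → ℂ) =ᵐ[volume]
                  GLFront.farFieldCore q w χ v βm βp γ) ∧
            (∀ γ ∈ Metric.ball (0 : ℂ) δ, ∀ f : GLFront.ExpSobolev W 0 ℓ,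
              (F γ).symm f = (T γ f, Bm γ f, Bp γ f)) ∧
            AnalyticOnNhd ℂ T (Metric.ball 0 δ) ∧
            AnalyticOnNhd ℂ Bm (Metric.ball 0 δ) ∧
            AnalyticOnNhd ℂ Bp (Metric.ball 0 δ) := by
  -- The value `1/4` is the rate at which the mode residuals are known to decay; they must decay
  -- faster than the weight `e^{η|x|}` grows.
  refine ⟨1 / 4, by norm_num, fun η hη hη4 W ℓ _ hℓ => ?_⟩
  obtain ⟨r, hr, Φ, hΦ, hΦe⟩ := exists_farFieldCore_family (W := W) (w := w) hq hχ hη4 hℓ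
  have h0 := hΦe 0 (Metric.mem_ball_self hr)
  obtain ⟨δm, hδm, mm, -, hm⟩ := exists_modeLeft_family W ℓ hq w hχ hη4 hℓ
  obtain ⟨δp, hδp, mp, -, hp⟩ := exists_modeRight_family W ℓ hq w hχ hη4 hℓ
  have hb : Function.Bijective (Φ 0) := by
    constructor
    · rw [injective_iff_map_eq_zero]
      rintro ⟨v, βm, βp⟩ hv
      have e := h0 v βm βp
      rw [hv] at e
      obtain ⟨rfl, rfl, rfl⟩ := eq_zero_of_farFieldCore_zero hq hχ hη hℓ
        (e.symm.trans (ExpSobolev.coeFn_zero W 0 ℓ))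
      rfl
    · intro f
      obtain ⟨v, βm, βp, h⟩ := exists_farFieldCore_zero_eq hq hχ hη hη4 hℓ
        (hm 0 (Metric.mem_ball_self hδm)) (hp 0 (Metric.mem_ball_self hδp)) f
      exact ⟨(v, βm, βp), ExpSobolev.ext W 0 ℓ ((h0 v βm βp).trans h)⟩
  obtain ⟨δ, hδ, hδr, F, hF, hFd⟩ := exists_equiv_of_bijective_zero hr hΦ hb
  let P := ContinuousLinearMap.fst ℂ (ExpSobolev W 2 ℓ) (ℂ × ℂ)
  let P1 := (ContinuousLinearMap.fst ℂ ℂ ℂ).comp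
    (ContinuousLinearMap.snd ℂ (ExpSobolev W 2 ℓ) (ℂ × ℂ))
  let P2 := (ContinuousLinearMap.snd ℂ ℂ ℂ).comp
    (ContinuousLinearMap.snd ℂ (ExpSobolev W 2 ℓ) (ℂ × ℂ))
  refine ⟨δ, hδ, F, fun γ => P.comp ((F γ).symm : _ →L[ℂ] _),
    fun γ => P1.comp ((F γ).symm : _ →L[ℂ] _), fun γ => P2.comp ((F γ).symm : _ →L[ℂ] _),
    fun γ hγ v βm βp => ?_, fun γ _ f => rfl, ?_, ?_, ?_⟩
  · have e : F γ (v, βm, βp) = Φ γ (v, βm, βp) := by rw [← hF γ hγ]; rfl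
    rw [e]
    exact hΦe γ (Metric.ball_subset_ball hδr hγ) v βm βp
  -- Complex differentiability in operator norm on an open disc is analyticity, and composing with a
  -- fixed projection preserves it.
  all_goals
    exact (DifferentiableOn.clm_comp (differentiableOn_const _) hFd).analyticOnNhd
      Metric.isOpen_ball
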